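/- **Setting.** Let $n\ge 1$, $m\ge 0$, $p\in[1,\infty]$. Let $\Omega\subset\mathbb R^n$ be a bounded connected open set with Lipschitz boundary (locally, after a rotation, the region strictly above the graph of a Lipschitz function); this includes domains with piecewise $C^1$ boundary in the usual sense. Let $\sigma$ be the $(n-1)$-dimensional Hausdorff measure on $\partial\Omega$ (normalized as surface measure) and $\mathbf n$ the exterior unit normal, defined $\sigma$-a.e. Let $Y\subseteq\mathbb R^m$ and $Z\subseteq\mathbb R^{m\times n}$ be closed and convex, and write $z=(z_1,\dots,z_n)$, $z_j\in\mathbb R^m$. Let $I$ be any (possibly uncountable) index set, and let $L,A_i,B_i,C_i:\Omega\times Y\times Z\to\mathbb R$ and $A_{\partial,i},B_{\partial,i},C_{\partial,i}:\partial\Omega\times Y\to\mathbb R$ $(i\in I)$ be functions such that * for every $x\in\Omega$, $L,B_i,C_i$ are convex and $A_i$ is affine in $(y,z)\in Y\times Z$; for every $x\in\partial\Omega$, $B_{\partial,i},C_{\partial,i}$ are convex and $A_{\partial,i}$ is affine in $y\in Y$; * $L,C_i,C_{\partial,i}$ are Borel measurable, and for each $i$ the sets $K_i=\{(x,y,z)\in\Omega\times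 Y\times Z: A_i=0,\ B_i\le 0\}$ and $K_{\partial,i}=\{(x,y)\in\partial\Omega\times Y: A_{\partial,i}=0,\ B_{\partial,i}\le0\}$ are relatively closed in $\Omega\times Y\times Z$ and in $\partial\Omega\times Y$ (for instance, $A_i,B_i,A_{\partial,i},B_{\partial,i}$ are continuous). Integrals of $L,C_i,C_{\partial,i}$ are taken in $[-\infty,+\infty]$, as $\int f^+-\int f^-$, with value $+\infty$ if $\int f^+=+\infty$; an infimum over the empty set is $+\infty$. **Classical problem.** Let $M$ be the infimum of $\int_\Omega L(x,y(x),Dy(x))\,dx$ over all $y\in W^{1,p}(\Omega;\mathbb R^m)$ with $y(x)\in Y$ and $Dy(x)\in Z$ for a.e. $x\in\Omega$ such that, for every $i\in I$, $A_i(x,y,Dy)=0$ and $B_i(x,y,Dy)\le0$ a.e. in $\Omega$, $A_{\partial,i}(x,y)=0$ and $B_{\partial,i}(x,y)\le0$ $\sigma$-a.e. on $\partial\Omega$, $\int_\Omega C_i(x,y,Dy)\,dx\le0$ and $\int_{\partial\Omega}C_{\partial,i}(x,y)\,d\sigma\le0$, where $y$ on $\partial\Omega$ is the Sobolev trace. **Occupation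 measures.** Let $\mathcal O_p^{\mathrm{aff}}$ be the set of pairs $(\mu,\mu_\partial)$ of positive Radon measures on $\overline\Omega\times Y\times Z$ and $\partial\Omega\times Y$ such that * $\mu(\overline\Omega\times Y\times Z)=|\Omega|$; * if $p=\infty$, $\operatorname{supp}\mu$ and $\operatorname{supp}\mu_\partial$ are compact; if $p<\infty$, $\int_{\Omega\times Y\times Z}\big(\|y\|^p+\sum_j\|z_j\|^p\big)d\mu<\infty$ and $\int_{\partial\Omega\times Y}\|y\|^p\,d\mu_\partial<\infty$; * $\mathbf n(x)$ is defined for $\mu_\partial$-a.e. $(x,y)$, and for all $\phi_1\in C^\infty(\overline\Omega)$, $\phi_2\in C^\infty(\overline\Omega;\mathbb R^m)$ (restrictions of smooth functions on $\mathbb R^n$) $$\int_{\Omega\times Y\times Z}\Big[\frac{\partial\phi_1}{\partial x}+y^\top\frac{\partial\phi_2}{\partial x}+\phi_2^\top z\Big]d\mu=\int_{\partial\Omega\times Y}(\phi_1+y^\top\phi_2)\,\mathbf n\,d\mu_\partial .$$ Let $\mathcal O_p\subseteq\mathcal O_p^{\mathrm{aff}}$ be the set of those pairs for which moreover $$\int_{\Omega\times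 Y\times Z}\Big[\frac{\partial\phi}{\partial x}(x,y)+\frac{\partial\phi}{\partial y}(x,y)\,z\Big]d\mu=\int_{\partial\Omega\times Y}\phi(x,y)\,\mathbf n(x)\,d\mu_\partial$$ for all $\phi\in\mathbf F_p$. Here $\mathbf F_p$ consists of the functions on $\overline\Omega\times Y$ that are restrictions of $C^\infty$ functions $\phi$ on $\mathbb R^n\times\mathbb R^m$ satisfying, if $p<\infty$, for some $c>0$ and all $(x,y)\in\Omega\times Y$, $\|\partial_x\phi\|\le c(1+\|y\|^p)$, $\|\partial_y\phi\|\le c(1+\|y\|^{p-1})$ and $|\phi|\le c(1+\|y\|^p)$; no growth condition is imposed if $p=\infty$. **Relaxations.** Let $M_{\mathrm r}^{\mathrm{aff}}$ (resp. $M_{\mathrm r}$) be the infimum of $\int_{\Omega\times Y\times Z}L\,d\mu$ over $(\mu,\mu_\partial)\in\mathcal O_p^{\mathrm{aff}}$ (resp. $\mathcal O_p$) such that $\mu$ is carried by $\Omega\times Y\times Z$ and, for every $i\in I$, $\operatorname{supp}\mu\cap(\Omega\times Y\times Z)\subseteq K_i$, $\operatorname{supp}\mu_\partial\subseteq K_{\partial,i}$,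 $\int_{\Omega\times Y\times Z} C_i\,d\mu\le0$ and $\int_{\partial\Omega\times Y} C_{\partial,i}\,d\mu_\partial\le0$. **Statement.** Under these assumptions, $M_{\mathrm r}=M_{\mathrm r}^{\mathrm{aff}}=M$ (in $[-\infty,+\infty]$). -/

import Mathlib

open MeasureTheory Set Filter Topology
open scoped ENNReal ContDiff

noncomputable section

namespace OccMeasure

/-- `ℝⁿ` with its Euclidean norm. -/
abbrev Vec (n : ℕ) := EuclideanSpace ℝ (Fin n)

/-- Real `m × n` matrices `z = (z₁, …, z_n)`, stored by columns `z_j ∈ ℝᵐ`. -/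
abbrev Jac (n m : ℕ) := Fin n → Vec m

/-- The partial derivative `∂f/∂x_j`. -/
def pderiv {n : ℕ} {G : Type*} [NormedAddCommGroup G] [NormedSpace ℝ G]
    (j : Fin n) (f : Vec n → G) (x : Vec n) : G :=
  fderiv ℝ f x (EuclideanSpace.single j 1)

/-- The integral of a real function with values in `[-∞, +∞]`: it is `∫ f⁺ - ∫ f⁻`, and `+∞` as
soon as `∫ f⁺ = +∞`. For integrable `f` it is the usual integral. -/
def extIntegral {α : Type*} [MeasurableSpace α] (μ : Measure α) (f : α → ℝ) : EReal :=
  open Classical in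
  if ∫⁻ a, ENNReal.ofReal (f a) ∂μ = ⊤ then ⊤
  else ((∫⁻ a, ENNReal.ofReal (f a) ∂μ : ℝ≥0∞) : EReal)
    - ((∫⁻ a, ENNReal.ofReal (-f a) ∂μ : ℝ≥0∞) : EReal)

/-! ### Domains, surface measure, exterior normal -/

/-- A bounded connected open set whose boundary is locally, in suitable orthonormal coordinates,
the graph of a Lipschitz function, with the set lying on one side: near each boundary point there
are a unit vector `e` and a Lipschitz function `g` on the hyperplane `e^⊥` (extended to the whole
space, but only evaluated on `e^⊥`) such that `x` is in the set iff `⟪x, e⟫ > g (x - ⟪x, e⟫ e)`. -/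
structure IsLipschitzDomain {n : ℕ} (Ω : Set (Vec n)) : Prop where
  isOpen : IsOpen Ω
  isConnected : IsConnected Ω
  isBounded : Bornology.IsBounded Ω
  localGraph : ∀ x₀ ∈ frontier Ω, ∃ (e : Vec n) (g : Vec n → ℝ),
    ‖e‖ = 1 ∧ (∃ K, LipschitzWith K g) ∧
      ∀ᶠ x in 𝓝 x₀, (x ∈ Ω ↔ g (x - inner ℝ x e • e) < inner ℝ x e)

/-- The surface measure `σ` of `∂Ω`, that is the `(n-1)`-dimensional Hausdorff measure with the
usual normalization, for which `k`-dimensional Hausdorff measure is Lebesgue measure on `ℝᵏ`. -/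
def surf {n : ℕ} (Ω : Set (Vec n)) : Measure (Vec n) :=
  (μHE[n - 1] : Measure (Vec n)).restrict (frontier Ω)

/-- `ν` is the exterior unit normal of `Ω` at `x`: seen from `x`, the set `Ω` is to first order
the half-space `{v | ⟪v, ν⟫ < 0}`. -/
def IsOuterNormal {n : ℕ} (Ω : Set (Vec n)) (x ν : Vec n) : Prop :=
  ‖ν‖ = 1 ∧ ∀ ε > 0, ∀ᶠ v in 𝓝 (0 : Vec n),
    (inner ℝ v ν < -(ε * ‖v‖) → x + v ∈ Ω) ∧ (ε * ‖v‖ < inner ℝ v ν → x + v ∉ Ω)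

/-- The exterior unit normal is unique where it exists. -/
theorem IsOuterNormal.unique {n : ℕ} {Ω : Set (Vec n)} {x ν ν' : Vec n}
    (h : IsOuterNormal Ω x ν) (h' : IsOuterNormal Ω x ν') : ν = ν' := by
  by_contra hne
  have hνν : inner ℝ ν ν = (1 : ℝ) := by rw [real_inner_self_eq_norm_sq, h.1]; norm_num
  have hνν' : inner ℝ ν' ν' = (1 : ℝ) := by rw [real_inner_self_eq_norm_sq, h'.1]; norm_num
  have hw : 0 < ‖ν' - ν‖ := norm_pos_iff.2 (sub_ne_zero.2 (Ne.symm hne))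
  have hsq : ‖ν' - ν‖ ^ 2 = 2 - 2 * inner ℝ ν' ν := by
    rw [norm_sub_sq_real, h.1, h'.1]; ring
  have hε : 0 < ‖ν' - ν‖ / 4 := by positivity
  have hev := (h.2 _ hε).and (h'.2 _ hε)
  have ht : Tendsto (fun t : ℝ => t • (ν' - ν)) (𝓝[>] 0) (𝓝 0) := by
    have : Tendsto (fun t : ℝ => t • (ν' - ν)) (𝓝 0) (𝓝 ((0 : ℝ) • (ν' - ν))) :=
      (continuous_id.smul continuous_const).tendsto 0
    rw [zero_smul] at this
    exact this.mono_left nhdsWithin_le_nhds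
  obtain ⟨t, ⟨h1, h2⟩, htpos⟩ := ((ht.eventually hev).and self_mem_nhdsWithin).exists
  have htpos : 0 < t := htpos
  have hn : ‖t • (ν' - ν)‖ = t * ‖ν' - ν‖ := by rw [norm_smul, Real.norm_of_nonneg htpos.le]
  have e1 : inner ℝ (t • (ν' - ν)) ν = -(t * (‖ν' - ν‖ ^ 2 / 2)) := by
    rw [real_inner_smul_left, inner_sub_left, hνν, hsq]; ring
  have e2 : inner ℝ (t • (ν' - ν)) ν' = t * (‖ν' - ν‖ ^ 2 / 2) := by
    rw [real_inner_smul_left, inner_sub_left, hνν', real_inner_comm, hsq]; ring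
  have key : ‖ν' - ν‖ / 4 * (t * ‖ν' - ν‖) < t * (‖ν' - ν‖ ^ 2 / 2) := by
    have : 0 < t * ‖ν' - ν‖ ^ 2 := by positivity
    nlinarith
  refine h2.2 ?_ (h1.1 ?_)
  · rw [hn, e2]; exact key
  · rw [hn, e1]; linarith

/-- The exterior unit normal vector `𝐧(x)` (and `0` where there is none). -/
def outerNormal {n : ℕ} (Ω : Set (Vec n)) (x : Vec n) : Vec n :=
  open Classical in if h : ∃ ν, IsOuterNormal Ω x ν then h.choose else 0

/-! ### Sobolev functions and traces -/

/-- `y ∈ W^{1,p}(Ω; ℝᵐ)` with weak derivative `Dy = z`. -/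
structure IsSobolev {n m : ℕ} (Ω : Set (Vec n)) (p : ℝ≥0∞) (y : Vec n → Vec m)
    (z : Vec n → Jac n m) : Prop where
  memLp : MemLp y p (volume.restrict Ω)
  memLp_deriv : ∀ j, MemLp (fun x => z x j) p (volume.restrict Ω)
  weakDeriv : ∀ ψ : Vec n → ℝ, ContDiff ℝ ∞ ψ → HasCompactSupport ψ → tsupport ψ ⊆ Ω → ∀ j,
    ∫ x in Ω, pderiv j ψ x • y x = -∫ x in Ω, ψ x • z x j

/-- `T` is the trace on `∂Ω` of the Sobolev function `y` with weak derivative `z`. The trace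
operator is the continuous extension to `W^{1,1}(Ω)`, which contains every `W^{1,p}(Ω)`, of the
restriction `u ↦ u|_∂Ω` of functions that are smooth up to the boundary. -/
def IsTrace {n m : ℕ} (Ω : Set (Vec n)) (y : Vec n → Vec m) (z : Vec n → Jac n m)
    (T : Vec n → Vec m) : Prop :=
  MemLp T 1 (surf Ω) ∧ ∃ u : ℕ → Vec n → Vec m, (∀ k, ContDiff ℝ ∞ (u k)) ∧
    Tendsto (fun k => eLpNorm (u k - y) 1 (volume.restrict Ω)) atTop (𝓝 0) ∧
    (∀ j, Tendsto (fun k => eLpNorm (fun x => pderiv j (u k) x - z x j) 1 (volume.restrict Ω))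
      atTop (𝓝 0)) ∧
    Tendsto (fun k => eLpNorm (u k - T) 1 (surf Ω)) atTop (𝓝 0)

/-! ### The variational problem -/

/-- The data of the problem. Only the values of `L`, `A i`, `B i`, `C i` on `Ω × Y × Z` and those
of `A' i`, `B' i`, `C' i` (the boundary data `A_{∂,i}`, `B_{∂,i}`, `C_{∂,i}`) on `∂Ω × Y` are
ever used. -/
structure Problem (n m : ℕ) (I : Type*) where
  Ω : Set (Vec n)
  Y : Set (Vec m)
  Z : Set (Jac n m)
  L : Vec n × Vec m × Jac n m → ℝ
  A : I → Vec n × Vec m × Jac n m → ℝ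
  B : I → Vec n × Vec m × Jac n m → ℝ
  C : I → Vec n × Vec m × Jac n m → ℝ
  A' : I → Vec n × Vec m → ℝ
  B' : I → Vec n × Vec m → ℝ
  C' : I → Vec n × Vec m → ℝ

namespace Problem

variable {n m : ℕ} {I : Type*} (P : Problem n m I)

/-- The set `Ω × Y × Z`. -/
def bulk : Set (Vec n × Vec m × Jac n m) := P.Ω ×ˢ P.Y ×ˢ P.Z

/-- The set `∂Ω × Y`. -/
def bdry : Set (Vec n × Vec m) := frontier P.Ω ×ˢ P.Y

/-- The points of `Ω × Y × Z` with `A_i = 0` and `B_i ≤ 0`. -/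
def bulkSet (i : I) : Set (Vec n × Vec m × Jac n m) := {w ∈ P.bulk | P.A i w = 0 ∧ P.B i w ≤ 0}

/-- The points of `∂Ω × Y` with `A_{∂,i} = 0` and `B_{∂,i} ≤ 0`. -/
def bdrySet (i : I) : Set (Vec n × Vec m) := {w ∈ P.bdry | P.A' i w = 0 ∧ P.B' i w ≤ 0}

/-- `y` (with weak derivative `z` and trace `T`) is admissible in the classical problem. -/
structure IsAdmissible (p : ℝ≥0∞) (y : Vec n → Vec m) (z : Vec n → Jac n m)
    (T : Vec n → Vec m) : Prop where
  sobolev : IsSobolev P.Ω p y z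
  trace : IsTrace P.Ω y z T
  mem_Y : ∀ᵐ x ∂volume.restrict P.Ω, y x ∈ P.Y
  mem_Z : ∀ᵐ x ∂volume.restrict P.Ω, z x ∈ P.Z
  bulk_constr : ∀ i, ∀ᵐ x ∂volume.restrict P.Ω,
    P.A i (x, y x, z x) = 0 ∧ P.B i (x, y x, z x) ≤ 0
  bdry_constr : ∀ i, ∀ᵐ x ∂surf P.Ω, P.A' i (x, T x) = 0 ∧ P.B' i (x, T x) ≤ 0
  bulk_int : ∀ i, extIntegral (volume.restrict P.Ω) (fun x => P.C i (x, y x, z x)) ≤ 0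
  bdry_int : ∀ i, extIntegral (surf P.Ω) (fun x => P.C' i (x, T x)) ≤ 0

/-- The value `M` of the classical problem (`+∞` if nothing is admissible). -/
def M (p : ℝ≥0∞) : EReal :=
  sInf {v | ∃ y z T, P.IsAdmissible p y z T ∧
    v = extIntegral (volume.restrict P.Ω) (fun x => P.L (x, y x, z x))}

/-! ### Occupation measures -/

/-- `(μ, μ')` is a pair of affinely relaxed occupation measures; `μ'` is the boundary measure.
The field `normal_ae` says that the normal in the integrand of `liouville` is defined
`μ'`-almost everywhere. -/
structure IsAffOcc (p : ℝ≥0∞) (μ : Measure (Vec n × Vec m × Jac n m))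
    (μ' : Measure (Vec n × Vec m)) : Prop where
  radon : IsLocallyFiniteMeasure μ
  radon' : IsLocallyFiniteMeasure μ'
  carrier : μ (closure P.Ω ×ˢ P.Y ×ˢ P.Z)ᶜ = 0
  carrier' : μ' P.bdryᶜ = 0
  mass : μ (closure P.Ω ×ˢ P.Y ×ˢ P.Z) = volume P.Ω
  compact : p = ⊤ → IsCompact μ.support ∧ IsCompact μ'.support
  moment : p ≠ ⊤ →
    ∫⁻ w in P.bulk, (‖w.2.1‖ₑ ^ p.toReal + ∑ j, ‖w.2.2 j‖ₑ ^ p.toReal) ∂μ < ⊤ ∧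
    ∫⁻ w in P.bdry, ‖w.2‖ₑ ^ p.toReal ∂μ' < ⊤
  normal_ae : ∀ᵐ w ∂μ', ∃ ν, IsOuterNormal P.Ω w.1 ν
  liouville : ∀ (φ₁ : Vec n → ℝ) (φ₂ : Vec n → Vec m), ContDiff ℝ ∞ φ₁ → ContDiff ℝ ∞ φ₂ → ∀ j,
    ∫ w in P.bulk, (pderiv j φ₁ w.1 + inner ℝ w.2.1 (pderiv j φ₂ w.1)
        + inner ℝ (φ₂ w.1) (w.2.2 j)) ∂μ
      = ∫ w in P.bdry, (φ₁ w.1 + inner ℝ w.2 (φ₂ w.1)) * outerNormal P.Ω w.1 j ∂μ'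

/-- The class `𝐅_p` of test functions on `Ω × Y` that are smooth up to the boundary, with
polynomial growth if `p < ∞`. -/
structure IsTest (p : ℝ≥0∞) (φ : Vec n × Vec m → ℝ) : Prop where
  smooth : ContDiff ℝ ∞ φ
  growth : p ≠ ⊤ → ∃ c : ℝ, 0 < c ∧ ∀ x ∈ P.Ω, ∀ y ∈ P.Y,
    ‖fderiv ℝ (fun a => φ (a, y)) x‖ ≤ c * (1 + ‖y‖ ^ p.toReal) ∧
    ‖fderiv ℝ (fun b => φ (x, b)) y‖ ≤ c * (1 + ‖y‖ ^ (p.toReal - 1)) ∧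
    |φ (x, y)| ≤ c * (1 + ‖y‖ ^ p.toReal)

/-- `(μ, μ')` is a pair of relaxed occupation measures. -/
structure IsOcc (p : ℝ≥0∞) (μ : Measure (Vec n × Vec m × Jac n m))
    (μ' : Measure (Vec n × Vec m)) : Prop extends P.IsAffOcc p μ μ' where
  liouville_nonlinear : ∀ φ, P.IsTest p φ → ∀ j,
    ∫ w in P.bulk, (pderiv j (fun a => φ (a, w.2.1)) w.1
        + fderiv ℝ (fun b => φ (w.1, b)) w.2.1 (w.2.2 j)) ∂μ
      = ∫ w in P.bdry, φ w * outerNormal P.Ω w.1 j ∂μ'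

/-- The constraints of the relaxed problems. As `Ω` is open, the support of `μ` is taken relative
to `Ω × Y × Z`: the measure `μ` does not charge the complement of `Ω × Y × Z`, and the points of
its support in `Ω × Y × Z` satisfy the constraints. -/
structure IsFeasible (μ : Measure (Vec n × Vec m × Jac n m))
    (μ' : Measure (Vec n × Vec m)) : Prop where
  carrier : μ P.bulkᶜ = 0
  supp : ∀ i, μ.support ∩ P.bulk ⊆ P.bulkSet i
  supp' : ∀ i, μ'.support ⊆ P.bdrySet i
  bulk_int : ∀ i, extIntegral (μ.restrict P.bulk) (P.C i) ≤ 0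
  bdry_int : ∀ i, extIntegral (μ'.restrict P.bdry) (P.C' i) ≤ 0

/-- The value `M_r^aff` of the relaxation with affinely relaxed occupation measures. -/
def MrAff (p : ℝ≥0∞) : EReal :=
  sInf {v | ∃ μ μ', P.IsAffOcc p μ μ' ∧ P.IsFeasible μ μ' ∧
    v = extIntegral (μ.restrict P.bulk) P.L}

/-- The value `M_r` of the relaxation with relaxed occupation measures. -/
def Mr (p : ℝ≥0∞) : EReal :=
  sInf {v | ∃ μ μ', P.IsOcc p μ μ' ∧ P.IsFeasible μ μ' ∧
    v = extIntegral (μ.restrict P.bulk) P.L}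

/-- Regularity of the data that makes integrals and support constraints meaningful: the integrands
are Borel, and the constraint sets are relatively closed in `Ω × Y × Z` and in `∂Ω × Y`. -/
structure IsRegular : Prop where
  L_meas : Measurable (P.bulk.domRestrict P.L)
  C_meas : ∀ i, Measurable (P.bulk.domRestrict (P.C i))
  C'_meas : ∀ i, Measurable (P.bdry.domRestrict (P.C' i))
  closed : ∀ i, closure (P.bulkSet i) ∩ P.bulk ⊆ P.bulkSet i
  closed' : ∀ i, closure (P.bdrySet i) ∩ P.bdry ⊆ P.bdrySet i

/-- The convexity assumptions: `Y` and `Z` are closed and convex, `L`, `B_i`, `C_i` are convex and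
`A_i` is affine in `(y, z)`, `B_{∂,i}`, `C_{∂,i}` are convex and `A_{∂,i}` is affine in `y`. -/
structure IsConvex : Prop where
  Y_closed : IsClosed P.Y
  Y_convex : Convex ℝ P.Y
  Z_closed : IsClosed P.Z
  Z_convex : Convex ℝ P.Z
  L_convex : ∀ x ∈ P.Ω, ConvexOn ℝ (P.Y ×ˢ P.Z) (fun q => P.L (x, q))
  A_affine : ∀ i, ∀ x ∈ P.Ω, ∃ a : (Vec m × Jac n m) →ᵃ[ℝ] ℝ,
    ∀ q ∈ P.Y ×ˢ P.Z, P.A i (x, q) = a q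
  B_convex : ∀ i, ∀ x ∈ P.Ω, ConvexOn ℝ (P.Y ×ˢ P.Z) (fun q => P.B i (x, q))
  C_convex : ∀ i, ∀ x ∈ P.Ω, ConvexOn ℝ (P.Y ×ˢ P.Z) (fun q => P.C i (x, q))
  A'_affine : ∀ i, ∀ x ∈ frontier P.Ω, ∃ a : Vec m →ᵃ[ℝ] ℝ, ∀ y ∈ P.Y, P.A' i (x, y) = a y
  B'_convex : ∀ i, ∀ x ∈ frontier P.Ω, ConvexOn ℝ P.Y (fun y => P.B' i (x, y))
  C'_convex : ∀ i, ∀ x ∈ frontier P.Ω, ConvexOn ℝ P.Y (fun y => P.C' i (x, y))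

end Problem

end OccMeasure

end

open MeasureTheory Set Filter Topology
open scoped ENNReal ContDiff

noncomputable section

namespace OccMeasure

/-! ### The area formula for Lipschitz graphs -/

section GraphArea

set_option linter.unusedSectionVars false
open Module (finrank)
open scoped NNReal

variable {H E : Type*} [NormedAddCommGroup H] [InnerProductSpace ℝ H] [FiniteDimensional ℝ H]
  [MeasurableSpace H] [BorelSpace H]
  [NormedAddCommGroup E] [InnerProductSpace ℝ E] [FiniteDimensional ℝ E]
  [MeasurableSpace E] [BorelSpace E]

/-! Dropping the nonlinear Liouville equations enlarges the class of measures, so `MrAff ≤ Mr` is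
immediate. What remains is `Mr ≤ M` and `M ≤ MrAff`.

For `Mr ≤ M`, an admissible `y` with trace `T` is replaced by the push-forward of Lebesgue measure
under `x ↦ (x, y x, z x)` and of surface measure under `x ↦ (x, T x)`. Cost and constraints keep
their values. The nonlinear Liouville equation becomes the divergence theorem for `x ↦ φ (x, y x)`,
that is, a chain rule up to the boundary for test functions of polynomial growth
(`Problem.IsTest.chain_rule`). Convexity plays no role here, only closedness of `Y` and `Z` and the
regularity of the data.

For `M ≤ MrAff`, let `(μ, μ')` be feasible. Liouville's equation with `φ₂ = 0` says that the
`x`-marginal of `μ` has vanishing distributional gradient in `Ω`. As `Ω` is connected, this marginal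
is a multiple of Lebesgue measure, and the mass condition makes it Lebesgue measure itself
(`Problem.IsAffOcc.fst_eq`). Comparison with the divergence theorem then identifies the marginal of
`μ'` with surface measure, because normals do not vanish (`Problem.IsAffOcc.fst_eq'`). Disintegrate
both measures over `x` and take conditional means: `y`, `z` from `μ` and `T` from `μ'`. The equation
with `φ₁ = 0` is linear in `(y, z)`, so the means satisfy it. Interior test functions show that `z`
is the weak derivative of `y`, and general ones that `T` is its trace. Means of probability measures
stay in convex sets, which preserves the pointwise constraints, and Jensen's inequality does not
increase the cost or the integral constraints (`Problem.IsAffOcc.isAdmissible`,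
`extIntegral_condMean_le`).

Both halves rest on the theory of Lipschitz domains, developed from the local graph description. The
area formula for graphs turns Fubini above a graph into the divergence theorem. A smooth field
uniformly transverse to the boundary then gives the trace inequality, `L^p` bounds for traces and
the stability of closed value sets. The interior cone property gives density of functions smooth up
to the boundary. -/

theorem lipschitzOnWith_euclideanHausdorffMeasure_image_le {X Y : Type*} [MetricSpace X]
    [MeasurableSpace X] [BorelSpace X] [MetricSpace Y] [MeasurableSpace Y] [BorelSpace Y]
    {f : X → Y} {s : Set X} {K : ℝ≥0} (h : LipschitzOnWith K f s) (d : ℕ) :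
    (μHE[d] : Measure Y) (f '' s) ≤ (K : ℝ≥0∞) ^ d * (μHE[d] : Measure X) s := by
  have h1 := h.hausdorffMeasure_image_le (d := d) (by positivity)
  rw [ENNReal.rpow_natCast] at h1
  simp only [Measure.euclideanHausdorffMeasure_def, Measure.smul_apply, Measure.nnreal_smul_coe_apply]
  calc _ ≤ _ * ((K : ℝ≥0∞) ^ d * μH[d] s) := by gcongr
    _ = _ := mul_left_comm _ _ _

/-- The derivative `v ↦ v + a(v) e` of a graph map. -/
def graphLin (j : H →ₗᵢ[ℝ] E) (e : E) (a : H →L[ℝ] ℝ) : H →L[ℝ] E :=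
  j.toContinuousLinearMap + a.smulRight e

/-- The graph map `h ↦ h + g(h) e`. -/
def graphMap (j : H →ₗᵢ[ℝ] E) (e : E) (g : H → ℝ) (h : H) : E := j h + g h • e

variable {j : H →ₗᵢ[ℝ] E} {e : E}

theorem graphLin_apply (a : H →L[ℝ] ℝ) (v : H) : graphLin j e a v = j v + a v • e := rfl

theorem inner_graphLin (he : ‖e‖ = 1) (hj : ∀ h, inner ℝ (j h) e = 0) (a : H →L[ℝ] ℝ) (v w : H) :
    inner ℝ (graphLin j e a v) (graphLin j e a w) = inner ℝ v w + a v * a w := by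
  have hj' : ∀ h, inner ℝ e (j h) = 0 := fun h => by rw [real_inner_comm]; exact hj h
  simp only [graphLin_apply, inner_add_left, inner_add_right, real_inner_smul_left,
    real_inner_smul_right, hj, hj', real_inner_self_eq_norm_sq, he, j.inner_map_map]
  ring

theorem norm_le_norm_graphLin (he : ‖e‖ = 1) (hj : ∀ h, inner ℝ (j h) e = 0) (a : H →L[ℝ] ℝ)
    (v : H) : ‖v‖ ≤ ‖graphLin j e a v‖ := by
  have := inner_graphLin he hj a v v
  rw [real_inner_self_eq_norm_sq, real_inner_self_eq_norm_sq] at this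
  exact (sq_le_sq₀ (norm_nonneg _) (norm_nonneg _)).1 (by nlinarith [mul_self_nonneg (a v)])

theorem sum_sq_apply_orthonormalBasis {ι : Type*} [Fintype ι] (b : OrthonormalBasis ι ℝ H)
    (a : H →L[ℝ] ℝ) : ∑ i, a (b i) ^ 2 = ‖a‖ ^ 2 := by
  obtain ⟨u, rfl⟩ := (InnerProductSpace.toDual ℝ H).surjective a
  simp only [InnerProductSpace.toDual_apply_apply, LinearIsometryEquiv.norm_map]
  rw [← b.sum_sq_norm_inner_left u]
  simp

/-- In an orthonormal basis the Gram matrix is the identity plus the rank-one matrix of the products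
`a (b i) * a (b k)`, so its determinant is `1 + ‖a‖ ^ 2` by the matrix determinant lemma. -/
theorem normDet_graphLin (he : ‖e‖ = 1) (hj : ∀ h, inner ℝ (j h) e = 0) (a : H →L[ℝ] ℝ) :
    (graphLin j e a).toLinearMap.normDet = √(1 + ‖a‖ ^ 2) := by
  classical
  rw [eq_comm, Real.sqrt_eq_iff_mul_self_eq (by positivity) (LinearMap.normDet_nonneg _), ← sq]
  let b := stdOrthonormalBasis ℝ H
  have h1 := (graphLin j e a).toLinearMap.normDet_sq_eq_det_gram b
  rw [RCLike.ofReal_real_eq_id, id] at h1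
  rw [h1]
  have : Matrix.gram ℝ ((graphLin j e a).toLinearMap <| b ·)
      = 1 + Matrix.replicateCol Unit (fun i => a (b i)) * Matrix.replicateRow Unit
        (fun i => a (b i)) := by
    ext i k
    simp only [Matrix.gram_apply, ContinuousLinearMap.coe_coe, inner_graphLin he hj,
      Matrix.add_apply, Matrix.mul_apply, Matrix.one_apply, orthonormal_iff_ite.1 b.orthonormal]
    simp
  rw [this, Matrix.det_one_add_replicateCol_mul_replicateRow, ← sum_sq_apply_orthonormalBasis b a]
  simp [dotProduct, sq]

/-- The adjoint of `j` is the orthogonal projection along `e`. It inverts every graph map on its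
image, which makes it possible to compare two graphs over the same base. -/
theorem adjoint_graph (hj : ∀ h, inner ℝ (j h) e = 0) (h : H) (t : ℝ) :
    (j.toContinuousLinearMap).adjoint (j h + t • e) = h := by
  refine ext_inner_right ℝ fun w => ?_
  rw [ContinuousLinearMap.adjoint_inner_left, inner_add_left, real_inner_smul_left]
  have : inner ℝ e (j w) = 0 := by rw [real_inner_comm]; exact hj w
  simp [this]

theorem graphMap_sub (a : H →L[ℝ] ℝ) (g : H → ℝ) (x y : H) :
    graphMap j e g x - graphMap j e g y = graphLin j e a (x - y) + (g x - g y - a (x - y)) • e := by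
  simp only [graphMap, graphLin_apply, map_sub]
  module

variable (he : ‖e‖ = 1) (hj : ∀ h, inner ℝ (j h) e = 0)
include he hj

/-- The graph is the image of its approximate tangent plane under projection to the base followed by
`graphMap`. The error term is at most `δ ‖x - y‖`, and `‖x - y‖` is at most the distance in the
plane, so this map is `(1 + δ)`-Lipschitz. The area of the plane piece is known from linear algebra.
-/
theorem graph_piece_le {g : H → ℝ} {a : H →L[ℝ] ℝ} {δ : ℝ≥0} {P : Set H}
    (hP : ApproximatesLinearOn g a P δ) :
    (μHE[finrank ℝ H] : Measure E) (graphMap j e g '' P)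
      ≤ ((1 + δ : ℝ≥0) : ℝ≥0∞) ^ finrank ℝ H *
        (ENNReal.ofReal (√(1 + ‖a‖ ^ 2)) * volume P) := by
  have hlin := (graphLin j e a).toLinearMap.euclideanHausdorffMeasure_image_eq_normDet_mul_volume P
  rw [normDet_graphLin he hj] at hlin
  rw [← hlin, ContinuousLinearMap.coe_coe]
  have hl : LipschitzOnWith (1 + δ) (fun q => graphMap j e g (j.toContinuousLinearMap.adjoint q))
      (graphLin j e a '' P) := by
    refine LipschitzOnWith.of_dist_le_mul ?_
    rintro _ ⟨x, hx, rfl⟩ _ ⟨y, hy, rfl⟩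
    simp only [graphLin_apply, adjoint_graph hj]
    rw [← graphLin_apply, ← graphLin_apply, dist_eq_norm, dist_eq_norm, graphMap_sub a, ← map_sub]
    refine (norm_add_le _ _).trans ?_
    rw [norm_smul, he, mul_one]
    have := hP x hx y hy
    have h2 := norm_le_norm_graphLin he hj a (x - y)
    push_cast
    have : (δ : ℝ) * ‖x - y‖ ≤ δ * ‖graphLin j e a (x - y)‖ := by gcongr
    linarith
  have := lipschitzOnWith_euclideanHausdorffMeasure_image_le hl (finrank ℝ H)
  rw [image_image] at this
  simpa only [graphLin_apply, adjoint_graph hj] using this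

/-- Here the tangent plane is the image of the graph. The projection back loses at most a factor `1
/ (1 - δ)`, and the condition on `c` is a division-free form of `1 / (1 - δ) ≤ c`. -/
theorem le_graph_piece {g : H → ℝ} {a : H →L[ℝ] ℝ} {δ c : ℝ≥0} {P : Set H}
    (hP : ApproximatesLinearOn g a P δ) (hc : 1 + c * δ ≤ c) :
    ENNReal.ofReal (√(1 + ‖a‖ ^ 2)) * volume P
      ≤ (c : ℝ≥0∞) ^ finrank ℝ H *
        (μHE[finrank ℝ H] : Measure E) (graphMap j e g '' P) := by
  have hlin := (graphLin j e a).toLinearMap.euclideanHausdorffMeasure_image_eq_normDet_mul_volume P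
  rw [normDet_graphLin he hj] at hlin
  rw [← hlin, ContinuousLinearMap.coe_coe]
  have hl : LipschitzOnWith c (fun q => graphLin j e a (j.toContinuousLinearMap.adjoint q))
      (graphMap j e g '' P) := by
    refine LipschitzOnWith.of_dist_le_mul ?_
    rintro _ ⟨x, hx, rfl⟩ _ ⟨y, hy, rfl⟩
    rw [dist_eq_norm (graphMap j e g x), graphMap_sub a]
    simp only [graphMap, adjoint_graph hj]
    rw [dist_eq_norm, ← map_sub]
    have h1 := hP x hx y hy
    have h2 := norm_le_norm_graphLin he hj a (x - y)
    have h3 := norm_sub_le_norm_add (graphLin j e a (x - y)) ((g x - g y - a (x - y)) • e)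
    rw [norm_smul, he, mul_one] at h3
    have h4 : (1 : ℝ) + c * δ ≤ c := by exact_mod_cast hc
    have h5 : (c : ℝ) * ‖g x - g y - a (x - y)‖ ≤ c * (δ * ‖graphLin j e a (x - y)‖) := by
      gcongr
      exact h1.trans (by gcongr)
    have h6 := mul_le_mul_of_nonneg_left h3 c.2
    have h7 := mul_le_mul_of_nonneg_right h4 (norm_nonneg (graphLin j e a (x - y)))
    change (c : ℝ) * _ ≤ _ at h6
    nlinarith
  have := lipschitzOnWith_euclideanHausdorffMeasure_image_le hl (finrank ℝ H)
  rw [image_image] at this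
  simpa only [graphMap, adjoint_graph hj] using this

omit he hj
omit [MeasurableSpace E] [BorelSpace E] [FiniteDimensional ℝ E] in
-- Turns additive closeness of gradients into multiplicative closeness of area densities.
theorem sqrt_one_add_sq_le {a b δ : ℝ} (h : |a - b| ≤ δ) (hb : 0 ≤ b) :
    √(1 + a ^ 2) ≤ (1 + δ) * √(1 + b ^ 2) := by
  have h0 : 0 ≤ δ := (abs_nonneg _).trans h
  have h1 : (1 : ℝ) ≤ √(1 + b ^ 2) := Real.one_le_sqrt.2 (by nlinarith)
  have hs := Real.sq_sqrt (show 0 ≤ 1 + b ^ 2 by positivity)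
  have h2 : b ≤ √(1 + b ^ 2) := Real.le_sqrt_of_sq_le (by linarith)
  rw [Real.sqrt_le_left (by positivity)]
  have h3 := abs_le.1 h
  have h4 : a ^ 2 ≤ (b + δ) ^ 2 := by
    rw [sq_le_sq, abs_of_nonneg (by positivity : 0 ≤ b + δ), abs_le]
    constructor <;> linarith
  rw [mul_pow, hs]
  nlinarith [sq_nonneg b, sq_nonneg (b-1), mul_nonneg h0 (sq_nonneg (b-1)), mul_nonneg h0 h0,
    mul_nonneg (mul_nonneg h0 h0) (sq_nonneg b)]

/-- The corresponding estimate for maps from `H` to `H` is applied to `x ↦ g x • u` with a unit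
vector `u`, which preserves all norms. A trivial `H` contains no such `u` and is treated apart. -/
theorem approximatesLinearOn_norm_fderiv_sub_le {g : H → ℝ} {a : H →L[ℝ] ℝ} {δ : ℝ≥0} {s : Set H}
    (hs : MeasurableSet s) (h : ApproximatesLinearOn g a s δ)
    (hd : ∀ x ∈ s, DifferentiableAt ℝ g x) :
    ∀ᵐ x ∂volume.restrict s, ‖fderiv ℝ g x - a‖ ≤ δ := by
  rcases subsingleton_or_nontrivial H with hH | hH
  · refine ae_of_all _ fun x => ?_
    rw [show fderiv ℝ g x - a = 0 from ContinuousLinearMap.ext fun v => by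
      rw [Subsingleton.elim v 0]; simp, norm_zero]
    exact δ.2
  obtain ⟨u, hu⟩ := exists_norm_eq H (zero_le_one (α := ℝ))
  have h1 : ApproximatesLinearOn (fun x => g x • u) (a.smulRight u) s δ := by
    intro x hx y hy
    have := h x hx y hy
    rw [ContinuousLinearMap.smulRight_apply, ← sub_smul, ← sub_smul, norm_smul, hu, mul_one]
    exact this
  have h2 := h1.norm_fderiv_sub_le volume hs (fun x => (fderiv ℝ g x).smulRight u) fun x hx =>
    ((hd x hx).hasFDerivAt.smul_const u).hasFDerivWithinAt
  filter_upwards [h2] with x hx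
  have h3 : (fderiv ℝ g x).smulRight u - a.smulRight u = (fderiv ℝ g x - a).smulRight u := by
    ext; simp [sub_smul]
  rw [h3] at hx
  have hx' : ‖(fderiv ℝ g x - a).smulRight u‖ ≤ δ := hx
  rwa [ContinuousLinearMap.norm_smulRight_apply, hu, mul_one] at hx'

theorem lipschitzWith_graphMap {g : H → ℝ} {K : ℝ≥0} (hg : LipschitzWith K g) :
    LipschitzWith (1 + K * ‖e‖₊) (graphMap j e g) := by
  refine j.lipschitz.add (LipschitzWith.of_dist_le_mul fun x y => ?_)
  rw [dist_eq_norm, ← sub_smul, norm_smul, ← dist_eq_norm]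
  have := hg.dist_le_mul x y
  push_cast
  calc _ ≤ (K * dist x y) * ‖e‖ := by gcongr
    _ = _ := by ring

include hj in
theorem injective_graphMap (g : H → ℝ) : Function.Injective (graphMap j e g) := by
  intro x y hxy
  have := congrArg (j.toContinuousLinearMap.adjoint) hxy
  simpa only [graphMap, adjoint_graph hj] using this

include he hj in
/-- The area formula for the graph of a Lipschitz function. -/
theorem graph_area {g : H → ℝ} {K : ℝ≥0} (hg : LipschitzWith K g) {A : Set H}
    (hA : MeasurableSet A) :
    (μHE[finrank ℝ H] : Measure E) (graphMap j e g '' A)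
      = ∫⁻ h in A, ENNReal.ofReal (√(1 + ‖fderiv ℝ g h‖ ^ 2)) := by
  set F := graphMap j e g with hF
  set J : H → ℝ≥0∞ := fun h => ENNReal.ofReal (√(1 + ‖fderiv ℝ g h‖ ^ 2)) with hJ
  set k := finrank ℝ H
  have hFinj : Function.Injective F := injective_graphMap hj g
  have hFc : Continuous F := (lipschitzWith_graphMap hg).continuous
  set D : Set H := {x | DifferentiableAt ℝ g x} with hD
  have hDm : MeasurableSet D := measurableSet_of_differentiableAt ℝ g
  have hDnull : volume Dᶜ = 0 := hg.ae_differentiableAt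
  -- By Rademacher's theorem the points of non-differentiability are null, and a Lipschitz map sends
  -- null sets to null sets.
  have hFnull : (μHE[k] : Measure E) (F '' (A \ D)) = 0 := by
    refine le_antisymm ((lipschitzOnWith_euclideanHausdorffMeasure_image_le
      (lipschitzWith_graphMap hg).lipschitzOnWith k).trans ?_) zero_le
    rw [InnerProductSpace.euclideanHausdorffMeasure_eq_volume,
      measure_mono_null (fun x hx => hx.2) hDnull, mul_zero]
  have hAD : (μHE[k] : Measure E) (F '' A) = (μHE[k] : Measure E) (F '' (A ∩ D)) := by
    refine le_antisymm ?_ (measure_mono (image_mono inter_subset_left))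
    rw [← inter_union_sdiff A D, image_union]
    refine (measure_union_le _ _).trans ?_
    rw [hFnull, add_zero, inter_union_sdiff]
  have hAJ : ∫⁻ h in A, J h = ∫⁻ h in A ∩ D, J h := by
    refine setLIntegral_congr ?_
    exact (inter_ae_eq_left_of_ae_eq_univ (eventuallyEq_univ.2 hDnull)).symm
  rw [hAD, hAJ]
  -- comparison up to a factor close to one
  have key : ∀ c : ℝ≥0, 1 < c →
      (μHE[k] : Measure E) (F '' (A ∩ D)) ≤ (c : ℝ≥0∞) ^ (k + 1) * ∫⁻ h in A ∩ D, J h ∧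
      ∫⁻ h in A ∩ D, J h ≤ (c : ℝ≥0∞) ^ (k + 1) * (μHE[k] : Measure E) (F '' (A ∩ D)) := by
    intro c hc
    have hc0 : (0 : ℝ) < c := by positivity
    have hc1 : (1 : ℝ) < c := by exact_mod_cast hc
    have hci : (c : ℝ)⁻¹ < 1 := inv_lt_one_of_one_lt₀ hc1
    -- This value makes `1 + c δ = c`, as required for the lower bound, and also yields `1 + δ ≤ c`
    -- for the upper bound.
    let δ : ℝ≥0 := ⟨1 - (c : ℝ)⁻¹, by linarith⟩
    have hδc : (δ : ℝ) = 1 - (c : ℝ)⁻¹ := rfl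
    have hδ0 : δ ≠ 0 := by
      intro h; have : (δ : ℝ) = 0 := by rw [h]; rfl
      linarith
    have hδ1 : 1 + c * δ ≤ c := by
      have : (1 : ℝ) + c * δ ≤ c := by rw [hδc, mul_sub, mul_inv_cancel₀ hc0.ne']; linarith
      exact_mod_cast this
    have hδ2 : 1 + δ ≤ c := by
      have : (1 : ℝ) + δ ≤ c := by
        rw [hδc]
        have : (c : ℝ) * (c : ℝ)⁻¹ = 1 := mul_inv_cancel₀ hc0.ne'
        nlinarith [mul_self_nonneg ((c : ℝ) - 1), inv_pos.2 hc0]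
      exact_mod_cast this
    obtain ⟨t, a, tdisj, tmeas, tcov, tapp, -⟩ :=
      exists_partition_approximatesLinearOn_of_hasFDerivWithinAt g (A ∩ D) (fderiv ℝ g)
        (fun x hx => hx.2.hasFDerivAt.hasFDerivWithinAt) (fun _ => δ) (fun _ => hδ0)
    have hPm : ∀ n, MeasurableSet (A ∩ D ∩ t n) := fun n => (hA.inter hDm).inter (tmeas n)
    have hcover : A ∩ D = ⋃ n, A ∩ D ∩ t n := by rw [← inter_iUnion, inter_eq_left.2 tcov]
    have hdisj : Pairwise (Function.onFun Disjoint fun n => A ∩ D ∩ t n) := fun i l hil =>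
      (tdisj hil).mono inter_subset_right inter_subset_right
    have hsum : (μHE[k] : Measure E) (F '' (A ∩ D)) = ∑' n, (μHE[k] : Measure E)
        (F '' (A ∩ D ∩ t n)) := by
      conv_lhs => rw [hcover, image_iUnion]
      refine measure_iUnion (fun i l hil => ?_) fun n =>
        (hPm n).image_of_continuousOn_injOn hFc.continuousOn hFinj.injOn
      exact (disjoint_image_iff hFinj).2 (hdisj hil)
    have hsumJ : ∫⁻ h in A ∩ D, J h = ∑' n, ∫⁻ h in A ∩ D ∩ t n, J h := by
      conv_lhs => rw [hcover]
      exact lintegral_iUnion hPm hdisj _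
    have hclose : ∀ n, ∀ᵐ x ∂volume.restrict (A ∩ D ∩ t n), ‖fderiv ℝ g x - a n‖ ≤ δ := fun n =>
      approximatesLinearOn_norm_fderiv_sub_le (hPm n) (tapp n) fun x hx => hx.1.2
    have hJ1 : ∀ n, ENNReal.ofReal (√(1 + ‖a n‖ ^ 2)) * volume (A ∩ D ∩ t n)
        ≤ c * ∫⁻ h in A ∩ D ∩ t n, J h := by
      intro n
      rw [← lintegral_const_mul' _ _ ENNReal.coe_ne_top, ← setLIntegral_const]
      refine lintegral_mono_ae ?_
      filter_upwards [hclose n] with x hx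
      simp only [hJ]
      rw [← ENNReal.ofReal_coe_nnreal, ← ENNReal.ofReal_mul hc0.le]
      refine ENNReal.ofReal_le_ofReal ((sqrt_one_add_sq_le (δ := δ) (b := ‖fderiv ℝ g x‖) ?_
        (norm_nonneg _)).trans ?_)
      · rw [abs_sub_comm]; exact (abs_norm_sub_norm_le _ _).trans hx
      · gcongr; exact_mod_cast hδ2
    have hJ2 : ∀ n, ∫⁻ h in A ∩ D ∩ t n, J h
        ≤ c * (ENNReal.ofReal (√(1 + ‖a n‖ ^ 2)) * volume (A ∩ D ∩ t n)) := by
      intro n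
      rw [← mul_assoc, ← setLIntegral_const]
      refine lintegral_mono_ae ?_
      filter_upwards [hclose n] with x hx
      simp only [hJ]
      rw [← ENNReal.ofReal_coe_nnreal, ← ENNReal.ofReal_mul hc0.le]
      refine ENNReal.ofReal_le_ofReal ((sqrt_one_add_sq_le (δ := δ) (b := ‖a n‖) ?_
        (norm_nonneg _)).trans ?_)
      · exact (abs_norm_sub_norm_le _ _).trans hx
      · gcongr; exact_mod_cast hδ2
    -- Of the `k + 1` factors `c`, `k` come from the Lipschitz comparison with the tangent plane and
    -- one from the comparison of densities.
    constructor
    · rw [hsum, hsumJ, ← ENNReal.tsum_mul_left]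
      refine ENNReal.tsum_le_tsum fun n => (graph_piece_le he hj (tapp n)).trans ?_
      rw [pow_succ (c : ℝ≥0∞), mul_assoc]
      exact mul_le_mul' (pow_le_pow_left' (by exact_mod_cast hδ2) _) (hJ1 n)
    · rw [hsum, hsumJ, ← ENNReal.tsum_mul_left]
      refine ENNReal.tsum_le_tsum fun n => (hJ2 n).trans ?_
      rw [pow_succ' (c : ℝ≥0∞), mul_assoc]
      exact mul_le_mul' le_rfl (le_graph_piece he hj (tapp n) hδ1)
  -- Let `c` decrease to one.
  have lim : ∀ X Y : ℝ≥0∞, (∀ c : ℝ≥0, 1 < c → X ≤ (c : ℝ≥0∞) ^ (k + 1) * Y) → X ≤ Y := by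
    intro X Y h
    rcases eq_or_ne Y ⊤ with rfl | hY
    · exact le_top
    have ht : Tendsto (fun c : ℝ≥0 => (c : ℝ≥0∞) ^ (k + 1) * Y) (𝓝[>] 1) (𝓝 (1 ^ (k + 1) * Y)) := by
      refine ENNReal.Tendsto.mul_const ?_ (Or.inr hY)
      refine ENNReal.Tendsto.pow ?_
      have : Tendsto (fun c : ℝ≥0 => (c : ℝ≥0∞)) (𝓝[>] 1) (𝓝 ((1 : ℝ≥0) : ℝ≥0∞)) :=
        ENNReal.tendsto_coe.2 (tendsto_id.mono_left nhdsWithin_le_nhds)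
      exact this
    rw [one_pow, one_mul] at ht
    exact ge_of_tendsto ht (eventually_nhdsWithin_of_forall fun c hc => h c hc)
  exact le_antisymm (lim _ _ fun c hc => (key c hc).1) (lim _ _ fun c hc => (key c hc).2)

end GraphArea

theorem hasCompactSupport_prod_left {X Y M : Type*} [TopologicalSpace X] [TopologicalSpace Y]
    [Zero M] [T1Space Y] {f : X × Y → M} (hf : HasCompactSupport f) (y : Y) :
    HasCompactSupport fun x => f (x, y) :=
  hf.comp_isClosedEmbedding (Topology.IsClosedEmbedding.of_continuous_injective_isClosedMap
    (by fun_prop) (fun _ _ h => (Prod.ext_iff.1 h).1) (isClosedMap_prodMk_right y))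

theorem hasCompactSupport_prod_right {X Y M : Type*} [TopologicalSpace X] [TopologicalSpace Y]
    [Zero M] [T1Space X] {f : X × Y → M} (hf : HasCompactSupport f) (x : X) :
    HasCompactSupport fun y => f (x, y) :=
  hf.comp_isClosedEmbedding (Topology.IsClosedEmbedding.of_continuous_injective_isClosedMap
    (by fun_prop) (fun _ _ h => (Prod.ext_iff.1 h).2) (isClosedMap_prodMk_left x))

/-! ### The divergence theorem above a Lipschitz graph -/

section Epigraph

set_option linter.unusedSectionVars false
open Module (finrank)
open scoped NNReal

variable {H E : Type*} [NormedAddCommGroup H] [InnerProductSpace ℝ H] [FiniteDimensional ℝ H]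
  [MeasurableSpace H] [BorelSpace H]
  [NormedAddCommGroup E] [InnerProductSpace ℝ E] [FiniteDimensional ℝ E]
  [MeasurableSpace E] [BorelSpace E]

/-- `j` embeds `H` isometrically as the orthogonal complement of the unit vector `e`. -/
structure IsFrame (j : H →ₗᵢ[ℝ] E) (e : E) : Prop where
  norm_eq_one : ‖e‖ = 1
  inner_eq_zero : ∀ h, inner ℝ (j h) e = 0
  decomp : ∀ x, ∃ h, x = j h + (inner ℝ x e : ℝ) • e

/-- The projection onto `H` associated with a frame. -/
def hproj (j : H →ₗᵢ[ℝ] E) : E →L[ℝ] H := j.toContinuousLinearMap.adjoint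

/-- Integration by parts against the constant one. Lipschitz functions are needed, since a smooth
function restricted to a translate of a Lipschitz graph is no smoother than that. -/
theorem integral_fderiv_eq_zero {φ : H → ℝ} {C : ℝ≥0} (hφ : LipschitzWith C φ)
    (hc : HasCompactSupport φ) (v : H) : ∫ x, fderiv ℝ φ x v = 0 := by
  have h := LipschitzWith.integral_lineDeriv_mul_eq (μ := volume) (LipschitzWith.const (1 : ℝ))
    hφ hc (-v)
  have h0 : ∀ x : H, lineDeriv ℝ (fun _ : H => (1 : ℝ)) x (-v) = 0 := fun x => by simp [lineDeriv]
  simp only [neg_neg, mul_one, h0, zero_mul, integral_zero] at h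
  rw [h]
  refine integral_congr_ae ?_
  filter_upwards [hφ.ae_differentiableAt] with x hx using hx.lineDeriv_eq_fderiv.symm

variable {j : H →ₗᵢ[ℝ] E} {e : E} (F : IsFrame j e) {g : H → ℝ} {K : ℝ≥0} (hg : LipschitzWith K g)
include F

theorem IsFrame.hproj_add (h : H) (t : ℝ) : hproj j (j h + t • e) = h :=
  adjoint_graph F.inner_eq_zero h t

theorem IsFrame.decomp' (x : E) : j (hproj j x) + (inner ℝ x e : ℝ) • e = x := by
  obtain ⟨h, hx⟩ := F.decomp x
  conv_rhs => rw [hx]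
  rw [hx, F.hproj_add, ← hx]

theorem IsFrame.inner_add (h : H) (t : ℝ) : inner ℝ (j h + t • e) e = t := by
  rw [inner_add_left, F.inner_eq_zero, real_inner_smul_left, real_inner_self_eq_norm_sq,
    F.norm_eq_one]
  ring

theorem IsFrame.norm_hproj_le (x : E) : ‖hproj j x‖ ≤ ‖x‖ := by
  refine ((hproj j).le_opNorm x).trans ?_
  have h1 : ‖hproj j‖ ≤ 1 := by
    rw [hproj, LinearIsometryEquiv.norm_map]
    exact j.norm_toContinuousLinearMap_le
  nlinarith [norm_nonneg x]

theorem IsFrame.sub_inner_smul (x : E) : x - (inner ℝ x e : ℝ) • e = j (hproj j x) := by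
  rw [sub_eq_iff_eq_add]; exact (F.decomp' x).symm

/-- Orthogonal coordinates. -/
def IsFrame.isometry : WithLp 2 (H × ℝ) ≃ₗᵢ[ℝ] E where
  toFun p := j p.fst + p.snd • e
  invFun x := WithLp.toLp 2 (hproj j x, (inner ℝ x e : ℝ))
  map_add' p q := by simp; module
  map_smul' c p := by simp; module
  left_inv p := by
    simp only [F.hproj_add, F.inner_add]
    rfl
  right_inv x := by simpa using F.decomp' x
  norm_map' p := by
    rw [← sq_eq_sq₀ (norm_nonneg _) (norm_nonneg _), WithLp.prod_norm_sq_eq_of_L2]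
    change ‖j p.fst + p.snd • e‖ ^ 2 = _
    rw [norm_add_sq_real, real_inner_smul_right, F.inner_eq_zero, norm_smul, F.norm_eq_one,
      j.norm_map]
    ring

theorem IsFrame.measurePreserving : MeasurePreserving (fun p : H × ℝ => j p.1 + p.2 • e) := by
  have h1 : MeasurePreserving (WithLp.toLp 2 : H × ℝ → WithLp 2 (H × ℝ)) :=
    WithLp.volume_preserving_toLp H ℝ
  exact F.isometry.measurePreserving.comp h1

/-- Coordinates in which the graph of `g` is flat. -/
def IsFrame.shear (hg : Continuous g) : H × ℝ ≃ₜ E where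
  toFun p := j p.1 + (p.2 + g p.1) • e
  invFun x := (hproj j x, (inner ℝ x e : ℝ) - g (hproj j x))
  left_inv p := by simp [F.hproj_add, F.inner_add]
  right_inv x := by simpa using F.decomp' x
  continuous_toFun := by fun_prop
  continuous_invFun := by fun_prop

/-- On each vertical fibre the shear is a translation. -/
theorem IsFrame.measurePreserving_shear (hg : Continuous g) :
    MeasurePreserving (F.shear hg) := by
  have h1 : MeasurePreserving (fun p : H × ℝ => (p.1, p.2 + g p.1)) := by
    refine (MeasurePreserving.id (volume : Measure H)).skew_product (g := fun a t => t + g a)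
      ?_ (ae_of_all _ fun a => ?_)
    · exact (by fun_prop : Continuous (fun p : H × ℝ => p.2 + g p.1)).measurable
    · exact (measurePreserving_add_right volume (g a)).map_eq
  exact F.measurePreserving.comp h1

/-- The divergence theorem above the graph of a Lipschitz function. -/
theorem IsFrame.integral_epigraph (hg : LipschitzWith K g) {φ : E → ℝ} (hφ : ContDiff ℝ 1 φ)
    (hc : HasCompactSupport φ) (v : E) :
    ∫ x in {x : E | g (hproj j x) < inner ℝ x e}, fderiv ℝ φ x v
      = ∫ h, φ (graphMap j e g h) * (fderiv ℝ g h (hproj j v) - inner ℝ v e) := by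
  set Φ := F.shear hg.continuous with hΦ
  have hΦap : ∀ p : H × ℝ, Φ p = j p.1 + (p.2 + g p.1) • e := fun p => rfl
  have hmp := F.measurePreserving_shear hg.continuous
  have hD : Continuous (fun x => fderiv ℝ φ x v) :=
    (hφ.continuous_fderiv one_ne_zero).clm_apply continuous_const
  have hDe : Continuous (fun x => fderiv ℝ φ x e) :=
    (hφ.continuous_fderiv one_ne_zero).clm_apply continuous_const
  have hDc : HasCompactSupport (fun x => fderiv ℝ φ x v) := hc.fderiv_apply ℝ v
  have hDec : HasCompactSupport (fun x => fderiv ℝ φ x e) := hc.fderiv_apply ℝ e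
  -- pass to coordinates
  have e1 : ∫ x in {x : E | g (hproj j x) < inner ℝ x e}, fderiv ℝ φ x v
      = ∫ p in univ ×ˢ Ioi (0 : ℝ), fderiv ℝ φ (Φ p) v := by
    have h1 := hmp.setIntegral_preimage_emb Φ.measurableEmbedding (fun x => fderiv ℝ φ x v)
      {x : E | g (hproj j x) < inner ℝ x e}
    rw [← h1]
    congr 2
    ext p
    simp only [mem_prod, mem_univ, true_and, mem_Ioi, mem_preimage, mem_ofPred_eq, ← hΦ]
    rw [hΦap, F.hproj_add, F.inner_add]
    simp
  set A : H × ℝ → ℝ := fun p => fderiv ℝ φ (Φ p) v with hA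
  set B : H × ℝ → ℝ := fun p => fderiv ℝ φ (Φ p) e with hB
  -- Differentiating a slice at constant height above the graph in the horizontal direction of `v`
  -- gives `A - c B`. Hence `A` splits into a horizontal derivative, which integrates to zero, and
  -- `c B`, a vertical derivative that integrates to a boundary value.
  set c : H → ℝ := fun h => inner ℝ v e - fderiv ℝ g h (hproj j v) with hcdef
  have hAi : Integrable A (volume.prod volume) :=
    (hD.comp Φ.continuous).integrable_of_hasCompactSupport (hDc.comp_homeomorph Φ)
  have hBi : Integrable B (volume.prod volume) :=
    (hDe.comp Φ.continuous).integrable_of_hasCompactSupport (hDec.comp_homeomorph Φ)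
  have hcm : Measurable c := measurable_const.sub (measurable_fderiv_apply_const ℝ g _)
  have hcb : ∀ h, ‖c h‖ ≤ ‖v‖ * ‖e‖ + K * ‖hproj j v‖ := fun h => by
    refine (norm_sub_le _ _).trans (add_le_add (norm_inner_le_norm _ _) ?_)
    exact (ContinuousLinearMap.le_opNorm _ _).trans
      (by gcongr; exact norm_fderiv_le_of_lipschitz ℝ hg)
  have hcBi : Integrable (fun p : H × ℝ => c p.1 * B p) (volume.prod volume) :=
    hBi.bdd_mul (hcm.comp measurable_fst).aestronglyMeasurable (ae_of_all _ fun p => hcb p.1)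
  have hφL := hφ.lipschitzWith_of_hasCompactSupport hc one_ne_zero
  obtain ⟨C, hC⟩ := hφL
  -- the sliced function
  have hψL : ∀ s : ℝ, LipschitzWith (C * (1 + K * ‖e‖₊)) (fun h => φ (Φ (h, s))) := fun s =>
    hC.comp (lipschitzWith_graphMap (g := fun h => s + g h)
      (by simpa using (LipschitzWith.const s).add hg))
  have hψc : ∀ s : ℝ, HasCompactSupport (fun h => φ (Φ (h, s))) := fun s =>
    hasCompactSupport_prod_left (hc.comp_homeomorph Φ) s
  have hdiff : ∀ᵐ h : H, DifferentiableAt ℝ g h := hg.ae_differentiableAt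
  have hslice : ∀ h, DifferentiableAt ℝ g h → ∀ s,
      fderiv ℝ (fun h => φ (Φ (h, s))) h (hproj j v) = A (h, s) - c h * B (h, s) := by
    intro h hh s
    have h1 : HasFDerivAt (fun h => Φ (h, s))
        (j.toContinuousLinearMap + (fderiv ℝ g h).smulRight e) h := by
      refine j.toContinuousLinearMap.hasFDerivAt.add ?_
      exact (hh.hasFDerivAt.const_add s).smul_const e
    have h2 := ((hφ.differentiable one_ne_zero (Φ (h, s))).hasFDerivAt).comp h h1
    have h3 : fderiv ℝ (fun h => φ (Φ (h, s))) h = _ := h2.fderiv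
    rw [h3]
    have hv := F.decomp' v
    simp only [hA, hB, hcdef, ContinuousLinearMap.comp_apply, add_apply,
      ContinuousLinearMap.smulRight_apply, map_add, map_smul, smul_eq_mul,
      LinearIsometry.coe_toContinuousLinearMap]
    conv_rhs => rw [← hv]
    simp only [map_add, map_smul, smul_eq_mul, F.hproj_add, F.inner_add]
    ring
  -- Fubini with the horizontal variable inside: each slice has compact support and carries a full
  -- derivative.
  have hQ : ∫ p in univ ×ˢ Ioi (0 : ℝ), (A p - c p.1 * B p) = 0 := by
    rw [Measure.volume_eq_prod, ← Measure.prod_restrict, Measure.restrict_univ,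
      integral_prod_symm]
    · refine integral_eq_zero_of_ae (ae_of_all _ fun s => ?_)
      rw [Pi.zero_apply, ← integral_fderiv_eq_zero (hψL s) (hψc s) (hproj j v)]
      refine integral_congr_ae ?_
      filter_upwards [hdiff] with h hh using (hslice h hh s).symm
    · have := (hAi.sub hcBi).restrict (s := univ ×ˢ Ioi (0 : ℝ))
      rwa [← Measure.prod_restrict, Measure.restrict_univ] at this
  -- Fubini with the vertical variable inside. The coefficient `c` does not depend on the height,
  -- and `∫ B` over `s > 0` is minus the value on the graph.
  have hcB : ∫ p in univ ×ˢ Ioi (0 : ℝ), c p.1 * B p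
      = ∫ h, φ (graphMap j e g h) * (fderiv ℝ g h (hproj j v) - inner ℝ v e) := by
    have := hcBi.restrict (s := univ ×ˢ Ioi (0 : ℝ))
    rw [← Measure.prod_restrict, Measure.restrict_univ] at this
    rw [Measure.volume_eq_prod, ← Measure.prod_restrict, Measure.restrict_univ,
      integral_prod _ this]
    congr 1
    ext h
    simp only []
    rw [integral_const_mul]
    have hsm : ContDiff ℝ 1 (fun s : ℝ => φ (j h + (s + g h) • e)) := by fun_prop
    have hsc : HasCompactSupport (fun s : ℝ => φ (j h + (s + g h) • e)) :=
      hasCompactSupport_prod_right (hc.comp_homeomorph Φ) h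
    have h4 := hsc.integral_Ioi_deriv_eq hsm 0
    have h5 : ∀ s : ℝ, deriv (fun s : ℝ => φ (j h + (s + g h) • e)) s = B (h, s) := by
      intro s
      have h6 : HasDerivAt (fun s : ℝ => j h + (s + g h) • e) e s := by
        simpa using (((hasDerivAt_id s).add_const (g h)).smul_const e).const_add (j h)
      exact ((hφ.differentiable one_ne_zero _).hasFDerivAt.comp_hasDerivAt s h6).deriv
    simp_rw [h5] at h4
    rw [h4, zero_add, graphMap]
    ring
  rw [e1, ← hcB, ← sub_eq_zero]
  exact (integral_sub hAi.integrableOn hcBi.integrableOn).symm.trans hQ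

end Epigraph

/-! ### Local description of a Lipschitz domain -/

section LocalChart

set_option linter.unusedSectionVars false
open Module (finrank)
open scoped NNReal

theorem exists_frame {n : ℕ} {e : Vec n} (he : ‖e‖ = 1) :
    ∃ j : (ℝ ∙ e)ᗮ →ₗᵢ[ℝ] Vec n, IsFrame j e ∧ finrank ℝ (ℝ ∙ e)ᗮ = n - 1 := by
  refine ⟨(ℝ ∙ e)ᗮ.subtypeₗᵢ, ⟨he, fun h => ?_, fun x => ?_⟩, ?_⟩
  · have := h.2
    rw [Submodule.mem_orthogonal_singleton_iff_inner_left] at this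
    exact this
  · refine ⟨⟨x - (inner ℝ x e : ℝ) • e, ?_⟩, ?_⟩
    · rw [Submodule.mem_orthogonal_singleton_iff_inner_left, inner_sub_left, real_inner_smul_left,
        real_inner_self_eq_norm_sq, he]
      ring
    · simp
  · have h0 : e ≠ 0 := fun h => by simp [h] at he
    have h1 := (ℝ ∙ e).finrank_add_finrank_orthogonal
    rw [finrank_span_singleton h0, finrank_euclideanSpace_fin] at h1
    omega

variable {H : Type*} [NormedAddCommGroup H] [InnerProductSpace ℝ H] [FiniteDimensional ℝ H]
  [MeasurableSpace H] [BorelSpace H] {n : ℕ} {j : H →ₗᵢ[ℝ] Vec n} {e : Vec n} {g : H → ℝ} {K : ℝ≥0}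

/-- The graph of `g`. -/
def graphSet (j : H →ₗᵢ[ℝ] Vec n) (e : Vec n) (g : H → ℝ) : Set (Vec n) :=
  {x | g (hproj j x) = inner ℝ x e}

/-- The open set above the graph of `g`. -/
def epigraphSet (j : H →ₗᵢ[ℝ] Vec n) (e : Vec n) (g : H → ℝ) : Set (Vec n) :=
  {x | g (hproj j x) < inner ℝ x e}

/-- The area density of a graph. -/
def graphDensity (g : H → ℝ) (h : H) : ℝ := √(1 + ‖fderiv ℝ g h‖ ^ 2)

theorem one_le_graphDensity (g : H → ℝ) (h : H) : 1 ≤ graphDensity g h :=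
  Real.one_le_sqrt.2 (by nlinarith [sq_nonneg ‖fderiv ℝ g h‖])

theorem graphDensity_le (hg : LipschitzWith K g) (h : H) :
    graphDensity g h ≤ √(1 + (K : ℝ) ^ 2) := by
  refine Real.sqrt_le_sqrt ?_
  have := norm_fderiv_le_of_lipschitz ℝ hg (x₀ := h)
  gcongr

theorem measurable_graphDensity (g : H → ℝ) : Measurable (graphDensity g) := by
  unfold graphDensity
  exact (((measurable_fderiv ℝ g).norm.pow_const 2).const_add 1).sqrt

/-- The unit normal of a graph, pointing downwards. -/
def graphNormal (j : H →ₗᵢ[ℝ] Vec n) (e : Vec n) (g : H → ℝ) (h : H) : Vec n :=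
  (graphDensity g h)⁻¹ • (j ((InnerProductSpace.toDual ℝ H).symm (fderiv ℝ g h)) - e)

variable (F : IsFrame j e)
include F

theorem IsFrame.graphMap_mem_graphSet (h : H) : graphMap j e g h ∈ graphSet j e g := by
  rw [graphSet, mem_ofPred_eq, graphMap, F.hproj_add, F.inner_add]

theorem IsFrame.range_graphMap : range (graphMap j e g) = graphSet j e g := by
  refine Subset.antisymm (range_subset_iff.2 fun h => F.graphMap_mem_graphSet h) fun x hx => ?_
  refine ⟨hproj j x, ?_⟩
  have hx : g (hproj j x) = inner ℝ x e := hx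
  rw [graphMap, hx]
  exact F.decomp' x

theorem IsFrame.inner_hproj_right (v : Vec n) (b : H) :
    inner ℝ (j b) v = inner ℝ b (hproj j v) := by
  rw [hproj, ContinuousLinearMap.adjoint_inner_right]; rfl

/-- The area density cancels the normalization of the normal, so the right-hand side is exactly the
weight in `IsFrame.integral_epigraph`. -/
theorem IsFrame.inner_graphNormal (h : H) (v : Vec n) :
    graphDensity g h * inner ℝ (graphNormal j e g h) v
      = fderiv ℝ g h (hproj j v) - inner ℝ v e := by
  have h0 : graphDensity g h ≠ 0 := (zero_lt_one.trans_le (one_le_graphDensity g h)).ne'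
  rw [graphNormal, real_inner_smul_left, mul_inv_cancel_left₀ h0, inner_sub_left,
    F.inner_hproj_right v, InnerProductSpace.toDual_symm_apply, real_inner_comm]

theorem IsFrame.norm_graphNormal (h : H) : ‖graphNormal j e g h‖ = 1 := by
  have h0 : 0 < graphDensity g h := zero_lt_one.trans_le (one_le_graphDensity g h)
  have h1 : ‖j ((InnerProductSpace.toDual ℝ H).symm (fderiv ℝ g h)) - e‖ = graphDensity g h := by
    rw [graphDensity, eq_comm, Real.sqrt_eq_iff_mul_self_eq (by positivity) (norm_nonneg _), ← sq,
      norm_sub_sq_real, F.inner_eq_zero, F.norm_eq_one, j.norm_map, LinearIsometryEquiv.norm_map]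
    ring
  rw [graphNormal, norm_smul, h1, norm_inv, Real.norm_of_nonneg h0.le, inv_mul_cancel₀ h0.ne']

theorem IsFrame.hproj_e : hproj j e = 0 := by
  have := F.hproj_add 0 1
  simpa using this

/-- The first-order expansion of `g` describes the epigraph near the point through the unnormalized
normal. Since the density is at least one, a lower bound on the size of the product with the unit
normal persists for the unnormalized one. -/
theorem IsFrame.isOuterNormal {Ω : Set (Vec n)} {h : H} (hd : DifferentiableAt ℝ g h)
    (hΩ : ∀ᶠ x in 𝓝 (graphMap j e g h), (x ∈ Ω ↔ x ∈ epigraphSet j e g)) :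
    IsOuterNormal Ω (graphMap j e g h) (graphNormal j e g h) := by
  refine ⟨F.norm_graphNormal h, fun ε hε => ?_⟩
  have h0 : ∀ᶠ v in 𝓝 (0 : Vec n),
      (graphMap j e g h + v ∈ Ω ↔ graphMap j e g h + v ∈ epigraphSet j e g) := by
    have : Tendsto (fun v : Vec n => graphMap j e g h + v) (𝓝 0) (𝓝 (graphMap j e g h)) := by
      simpa using (continuous_const_add (graphMap j e g h)).tendsto (0 : Vec n)
    exact this.eventually hΩ
  have h1 : ∀ᶠ v in 𝓝 (0 : Vec n), ‖g (h + hproj j v) - g h - fderiv ℝ g h (hproj j v)‖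
      ≤ ε * ‖hproj j v‖ := by
    have h2 := (hasFDerivAt_iff_isLittleO_nhds_zero.1 hd.hasFDerivAt).def hε
    have h3 : Tendsto (fun v : Vec n => hproj j v) (𝓝 0) (𝓝 0) := by
      simpa using (hproj j).continuous.tendsto 0
    exact h3.eventually h2
  filter_upwards [h0, h1] with v hv0 hv1
  have hv2 : ε * ‖hproj j v‖ ≤ ε * ‖v‖ := by gcongr; exact F.norm_hproj_le v
  have hkey := F.inner_graphNormal (g := g) h v
  rw [real_inner_comm] at hkey
  have hJ := one_le_graphDensity g h
  have hmem : graphMap j e g h + v ∈ epigraphSet j e g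
      ↔ g (h + hproj j v) < g h + inner ℝ v e := by
    rw [epigraphSet, mem_ofPred_eq, map_add, inner_add_left, graphMap, F.hproj_add, F.inner_add]
  rw [Real.norm_eq_abs, abs_le] at hv1
  rw [hv0, hmem]
  have hεv : 0 ≤ ε * ‖v‖ := by positivity
  constructor <;> intro hlt
  · have : graphDensity g h * inner ℝ v (graphNormal j e g h) ≤ 1 * inner ℝ v (graphNormal j e g h) :=
      mul_le_mul_of_nonpos_right hJ (by linarith)
    linarith [hv1.2]
  · have : 1 * inner ℝ v (graphNormal j e g h) ≤ graphDensity g h * inner ℝ v (graphNormal j e g h) :=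
      mul_le_mul_of_nonneg_right hJ (by linarith)
    linarith [hv1.1]

/-- The product with `e` is minus the inverse of the density, and the Lipschitz constant bounds the
density. This is the uniform transversality behind all trace estimates. -/
theorem IsFrame.inner_graphNormal_le (hg : LipschitzWith K g) (h : H) :
    inner ℝ (graphNormal j e g h) e ≤ -(√(1 + (K : ℝ) ^ 2))⁻¹ := by
  have h1 := F.inner_graphNormal (g := g) h e
  rw [F.hproj_e, map_zero, real_inner_self_eq_norm_sq, F.norm_eq_one] at h1
  have h0 : 0 < graphDensity g h := zero_lt_one.trans_le (one_le_graphDensity g h)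
  have h2 : inner ℝ (graphNormal j e g h) e = -(graphDensity g h)⁻¹ := by
    field_simp; linarith
  rw [h2, neg_le_neg_iff]
  exact inv_anti₀ h0 (graphDensity_le hg h)

theorem IsFrame.frontier_epigraphSet (hg : Continuous g) :
    frontier (epigraphSet j e g) = graphSet j e g := by
  have hc1 : Continuous fun x : Vec n => g (hproj j x) := by fun_prop
  have hc2 : Continuous fun x : Vec n => (inner ℝ x e : ℝ) := by fun_prop
  refine Subset.antisymm (frontier_lt_subset_eq hc1 hc2) fun x hx => ?_
  have hx : g (hproj j x) = inner ℝ x e := hx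
  have hopen : IsOpen (epigraphSet j e g) := isOpen_lt hc1 hc2
  rw [hopen.frontier_eq]
  refine ⟨?_, fun h => ?_⟩
  · have ht : Tendsto (fun t : ℝ => x + t • e) (𝓝[>] 0) (𝓝 x) := by
      have : Continuous fun t : ℝ => x + t • e := by fun_prop
      simpa using (this.tendsto 0).mono_left (nhdsWithin_le_nhds (s := Ioi 0))
    refine mem_closure_of_tendsto ht ?_
    filter_upwards [self_mem_nhdsWithin] with t ht
    have ht : 0 < t := ht
    rw [epigraphSet, mem_ofPred_eq, map_add, map_smul, F.hproj_e, smul_zero, add_zero, hx,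
      inner_add_left, real_inner_smul_left, real_inner_self_eq_norm_sq, F.norm_eq_one]
    linarith
  · have h : g (hproj j x) < inner ℝ x e := h
    linarith

theorem IsFrame.measurableEmbedding (hg : LipschitzWith K g) :
    MeasurableEmbedding (graphMap j e g) :=
  (lipschitzWith_graphMap hg).continuous.measurableEmbedding (injective_graphMap F.inner_eq_zero g)

/-- The surface measure on a Lipschitz graph. -/
theorem IsFrame.restrict_graphSet (hg : LipschitzWith K g) :
    (μHE[finrank ℝ H] : Measure (Vec n)).restrict (graphSet j e g)
      = (volume.withDensity fun h => ENNReal.ofReal (graphDensity g h)).map (graphMap j e g) := by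
  ext B hB
  rw [(F.measurableEmbedding hg).map_apply, withDensity_apply _
    ((F.measurableEmbedding hg).measurable hB), Measure.restrict_apply hB]
  have := graph_area F.norm_eq_one F.inner_eq_zero hg ((F.measurableEmbedding hg).measurable hB)
  rw [image_preimage_eq_inter_range, F.range_graphMap] at this
  exact this

end LocalChart

/-! ### Divergence theorem, transversality and cone property near a point of the closure -/

section LocalDomain

open Module (finrank)
open scoped NNReal

/-- The local properties of a Lipschitz domain `Ω` in the ball `B(x₀, r)`, where `e` points
inwards. -/
structure IsLocalDomain {n : ℕ} (Ω : Set (Vec n)) (x₀ : Vec n) (r : ℝ) (e : Vec n) (c : ℝ) :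
    Prop where
  r_pos : 0 < r
  c_pos : 0 < c
  divergence : ∀ φ : Vec n → ℝ, ContDiff ℝ 1 φ → HasCompactSupport φ →
    tsupport φ ⊆ Metric.ball x₀ r → ∀ v,
    ∫ x in Ω, fderiv ℝ φ x v = ∫ x, φ x * inner ℝ (outerNormal Ω x) v ∂surf Ω
  finite : surf Ω (Metric.ball x₀ r) < ⊤
  normal : ∀ᵐ x ∂surf Ω, x ∈ Metric.ball x₀ r →
    (∃ ν, IsOuterNormal Ω x ν) ∧ inner ℝ (outerNormal Ω x) e ≤ -c
  cone : ∀ x ∈ Ω ∩ Metric.ball x₀ r, ∀ t ∈ Ioo 0 r, Metric.ball (x + t • e) (c * t) ⊆ Ω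

theorem IsOuterNormal.outerNormal_eq {n : ℕ} {Ω : Set (Vec n)} {x ν : Vec n}
    (h : IsOuterNormal Ω x ν) : outerNormal Ω x = ν := by
  have h' : ∃ ν, IsOuterNormal Ω x ν := ⟨ν, h⟩
  rw [outerNormal, dif_pos h']
  exact h'.choose_spec.unique h

/-- Inside a small ball the domain coincides with the epigraph and its frontier with the graph, so
each property is inherited from the model situation. -/
theorem IsFrame.isLocalDomain {n : ℕ} {H : Type*} [NormedAddCommGroup H] [InnerProductSpace ℝ H]
    [FiniteDimensional ℝ H] [MeasurableSpace H] [BorelSpace H] {j : H →ₗᵢ[ℝ] Vec n} {e : Vec n}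
    (F : IsFrame j e) (hH : finrank ℝ H = n - 1) {g : H → ℝ} {K : ℝ≥0} (hg : LipschitzWith K g)
    {Ω : Set (Vec n)} {x₀ : Vec n} (hΩ : ∀ᶠ x in 𝓝 x₀, (x ∈ Ω ↔ x ∈ epigraphSet j e g)) :
    ∃ r c, IsLocalDomain Ω x₀ r e c := by
  obtain ⟨R, hR, hball⟩ := Metric.eventually_nhds_iff_ball.1 hΩ
  set U := Metric.ball x₀ R with hU
  have hUo : IsOpen U := Metric.isOpen_ball
  have hfr : frontier Ω ∩ U = graphSet j e g ∩ U := by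
    rw [← F.frontier_epigraphSet hg.continuous, ← frontier_inter_open_inter hUo,
      ← frontier_inter_open_inter (s := epigraphSet j e g) hUo]
    congr 2
    ext x; constructor <;> rintro ⟨h1, h2⟩ <;> refine ⟨?_, h2⟩
    · exact (hball x h2).1 h1
    · exact (hball x h2).2 h1
  have hemb := F.measurableEmbedding (g := g) hg
  have hsurf : (surf Ω).restrict U = ((volume.withDensity fun h =>
      ENNReal.ofReal (graphDensity g h)).map (graphMap j e g)).restrict U := by
    rw [← F.restrict_graphSet hg, surf, Measure.restrict_restrict hUo.measurableSet,
      Measure.restrict_restrict hUo.measurableSet, inter_comm, hfr, inter_comm, hH]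
  have hnormal : ∀ h, DifferentiableAt ℝ g h → graphMap j e g h ∈ U →
      IsOuterNormal Ω (graphMap j e g h) (graphNormal j e g h) := fun h hd hm =>
    F.isOuterNormal hd (by filter_upwards [hUo.mem_nhds hm] with x hx using hball x hx)
  have hdiff : ∀ᵐ h : H, DifferentiableAt ℝ g h := hg.ae_differentiableAt
  have hJm : Measurable fun h => ENNReal.ofReal (graphDensity g h) :=
    (measurable_graphDensity g).ennreal_ofReal
  -- The first bound serves the cone property, the second the transversality of the normal.
  set c : ℝ := min (1 / (1 + K)) ((√(1 + (K : ℝ) ^ 2))⁻¹) with hc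
  have hc0 : 0 < c := by
    refine lt_min (by positivity) (by positivity)
  have hc1 : c * (1 + K) ≤ 1 := by
    have : c ≤ 1 / (1 + K) := min_le_left _ _
    rwa [le_div_iff₀ (by positivity)] at this
  have hrR : R / 4 ≤ R := by linarith
  -- A point of the cone is within `R / 4 + t + c t < 3 R / 4` of `x₀`, hence still in the ball
  -- where the graph description holds.
  refine ⟨R / 4, c, by positivity, hc0, ?_, ?_, ?_, ?_⟩
  · intro φ hφ hφc hφs v
    have hφs' : tsupport φ ⊆ U := hφs.trans (Metric.ball_subset_ball hrR)
    have hz : ∀ x, x ∉ U → fderiv ℝ φ x v = 0 := fun x hx => by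
      have : fderiv ℝ φ x = 0 := by
        by_contra hne
        exact hx (hφs' (support_fderiv_subset ℝ hne))
      rw [this]; rfl
    have hz' : ∀ x, x ∉ U → φ x = 0 := fun x hx => by
      by_contra hne
      exact hx (hφs' (subset_tsupport φ hne))
    have e1 : ∫ x in Ω, fderiv ℝ φ x v = ∫ x in epigraphSet j e g, fderiv ℝ φ x v := by
      have h1 : (Ω ∩ U) = (epigraphSet j e g ∩ U) := by
        ext x; constructor <;> rintro ⟨h1, h2⟩ <;> refine ⟨?_, h2⟩
        · exact (hball x h2).1 h1
        · exact (hball x h2).2 h1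
      rw [← setIntegral_eq_integral_of_forall_compl_eq_zero hz,
        ← setIntegral_eq_integral_of_forall_compl_eq_zero (μ := volume.restrict (epigraphSet j e g)) hz,
        Measure.restrict_restrict hUo.measurableSet, Measure.restrict_restrict hUo.measurableSet,
        inter_comm, h1, inter_comm]
    have hz2 : ∀ x, x ∉ U → φ x * inner ℝ (outerNormal Ω x) v = 0 := fun x hx => by
      rw [hz' x hx, zero_mul]
    rw [e1, epigraphSet, F.integral_epigraph hg hφ hφc,
      ← setIntegral_eq_integral_of_forall_compl_eq_zero hz2, hsurf,
      setIntegral_eq_integral_of_forall_compl_eq_zero hz2, hemb.integral_map,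
      integral_withDensity_eq_integral_toReal_smul hJm (ae_of_all _ fun _ => ENNReal.ofReal_lt_top)]
    refine integral_congr_ae ?_
    filter_upwards [hdiff] with h hd
    rw [ENNReal.toReal_ofReal (zero_le_one.trans (one_le_graphDensity g h)), smul_eq_mul]
    by_cases hm : graphMap j e g h ∈ U
    · rw [(hnormal h hd hm).outerNormal_eq, ← F.inner_graphNormal]
      ring
    · rw [hz' _ hm]
      ring
  · refine (measure_mono (Metric.ball_subset_ball hrR)).trans_lt ?_
    rw [← Measure.restrict_apply_self, hsurf, Measure.restrict_apply_self, hemb.map_apply,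
      withDensity_apply _ (hemb.measurable hUo.measurableSet)]
    have hsub : graphMap j e g ⁻¹' U ⊆ Metric.ball (hproj j x₀) R := by
      intro h hh
      rw [mem_preimage, hU, Metric.mem_ball, dist_eq_norm] at hh
      rw [Metric.mem_ball, dist_eq_norm]
      have := F.norm_hproj_le (graphMap j e g h - x₀)
      rw [map_sub, graphMap, F.hproj_add] at this
      exact this.trans_lt hh
    calc ∫⁻ h in graphMap j e g ⁻¹' U, ENNReal.ofReal (graphDensity g h)
        ≤ ∫⁻ h in Metric.ball (hproj j x₀) R, ENNReal.ofReal (√(1 + (K : ℝ) ^ 2)) :=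
          (lintegral_mono fun h => ENNReal.ofReal_le_ofReal (graphDensity_le hg h)).trans
            (lintegral_mono_set hsub)
      _ < ⊤ := by
          rw [setLIntegral_const]
          exact ENNReal.mul_lt_top ENNReal.ofReal_lt_top measure_ball_lt_top
  · have h1 : ∀ᵐ x ∂(surf Ω).restrict U,
        (∃ ν, IsOuterNormal Ω x ν) ∧ inner ℝ (outerNormal Ω x) e ≤ -c := by
      rw [hsurf, ae_restrict_iff' hUo.measurableSet, hemb.ae_map_iff]
      refine (withDensity_absolutelyContinuous _ _).ae_le ?_
      filter_upwards [hdiff] with h hd hm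
      have h2 := hnormal h hd hm
      refine ⟨⟨_, h2⟩, ?_⟩
      rw [h2.outerNormal_eq]
      exact (F.inner_graphNormal_le hg h).trans (neg_le_neg (min_le_right _ _))
    rw [ae_restrict_iff' hUo.measurableSet] at h1
    filter_upwards [h1] with x hx hm using hx (Metric.ball_subset_ball hrR hm)
  · rintro x ⟨hx, hxb⟩ t ⟨ht0, htr⟩ y hy
    rw [Metric.mem_ball, dist_eq_norm] at hy hxb
    have hcl : c ≤ 1 := by nlinarith [K.2, hc0]
    have hct : c * t ≤ t := by nlinarith
    have hyU : y ∈ U := by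
      rw [hU, Metric.mem_ball, dist_eq_norm]
      have : y - x₀ = (y - (x + t • e)) + t • e + (x - x₀) := by module
      rw [this]
      refine (norm_add₃_le).trans_lt ?_
      rw [norm_smul, F.norm_eq_one, Real.norm_of_nonneg ht0.le]
      linarith
    have hxU : x ∈ U := by
      rw [hU, Metric.mem_ball, dist_eq_norm]; linarith
    have hxe : g (hproj j x) < inner ℝ x e := (hball x hxU).1 hx
    refine (hball y hyU).2 ?_
    rw [epigraphSet, mem_ofPred_eq]
    have h1 : hproj j y - hproj j x = hproj j (y - (x + t • e)) := by
      rw [map_sub, map_add, map_smul, F.hproj_e]; simp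
    have h2 : g (hproj j y) - g (hproj j x) ≤ K * ‖y - (x + t • e)‖ := by
      have h3 := hg.dist_le_mul (hproj j y) (hproj j x)
      rw [dist_eq_norm, dist_eq_norm, h1] at h3
      refine (le_abs_self _).trans (h3.trans ?_)
      gcongr
      exact F.norm_hproj_le _
    have h4 : inner ℝ y e = inner ℝ (y - (x + t • e)) e + inner ℝ x e + t := by
      rw [inner_sub_left, inner_add_left, real_inner_smul_left, real_inner_self_eq_norm_sq,
        F.norm_eq_one]
      ring
    have h5 : |inner ℝ (y - (x + t • e)) e| ≤ ‖y - (x + t • e)‖ := by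
      simpa [F.norm_eq_one] using abs_real_inner_le_norm (y - (x + t • e)) e
    have h6 := (abs_le.1 h5).1
    have h7 : (1 + K) * ‖y - (x + t • e)‖ < (1 + K) * (c * t) := by
      have : (0 : ℝ) < 1 + K := by positivity
      gcongr
    have h8 : (1 + K) * (c * t) ≤ t := by nlinarith
    linarith

/-- Lipschitz domains have the expected local properties at every point of their closure. -/
theorem IsLipschitzDomain.exists_isLocalDomain {n : ℕ} {Ω : Set (Vec n)} (hΩ : IsLipschitzDomain Ω)
    {x₀ : Vec n} (hx : x₀ ∈ closure Ω) : ∃ r e c, IsLocalDomain Ω x₀ r e c := by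
  by_cases hx' : x₀ ∈ Ω
  · obtain ⟨R, hR, hball⟩ := Metric.isOpen_iff.1 hΩ.isOpen x₀ hx'
    have hsub : Metric.ball x₀ (R / 2) ⊆ Metric.ball x₀ R := Metric.ball_subset_ball (by linarith)
    have hs : surf Ω (Metric.ball x₀ (R / 2)) = 0 := by
      rw [surf, Measure.restrict_apply measurableSet_ball]
      convert measure_empty (μ := (μHE[n - 1] : Measure (Vec n)))
      rw [hΩ.isOpen.frontier_eq]
      refine eq_empty_of_forall_notMem ?_
      rintro x ⟨h1, h2⟩
      exact h2.2 (hball (hsub h1))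
    have hae : ∀ᵐ x ∂surf Ω, x ∉ Metric.ball x₀ (R / 2) := measure_eq_zero_iff_ae_notMem.1 hs
    -- At an interior point no direction is needed: the cone is a ball around `x`, and the
    -- statements on the normal concern a null set.
    refine ⟨R / 2, 0, 1, by positivity, one_pos, ?_, hs ▸ ENNReal.zero_lt_top, ?_, ?_⟩
    · intro φ hφ hφc hφs v
      have hz : ∀ x, x ∉ Ω → fderiv ℝ φ x v = 0 := fun x hx => by
        have : fderiv ℝ φ x = 0 := by
          by_contra hne
          exact hx (hball (hsub (hφs (support_fderiv_subset ℝ hne))))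
        rw [this]; rfl
      obtain ⟨C, hC⟩ := hφ.lipschitzWith_of_hasCompactSupport hφc one_ne_zero
      rw [setIntegral_eq_integral_of_forall_compl_eq_zero hz, integral_fderiv_eq_zero hC hφc]
      refine (integral_eq_zero_of_ae ?_).symm
      filter_upwards [hae] with x hx
      have : φ x = 0 := by
        by_contra hne
        exact hx (hφs (subset_tsupport φ hne))
      rw [this, zero_mul, Pi.zero_apply]
    · filter_upwards [hae] with x hx hx' using absurd hx' hx
    · rintro x ⟨-, hxb⟩ t ⟨ht0, ht⟩
      rw [smul_zero, add_zero, one_mul]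
      refine Subset.trans (fun y hy => ?_) hball
      rw [Metric.mem_ball] at *
      linarith [dist_triangle y x x₀]
  · have hfr : x₀ ∈ frontier Ω := by rw [hΩ.isOpen.frontier_eq]; exact ⟨hx, hx'⟩
    obtain ⟨e, g, he, ⟨K, hg⟩, hloc⟩ := hΩ.localGraph x₀ hfr
    obtain ⟨j, F, hH⟩ := exists_frame he
    have hgj : LipschitzWith K fun h => g (j h) := by
      have := hg.comp j.lipschitz
      rw [mul_one] at this
      exact this
    obtain ⟨r, c, h⟩ := F.isLocalDomain hH hgj (Ω := Ω) (x₀ := x₀) (by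
      filter_upwards [hloc] with x hx
      rw [hx, F.sub_inner_smul]; rfl)
    exact ⟨r, e, c, h⟩

end LocalDomain

/-! ### Measurability of the normal -/

section NormalMeasurable

variable {n : ℕ} {Ω : Set (Vec n)}

theorem IsOuterNormal.eventually_mem {x ν w : Vec n} (h : IsOuterNormal Ω x ν)
    (hw : inner ℝ w ν < (0 : ℝ)) : ∀ᶠ k : ℕ in atTop, x + ((k : ℝ) + 1)⁻¹ • w ∈ Ω := by
  have hw0 : 0 < ‖w‖ := norm_pos_iff.2 fun h0 => by simp [h0] at hw
  have ht : Tendsto (fun k : ℕ => ((k : ℝ) + 1)⁻¹ • w) atTop (𝓝 0) := by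
    simpa using (tendsto_one_div_add_atTop_nhds_zero_nat (𝕜 := ℝ)).smul_const w
  have hε : 0 < -inner ℝ w ν / (2 * ‖w‖) := div_pos (by linarith) (by positivity)
  filter_upwards [ht.eventually (h.2 _ hε)] with k hk
  refine hk.1 ?_
  have hk0 : (0 : ℝ) < ((k : ℝ) + 1)⁻¹ := by positivity
  rw [real_inner_smul_left, norm_smul, Real.norm_of_nonneg hk0.le]
  have : -inner ℝ w ν / (2 * ‖w‖) * (((k : ℝ) + 1)⁻¹ * ‖w‖) = ((k : ℝ) + 1)⁻¹ * (-inner ℝ w ν / 2) := by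
    field_simp
  rw [this]
  nlinarith

theorem IsOuterNormal.eventually_notMem {x ν w : Vec n} (h : IsOuterNormal Ω x ν)
    (hw : (0 : ℝ) < inner ℝ w ν) : ∀ᶠ k : ℕ in atTop, x + ((k : ℝ) + 1)⁻¹ • w ∉ Ω := by
  have hw0 : 0 < ‖w‖ := norm_pos_iff.2 fun h0 => by simp [h0] at hw
  have ht : Tendsto (fun k : ℕ => ((k : ℝ) + 1)⁻¹ • w) atTop (𝓝 0) := by
    simpa using (tendsto_one_div_add_atTop_nhds_zero_nat (𝕜 := ℝ)).smul_const w
  have hε : 0 < inner ℝ w ν / (2 * ‖w‖) := div_pos (by linarith) (by positivity)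
  filter_upwards [ht.eventually (h.2 _ hε)] with k hk
  refine hk.2 ?_
  have hk0 : (0 : ℝ) < ((k : ℝ) + 1)⁻¹ := by positivity
  rw [real_inner_smul_left, norm_smul, Real.norm_of_nonneg hk0.le]
  have : inner ℝ w ν / (2 * ‖w‖) * (((k : ℝ) + 1)⁻¹ * ‖w‖) = ((k : ℝ) + 1)⁻¹ * (inner ℝ w ν / 2) := by
    field_simp
  rw [this]
  nlinarith

/-- The first moment of the part of `Ω` in a small ball around `x`. -/
def localMoment (Ω : Set (Vec n)) (k : ℕ) (x : Vec n) : Vec n :=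
  ∫ w in Metric.ball (0 : Vec n) 1, Ω.indicator (fun _ => (1 : ℝ)) (x + ((k : ℝ) + 1)⁻¹ • w) • w

theorem measurable_localMoment (hΩ : MeasurableSet Ω) (k : ℕ) : Measurable (localMoment Ω k) := by
  have h1 : Measurable fun p : Vec n × Vec n =>
      Ω.indicator (fun _ => (1 : ℝ)) (p.1 + ((k : ℝ) + 1)⁻¹ • p.2) • p.2 := by
    have h0 : Measurable fun p : Vec n × Vec n =>
        Ω.indicator (fun _ => (1 : ℝ)) (p.1 + ((k : ℝ) + 1)⁻¹ • p.2) :=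
      (measurable_const.indicator hΩ).comp (by fun_prop : Measurable _)
    exact h0.smul measurable_snd
  exact (h1.stronglyMeasurable.integral_prod_right
    (ν := volume.restrict (Metric.ball (0 : Vec n) 1))).measurable

/-- The first moment of a half ball. -/
def halfMoment (ν : Vec n) : Vec n :=
  ∫ w in Metric.ball (0 : Vec n) 1, {w : Vec n | inner ℝ w ν < (0 : ℝ)}.indicator (fun _ => (1 : ℝ)) w • w

/-- Blow-up: by definition of the normal, the rescaled indicator of `Ω` converges to that of a
half-space off the bounding hyperplane, which is null. Dominated convergence concludes. -/
theorem tendsto_localMoment (hΩ : MeasurableSet Ω) {x ν : Vec n} (h : IsOuterNormal Ω x ν) :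
    Tendsto (fun k => localMoment Ω k x) atTop (𝓝 (halfMoment ν)) := by
  have hν0 : ν ≠ 0 := fun h0 => by have := h.1; simp [h0] at this
  have hnull : volume {w : Vec n | inner ℝ w ν = (0 : ℝ)} = 0 := by
    have h1 : {w : Vec n | inner ℝ w ν = (0 : ℝ)} = ((ℝ ∙ ν)ᗮ : Submodule ℝ (Vec n)) := by
      ext w; simp [Submodule.mem_orthogonal_singleton_iff_inner_left]
    rw [h1]
    refine Measure.addHaar_submodule _ _ fun htop => ?_
    have h2 : ν ∈ (ℝ ∙ ν)ᗮ := htop ▸ Submodule.mem_top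
    rw [Submodule.mem_orthogonal_singleton_iff_inner_left] at h2
    exact hν0 (inner_self_eq_zero.1 h2)
  refine tendsto_integral_of_dominated_convergence (fun _ => 1) (fun k => ?_) ?_ (fun k => ?_) ?_
  · have h0 : Measurable fun w : Vec n =>
        Ω.indicator (fun _ => (1 : ℝ)) (x + ((k : ℝ) + 1)⁻¹ • w) :=
      (measurable_const.indicator hΩ).comp (by fun_prop : Measurable _)
    exact (h0.smul measurable_id).aestronglyMeasurable
  · exact integrableOn_const measure_ball_lt_top.ne
  · filter_upwards [ae_restrict_mem measurableSet_ball] with w hw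
    rw [mem_ball_zero_iff] at hw
    rw [norm_smul]
    refine mul_le_one₀ ?_ (norm_nonneg _) hw.le
    refine (norm_indicator_le_norm_self _ _).trans (by simp)
  · have hne : ∀ᵐ w ∂volume.restrict (Metric.ball (0 : Vec n) 1), inner ℝ w ν ≠ (0 : ℝ) :=
      ae_restrict_of_ae (measure_eq_zero_iff_ae_notMem.1 hnull)
    filter_upwards [hne] with w hw
    refine Tendsto.smul_const (tendsto_const_nhds.congr' ?_) w
    rcases lt_or_gt_of_ne hw with hlt | hgt
    · filter_upwards [h.eventually_mem hlt] with k hk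
      rw [indicator_of_mem (by exact hlt), indicator_of_mem hk]
    · filter_upwards [h.eventually_notMem hgt] with k hk
      rw [indicator_of_notMem (by simpa using hgt.le), indicator_of_notMem hk]

/-- The reflection across the line spanned by `ν` preserves the half ball and therefore fixes its
moment, which must lie on that line. The sign is read off from the product with `ν`, negative on the
half ball. -/
theorem halfMoment_eq {ν : Vec n} (hν : ‖ν‖ = 1) :
    ∃ κ : ℝ, 0 < κ ∧ halfMoment ν = -κ • ν := by
  set f : Vec n → Vec n := fun w =>
    {w : Vec n | inner ℝ w ν < (0 : ℝ)}.indicator (fun _ => (1 : ℝ)) w • w with hf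
  have hS : MeasurableSet {w : Vec n | inner ℝ w ν < (0 : ℝ)} :=
    measurableSet_lt (by fun_prop) measurable_const
  have hfi : IntegrableOn f (Metric.ball (0 : Vec n) 1) := by
    refine Measure.integrableOn_of_bounded (M := 1) measure_ball_lt_top.ne ?_ ?_
    · have h0 : Measurable ({w : Vec n | inner ℝ w ν < (0 : ℝ)}.indicator (fun _ => (1 : ℝ))) :=
        measurable_const.indicator hS
      exact (h0.smul measurable_id).aestronglyMeasurable
    · filter_upwards [ae_restrict_mem measurableSet_ball] with w hw
      rw [mem_ball_zero_iff] at hw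
      rw [hf, norm_smul]
      refine mul_le_one₀ ?_ (norm_nonneg _) hw.le
      refine (norm_indicator_le_norm_self _ _).trans (by simp)
  set R := (ℝ ∙ ν).reflection with hR
  have hRν : R ν = ν := Submodule.reflection_mem_subspace_eq_self (Submodule.mem_span_singleton_self ν)
  have hRin : ∀ w, inner ℝ (R w) ν = (inner ℝ w ν : ℝ) := fun w => by
    conv_lhs => rw [← hRν]
    exact R.inner_map_map w ν
  have hfix : R (halfMoment ν) = halfMoment ν := by
    have h1 : R (halfMoment ν) = ∫ w in Metric.ball (0 : Vec n) 1, R (f w) :=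
      (R.toContinuousLinearEquiv.toContinuousLinearMap.integral_comp_comm hfi).symm
    have h2 : ∀ w, R (f w) = f (R w) := fun w => by
      simp only [hf, map_smul, indicator, mem_ofPred_eq, hRin]
    have h3 := R.measurePreserving.setIntegral_preimage_emb
      R.toHomeomorph.measurableEmbedding f (Metric.ball 0 1)
    rw [LinearIsometryEquiv.preimage_ball, map_zero] at h3
    rw [h1]
    simp_rw [h2]
    exact h3
  have hmem := (Submodule.reflection_eq_self_iff _).1 hfix
  obtain ⟨a, ha⟩ := Submodule.mem_span_singleton.1 hmem
  refine ⟨-a, ?_, by rw [neg_neg, ha]⟩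
  have hia : a = ∫ w in Metric.ball (0 : Vec n) 1, inner ℝ ν (f w) := by
    rw [integral_inner hfi]
    change a = inner ℝ ν (halfMoment ν)
    rw [← ha, real_inner_smul_right, real_inner_self_eq_norm_sq, hν]; ring
  rw [hia, ← integral_neg]
  rw [setIntegral_pos_iff_support_of_nonneg_ae]
  · have hopen : IsOpen ({w : Vec n | inner ℝ w ν < (0 : ℝ)} ∩ Metric.ball 0 1) :=
      (isOpen_lt (by fun_prop) continuous_const).inter Metric.isOpen_ball
    refine (hopen.measure_pos volume ⟨-((1 / 2 : ℝ) • ν), ?_, ?_⟩).trans_le (measure_mono ?_)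
    · rw [mem_ofPred_eq, inner_neg_left, real_inner_smul_left, real_inner_self_eq_norm_sq, hν]
      norm_num
    · rw [mem_ball_zero_iff, norm_neg, norm_smul, hν]; norm_num
    · refine inter_subset_inter_left _ fun w hw => ?_
      have hw' : inner ℝ w ν < (0 : ℝ) := hw
      rw [Function.mem_support, hf]
      simp only [indicator_of_mem hw, one_smul]
      rw [real_inner_comm]
      linarith
  · refine ae_of_all _ fun w => ?_
    simp only [Pi.zero_apply, hf, indicator]
    split_ifs with hw
    · have hw' : inner ℝ w ν < (0 : ℝ) := hw
      rw [one_smul, real_inner_comm]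
      linarith
    · simp
  · exact (hfi.const_inner ν).neg

/-- The normal is defined by choice, but it is the limit of the normalized local moments with
opposite sign, which are measurable. An arbitrary measure is allowed because the lemma is also
applied to the marginal of `μ'` before this is known to be surface measure. -/
theorem aemeasurable_outerNormal (hΩ : MeasurableSet Ω) {μ : Measure (Vec n)}
    (h : ∀ᵐ x ∂μ, ∃ ν, IsOuterNormal Ω x ν) : AEMeasurable (outerNormal Ω) μ := by
  refine aemeasurable_of_tendsto_metrizable_ae atTop
    (f := fun k x => -(‖localMoment Ω k x‖⁻¹ • localMoment Ω k x)) (fun k => ?_) ?_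
  · have := measurable_localMoment hΩ k
    exact (this.norm.inv.smul this).neg.aemeasurable
  · filter_upwards [h] with x ⟨ν, hν⟩
    rw [hν.outerNormal_eq]
    obtain ⟨κ, hκ, hm⟩ := halfMoment_eq hν.1
    have h1 := tendsto_localMoment hΩ hν
    have h2 : ‖halfMoment ν‖ = κ := by
      rw [hm, norm_smul, hν.1, norm_neg, Real.norm_of_nonneg hκ.le, mul_one]
    have h3 := ((h1.norm.inv₀ (by rw [h2]; exact hκ.ne')).smul h1).neg
    rw [h2, hm, smul_smul] at h3
    have h4 : -((κ⁻¹ * -κ) • ν) = ν := by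
      rw [mul_neg, inv_mul_cancel₀ hκ.ne']; simp
    rwa [h4] at h3

theorem norm_outerNormal_le (x : Vec n) : ‖outerNormal Ω x‖ ≤ 1 := by
  by_cases h : ∃ ν, IsOuterNormal Ω x ν
  · obtain ⟨ν, hν⟩ := h
    rw [hν.outerNormal_eq, hν.1]
  · rw [outerNormal, dif_neg h]; simp

end NormalMeasurable

/-! ### The divergence theorem -/

section Global

variable {n : ℕ} {Ω : Set (Vec n)}

/-- A finite family of local descriptions with a subordinate partition of unity. -/
structure IsAtlas {ι : Type} [Fintype ι] (Ω : Set (Vec n)) (x₀ : ι → Vec n) (r : ι → ℝ)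
    (e : ι → Vec n) (c : ι → ℝ) (χ : ι → Vec n → ℝ) : Prop where
  isLocalDomain : ∀ i, IsLocalDomain Ω (x₀ i) (r i) (e i) (c i)
  smooth : ∀ i, ContDiff ℝ ∞ (χ i)
  nonneg : ∀ i x, 0 ≤ χ i x
  subordinate : ∀ i, tsupport (χ i) ⊆ Metric.ball (x₀ i) (r i)
  sum_eq_one : ∀ x ∈ closure Ω, ∑ i, χ i x = 1

open scoped Manifold in
theorem IsLipschitzDomain.exists_isAtlas (hΩ : IsLipschitzDomain Ω) :
    ∃ (ι : Type) (_ : Fintype ι) (x₀ : ι → Vec n) (r : ι → ℝ) (e : ι → Vec n) (c : ι → ℝ)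
      (χ : ι → Vec n → ℝ), IsAtlas Ω x₀ r e c χ := by
  have hcpt : IsCompact (closure Ω) := hΩ.isBounded.isCompact_closure
  choose! r e c hloc using fun (x : Vec n) (hx : x ∈ closure Ω) => hΩ.exists_isLocalDomain hx
  obtain ⟨t, ht, hcov⟩ := hcpt.elim_nhds_subcover (fun x => Metric.ball x (r x))
    fun x hx => Metric.ball_mem_nhds x (hloc x hx).r_pos
  have hcov' : closure Ω ⊆ ⋃ i : Fin t.card, Metric.ball ((t.equivFin.symm i : t) : Vec n)
      (r (t.equivFin.symm i : t)) := by
    intro x hx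
    obtain ⟨y, hy, hxy⟩ := mem_iUnion₂.1 (hcov hx)
    exact mem_iUnion.2 ⟨t.equivFin ⟨y, hy⟩, by simpa using hxy⟩
  obtain ⟨f, hf⟩ := SmoothPartitionOfUnity.exists_isSubordinate 𝓘(ℝ, Vec n) isClosed_closure
    (fun i : Fin t.card => Metric.ball ((t.equivFin.symm i : t) : Vec n)
      (r (t.equivFin.symm i : t))) (fun _ => Metric.isOpen_ball) hcov'
  refine ⟨Fin t.card, inferInstance, fun i => (t.equivFin.symm i : t),
    fun i => r (t.equivFin.symm i : t), fun i => e (t.equivFin.symm i : t),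
    fun i => c (t.equivFin.symm i : t), fun i => f i,
    ⟨fun i => hloc _ (ht _ (t.equivFin.symm i).2), fun i => (f i).contMDiff.contDiff,
    fun i x => f.nonneg i x, hf, fun x hx => ?_⟩⟩
  rw [← f.sum_eq_one hx, finsum_eq_sum_of_fintype]

variable {ι : Type} [Fintype ι] {x₀ : ι → Vec n} {r : ι → ℝ} {e : ι → Vec n} {c : ι → ℝ}
  {χ : ι → Vec n → ℝ}

theorem surf_compl_closure : surf Ω (closure Ω)ᶜ = 0 := by
  rw [surf, Measure.restrict_apply isClosed_closure.measurableSet.compl]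
  convert measure_empty (μ := (μHE[n - 1] : Measure (Vec n)))
  exact eq_empty_of_forall_notMem fun x hx => hx.1 (frontier_subset_closure hx.2)

theorem ae_surf_mem_closure : ∀ᵐ x ∂surf Ω, x ∈ closure Ω :=
  surf_compl_closure

theorem IsAtlas.exists_mem (A : IsAtlas Ω x₀ r e c χ) {x : Vec n} (hx : x ∈ closure Ω) :
    ∃ i, x ∈ Metric.ball (x₀ i) (r i) := by
  by_contra! h
  have h1 := A.sum_eq_one x hx
  rw [Finset.sum_eq_zero] at h1
  · exact zero_ne_one h1
  · intro i _
    by_contra h0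
    exact h i (A.subordinate i (subset_tsupport _ h0))

theorem IsLipschitzDomain.isFiniteMeasure_surf (hΩ : IsLipschitzDomain Ω) :
    IsFiniteMeasure (surf Ω) := by
  obtain ⟨ι, _, x₀, r, e, c, χ, A⟩ := hΩ.exists_isAtlas
  refine ⟨?_⟩
  have h1 : (univ : Set (Vec n)) ⊆ (closure Ω)ᶜ ∪ ⋃ i, Metric.ball (x₀ i) (r i) := by
    intro x _
    by_cases hx : x ∈ closure Ω
    · exact Or.inr (mem_iUnion.2 (A.exists_mem hx))
    · exact Or.inl hx
  refine (measure_mono h1).trans_lt ((measure_union_le _ _).trans_lt ?_)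
  rw [surf_compl_closure, zero_add]
  refine (measure_iUnion_le _).trans_lt ?_
  rw [tsum_fintype]
  exact ENNReal.sum_lt_top.2 fun i _ => (A.isLocalDomain i).finite

theorem IsLipschitzDomain.ae_normal (hΩ : IsLipschitzDomain Ω) :
    ∀ᵐ x ∂surf Ω, ∃ ν, IsOuterNormal Ω x ν := by
  obtain ⟨ι, _, x₀, r, e, c, χ, A⟩ := hΩ.exists_isAtlas
  have h1 := ae_all_iff.2 fun i => (A.isLocalDomain i).normal
  filter_upwards [h1, ae_surf_mem_closure] with x hx hc
  obtain ⟨i, hi⟩ := A.exists_mem hc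
  exact (hx i hi).1

theorem IsLipschitzDomain.aestronglyMeasurable_normal (hΩ : IsLipschitzDomain Ω) :
    AEStronglyMeasurable (outerNormal Ω) (surf Ω) :=
  (aemeasurable_outerNormal hΩ.isOpen.measurableSet hΩ.ae_normal).aestronglyMeasurable

theorem IsLipschitzDomain.integrable_mul_normal (hΩ : IsLipschitzDomain Ω) {f : Vec n → ℝ}
    (hf : Integrable f (surf Ω)) (v : Vec n) :
    Integrable (fun x => f x * inner ℝ (outerNormal Ω x) v) (surf Ω) := by
  refine hf.mul_bdd (c := ‖v‖) ?_ (ae_of_all _ fun x => ?_)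
  · exact hΩ.aestronglyMeasurable_normal.inner aestronglyMeasurable_const
  · refine (norm_inner_le_norm _ _).trans ?_
    have := norm_outerNormal_le (Ω := Ω) x
    nlinarith [norm_nonneg v]

theorem IsLipschitzDomain.integrable_surf (hΩ : IsLipschitzDomain Ω) {G : Type*}
    [NormedAddCommGroup G] {f : Vec n → G} (hf : Continuous f) : Integrable f (surf Ω) := by
  have := hΩ.isFiniteMeasure_surf
  have h1 : IntegrableOn f (closure Ω) (surf Ω) :=
    hf.continuousOn.integrableOn_compact hΩ.isBounded.isCompact_closure
  rwa [IntegrableOn, Measure.restrict_eq_self_of_ae_mem (ae_surf_mem_closure)] at h1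

theorem IsLipschitzDomain.integrable_vol (hΩ : IsLipschitzDomain Ω) {G : Type*}
    [NormedAddCommGroup G] {f : Vec n → G} (hf : Continuous f) :
    Integrable f (volume.restrict Ω) :=
  (hf.continuousOn.integrableOn_compact hΩ.isBounded.isCompact_closure).mono_set subset_closure

/-- The divergence theorem on a Lipschitz domain. -/
theorem IsLipschitzDomain.divergence (hΩ : IsLipschitzDomain Ω) {φ : Vec n → ℝ}
    (hφ : ContDiff ℝ 1 φ) (v : Vec n) :
    ∫ x in Ω, fderiv ℝ φ x v = ∫ x, φ x * inner ℝ (outerNormal Ω x) v ∂surf Ω := by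
  obtain ⟨ι, _, x₀, r, e, c, χ, A⟩ := hΩ.exists_isAtlas
  have hχ : ∀ i, ContDiff ℝ 1 (χ i) := fun i => (A.smooth i).of_le (by norm_cast)
  have hsm : ∀ i, ContDiff ℝ 1 (fun x => χ i x * φ x) := fun i => (hχ i).mul hφ
  have hloc : ∀ i, ∫ x in Ω, fderiv ℝ (fun x => χ i x * φ x) x v
      = ∫ x, (χ i x * φ x) * inner ℝ (outerNormal Ω x) v ∂surf Ω := by
    intro i
    have hcχ : HasCompactSupport (χ i) :=
      HasCompactSupport.of_support_subset_isCompact (isCompact_closedBall (x₀ i) (r i))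
        ((subset_tsupport _).trans ((A.subordinate i).trans Metric.ball_subset_closedBall))
    refine (A.isLocalDomain i).divergence _ (hsm i) hcχ.mul_right ?_ v
    exact (tsupport_mul_subset_left (f := χ i) (g := φ)).trans (A.subordinate i)
  have e1 : ∫ x in Ω, fderiv ℝ φ x v = ∫ x in Ω, ∑ i, fderiv ℝ (fun x => χ i x * φ x) x v := by
    refine setIntegral_congr_fun hΩ.isOpen.measurableSet fun x hx => ?_
    -- The functions `χ i` sum to one only on the closure of `Ω`, but near `x` this covers a whole
    -- neighbourhood since `Ω` is open.
    have h1 : fderiv ℝ φ x = fderiv ℝ (fun x => ∑ i, χ i x * φ x) x := by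
      refine Filter.EventuallyEq.fderiv_eq ?_
      filter_upwards [hΩ.isOpen.mem_nhds hx] with y hy
      rw [← Finset.sum_mul, A.sum_eq_one y (subset_closure hy), one_mul]
    rw [h1, fderiv_fun_sum fun i _ => (hsm i).differentiable one_ne_zero x]
    simp
  rw [e1, integral_finsetSum]
  · simp_rw [hloc]
    rw [← integral_finsetSum]
    · refine integral_congr_ae ?_
      filter_upwards [ae_surf_mem_closure] with x hx
      rw [← Finset.sum_mul, ← Finset.sum_mul, A.sum_eq_one x hx, one_mul]
    · exact fun i _ => hΩ.integrable_mul_normal (hΩ.integrable_surf (hsm i).continuous) v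
  · exact fun i _ => hΩ.integrable_vol
      (((hsm i).continuous_fderiv one_ne_zero).clm_apply continuous_const)

/-- A smooth vector field pointing uniformly outwards along the boundary. -/
theorem IsLipschitzDomain.exists_transverse (hΩ : IsLipschitzDomain Ω) :
    ∃ X : Vec n → Vec n, ContDiff ℝ ∞ X ∧ ∃ δ > 0, ∀ᵐ x ∂surf Ω,
      δ ≤ inner ℝ (outerNormal Ω x) (X x) := by
  obtain ⟨ι, _, x₀, r, e, c, χ, A⟩ := hΩ.exists_isAtlas
  -- The local directions `e i` point inwards, hence the sign. The constant lies below every `c i`,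
  -- and the added one keeps it meaningful for an empty family.
  refine ⟨fun x => -∑ i, χ i x • e i, ?_, (∑ i, (c i)⁻¹ + 1)⁻¹, ?_, ?_⟩
  · exact (ContDiff.sum fun i _ => (A.smooth i).smul contDiff_const).neg
  · have : 0 ≤ ∑ i, (c i)⁻¹ := Finset.sum_nonneg fun i _ => (inv_pos.2 (A.isLocalDomain i).c_pos).le
    positivity
  have hδ : ∀ i, (∑ i, (c i)⁻¹ + 1)⁻¹ ≤ c i := by
    intro i
    have hc := (A.isLocalDomain i).c_pos
    refine inv_le_of_inv_le₀ hc ?_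
    have := Finset.single_le_sum (f := fun i => (c i)⁻¹)
      (fun i _ => (inv_pos.2 (A.isLocalDomain i).c_pos).le) (Finset.mem_univ i)
    linarith
  have h1 := ae_all_iff.2 fun i => (A.isLocalDomain i).normal
  filter_upwards [h1, ae_surf_mem_closure] with x hx hc
  rw [inner_neg_right, inner_sum, ← Finset.sum_neg_distrib]
  calc (∑ i, (c i)⁻¹ + 1)⁻¹ = ∑ i, χ i x * (∑ i, (c i)⁻¹ + 1)⁻¹ := by
        rw [← Finset.sum_mul, A.sum_eq_one x hc, one_mul]
    _ ≤ _ := by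
        refine Finset.sum_le_sum fun i _ => ?_
        rw [real_inner_smul_right, ← mul_neg]
        by_cases h0 : χ i x = 0
        · rw [h0]; simp
        · refine mul_le_mul_of_nonneg_left ?_ (A.nonneg i x)
          have := (hx i (A.subordinate i (subset_tsupport _ h0))).2
          linarith [hδ i]

end Global

/-! ### Mollification -/

section Mollify

set_option linter.unusedSectionVars false

variable {n : ℕ} {G : Type*} [NormedAddCommGroup G] [NormedSpace ℝ G] [CompleteSpace G]

/-- Translations are continuous in `L¹`. -/
theorem tendsto_eLpNorm_translate {f : Vec n → G} (hf : MemLp f 1 volume) :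
    Tendsto (fun w : Vec n => eLpNorm (fun x => f (x - w) - f x) 1 volume) (𝓝 0) (𝓝 0) := by
  have : Fact ((1 : ℝ≥0∞) ≠ ⊤) := ⟨ENNReal.one_ne_top⟩
  have h1 : Continuous fun w : Vec n => DomAddAct.mk (-w) +ᵥ hf.toLp :=
    (DomAddAct.mkHomeomorph.continuous.comp continuous_neg).vadd continuous_const
  have h2 : Tendsto (fun w : Vec n => edist (DomAddAct.mk (-w) +ᵥ hf.toLp) hf.toLp) (𝓝 0) (𝓝 0) := by
    have := (h1.edist (continuous_const (y := hf.toLp))).tendsto (0 : Vec n)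
    simpa using this
  refine h2.congr fun w => ?_
  rw [DomAddAct.mk_vadd_toLp, Lp.edist_toLp_toLp]
  congr 1
  ext x
  simp [sub_eq_neg_add]

/-- Convolution of `f` with the kernel `ρ`. -/
def mollify (ρ : Vec n → ℝ) (f : Vec n → G) (x : Vec n) : G := ∫ w, ρ w • f (x - w)

theorem mollify_eq_convolution (ρ : Vec n → ℝ) (f : Vec n → G) :
    mollify ρ f = convolution ρ f (ContinuousLinearMap.lsmul ℝ ℝ) volume := rfl

/-- As `ρ` has integral one, `mollify ρ f - f` is an average of the differences `f (x - w) - f x`.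
Tonelli's theorem bounds its norm by the average of their norms. -/
theorem eLpNorm_mollify_sub_le {ρ : Vec n → ℝ} (hρ : Continuous ρ) (hρc : HasCompactSupport ρ)
    (hρ0 : ∀ w, 0 ≤ ρ w) (hρ1 : ∫ w, ρ w = 1) {f : Vec n → G} (hf : MemLp f 1 volume) {η : ℝ≥0∞}
    (hη : ∀ w, ρ w ≠ 0 → eLpNorm (fun x => f (x - w) - f x) 1 volume ≤ η) :
    eLpNorm (mollify ρ f - f) 1 volume ≤ η := by
  have hρi : Integrable ρ := hρ.integrable_of_hasCompactSupport hρc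
  have hfi : Integrable f := memLp_one_iff_integrable.1 hf
  have hconv : ∀ᵐ x : Vec n, Integrable (fun w => ρ w • f (x - w)) :=
    hρi.ae_convolution_exists (ContinuousLinearMap.lsmul ℝ ℝ) hfi
  have hmeas : AEMeasurable (Function.uncurry fun (x w : Vec n) => ‖ρ w • (f (x - w) - f x)‖ₑ)
      ((volume : Measure (Vec n)).prod volume) := by
    refine AEStronglyMeasurable.enorm ?_
    refine AEStronglyMeasurable.smul (hρ.comp continuous_snd).aestronglyMeasurable ?_
    refine AEStronglyMeasurable.sub ?_ hf.1.comp_fst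
    exact hf.1.comp_quasiMeasurePreserving (quasiMeasurePreserving_sub _ _)
  have hρl : ∫⁻ w, ‖ρ w‖ₑ = 1 := by
    have : ∀ w, ‖ρ w‖ₑ = ENNReal.ofReal (ρ w) := fun w => by
      rw [← ofReal_norm, Real.norm_of_nonneg (hρ0 w)]
    simp_rw [this]
    rw [← ofReal_integral_eq_lintegral_ofReal hρi (ae_of_all _ hρ0), hρ1, ENNReal.ofReal_one]
  calc eLpNorm (mollify ρ f - f) 1 volume
      = ∫⁻ x, ‖mollify ρ f x - f x‖ₑ := by rw [eLpNorm_one_eq_lintegral_enorm]; rfl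
    _ ≤ ∫⁻ x, ∫⁻ w, ‖ρ w • (f (x - w) - f x)‖ₑ := by
        refine lintegral_mono_ae ?_
        filter_upwards [hconv] with x hx
        have h1 : mollify ρ f x - f x = ∫ w, ρ w • (f (x - w) - f x) := by
          simp_rw [smul_sub]
          rw [integral_sub hx (hρi.smul_const _), integral_smul_const, hρ1, one_smul, mollify]
        rw [h1]
        exact enorm_integral_le_lintegral_enorm _
    _ = ∫⁻ w, ∫⁻ x, ‖ρ w • (f (x - w) - f x)‖ₑ := lintegral_lintegral_swap hmeas
    _ ≤ ∫⁻ w, ‖ρ w‖ₑ * η := by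
        refine lintegral_mono fun w => ?_
        simp_rw [enorm_smul]
        rw [lintegral_const_mul' _ _ (by simp), ← eLpNorm_one_eq_lintegral_enorm]
        by_cases h0 : ρ w = 0
        · simp [h0]
        · gcongr
          exact hη w h0
    _ = η := by rw [lintegral_mul_const _ hρ.measurable.enorm, hρl, one_mul]

theorem tendsto_eLpNorm_mollify {ρ : ℕ → Vec n → ℝ} (hρ : ∀ k, Continuous (ρ k))
    (hρc : ∀ k, HasCompactSupport (ρ k)) (hρ0 : ∀ k w, 0 ≤ ρ k w) (hρ1 : ∀ k, ∫ w, ρ k w = 1)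
    {d : ℕ → ℝ} (hd : Tendsto d atTop (𝓝 0)) (hρd : ∀ k w, ρ k w ≠ 0 → ‖w‖ ≤ d k)
    {f : Vec n → G} (hf : MemLp f 1 volume) :
    Tendsto (fun k => eLpNorm (mollify (ρ k) f - f) 1 volume) atTop (𝓝 0) := by
  rw [ENNReal.tendsto_nhds_zero]
  intro η hη
  have h1 := (ENNReal.tendsto_nhds_zero.1 (tendsto_eLpNorm_translate hf)) η hη
  obtain ⟨δ, hδ, hball⟩ := Metric.eventually_nhds_iff_ball.1 h1
  filter_upwards [hd.eventually (gt_mem_nhds hδ)] with k hk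
  refine eLpNorm_mollify_sub_le (hρ k) (hρc k) (hρ0 k) (hρ1 k) hf fun w hw => hball w ?_
  rw [mem_ball_zero_iff]
  exact (hρd k w hw).trans_lt hk

theorem contDiff_mollify {ρ : Vec n → ℝ} (hρ : ContDiff ℝ ∞ ρ) (hρc : HasCompactSupport ρ)
    {f : Vec n → G} (hf : MemLp f 1 volume) : ContDiff ℝ ∞ (mollify ρ f) :=
  hρc.contDiff_convolution_left (ContinuousLinearMap.lsmul ℝ ℝ) hρ (hf.locallyIntegrable le_rfl)

theorem pderiv_mollify {ρ : Vec n → ℝ} (hρ : ContDiff ℝ ∞ ρ) (hρc : HasCompactSupport ρ)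
    {f : Vec n → G} (hf : MemLp f 1 volume) (j : Fin n) (x : Vec n) :
    pderiv j (mollify ρ f) x = mollify (pderiv j ρ) f x := by
  have hρ1 : ContDiff ℝ 1 ρ := hρ.of_le (by norm_cast)
  have h1 := hρc.hasFDerivAt_convolution_left (ContinuousLinearMap.lsmul ℝ ℝ) hρ1
    (hf.locallyIntegrable le_rfl) x
  rw [pderiv, mollify_eq_convolution, h1.fderiv, convolution_def,
    ContinuousLinearMap.integral_apply]
  · rfl
  · exact (hρc.fderiv ℝ).convolutionExists_left _ (hρ1.continuous_fderiv one_ne_zero)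
      (hf.locallyIntegrable le_rfl) x

theorem mollify_eq_integral (ρ : Vec n → ℝ) (f : Vec n → G) (x : Vec n) :
    mollify ρ f x = ∫ w, ρ (x - w) • f w := by
  rw [mollify, ← integral_sub_left_eq_self (fun w => ρ (x - w) • f w) volume x]
  simp

end Mollify

/-! ### Density of smooth functions -/

section Density

variable {n m : ℕ} {Ω : Set (Vec n)}

/-- If `x - w` stays in `Ω` on the support of `ρ`, the reflected kernel is a test function for the
weak derivative, so the jump of the zero extension across the boundary is not seen. -/
theorem pderiv_mollify_eq {p : ℝ≥0∞} {y : Vec n → Vec m} {z : Vec n → Jac n m}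
    (hy : IsSobolev Ω p y z) (hΩ : MeasurableSet Ω)
    (hy1 : MemLp y 1 (volume.restrict Ω)) {ρ : Vec n → ℝ}
    (hρ : ContDiff ℝ ∞ ρ) (hρc : HasCompactSupport ρ) {x : Vec n}
    (hx : ∀ w ∈ tsupport ρ, x - w ∈ Ω) (j : Fin n) :
    pderiv j (mollify ρ (Ω.indicator y)) x = mollify ρ (Ω.indicator fun x => z x j) x := by
  have hyL : MemLp (Ω.indicator y) 1 volume := (memLp_indicator_iff_restrict hΩ).2 hy1
  rw [pderiv_mollify hρ hρc hyL, mollify_eq_integral, mollify_eq_integral]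
  set ψ : Vec n → ℝ := fun w => ρ (x - w) with hψ
  have hψs : ContDiff ℝ ∞ ψ := by fun_prop
  have hψc : HasCompactSupport ψ :=
    hρc.comp_isClosedEmbedding (Homeomorph.subLeft x).isClosedEmbedding
  have hψt : tsupport ψ ⊆ Ω := by
    intro w hw
    have h1 : w ∈ (Homeomorph.subLeft x) ⁻¹' tsupport ρ := by
      rw [← tsupport_comp_eq_preimage]; exact hw
    have := hx _ h1
    simpa using this
  have hd : ∀ w, pderiv j ψ w = -pderiv j ρ (x - w) := fun w => by
    have h1 : HasFDerivAt (fun w : Vec n => x - w) (-ContinuousLinearMap.id ℝ (Vec n)) w :=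
      (hasFDerivAt_id w).const_sub x
    have h2 := (hρ.differentiable (by simp) (x - w)).hasFDerivAt.comp w h1
    rw [pderiv, show fderiv ℝ ψ w = _ from h2.fderiv]
    simp [pderiv]
  have h := hy.weakDeriv ψ hψs hψc hψt j
  simp_rw [hd, neg_smul] at h
  rw [integral_neg, neg_inj] at h
  have key : ∀ (a : Vec n → ℝ) (f : Vec n → Vec m),
      ∫ w, a w • Ω.indicator f w = ∫ w in Ω, a w • f w := fun a f => by
    rw [← integral_indicator hΩ]
    congr 1
    ext1 w
    by_cases hw : w ∈ Ω <;> simp [hw]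
  rw [key, key]
  exact h

/-- The kernels are centred at `-(t k • e)` with radius `c * t k / 2`. Then `x - w` ranges over a
ball around `x + t k • e` inside the interior cone, so mollification only samples `Ω`, even for `x`
close to the boundary. -/
theorem IsLocalDomain.exists_kernels {x₀ : Vec n} {r : ℝ} {e : Vec n} {c : ℝ}
    (h : IsLocalDomain Ω x₀ r e c) : ∃ (ρ : ℕ → Vec n → ℝ) (d : ℕ → ℝ),
      (∀ k, ContDiff ℝ ∞ (ρ k)) ∧ (∀ k, HasCompactSupport (ρ k)) ∧ (∀ k w, 0 ≤ ρ k w) ∧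
      (∀ k, ∫ w, ρ k w = 1) ∧ Tendsto d atTop (𝓝 0) ∧ (∀ k w, ρ k w ≠ 0 → ‖w‖ ≤ d k) ∧
      ∀ k, ∀ x ∈ Ω ∩ Metric.ball x₀ r, ∀ w ∈ tsupport (ρ k), x - w ∈ Ω := by
  have hr := h.r_pos
  have hc := h.c_pos
  set t : ℕ → ℝ := fun k => (r / 2) * (1 / ((k : ℝ) + 1)) with ht
  have ht0 : ∀ k, 0 < t k := fun k => by positivity
  have htr : ∀ k, t k < r := fun k => by
    have : 1 / ((k : ℝ) + 1) ≤ 1 := by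
      rw [div_le_one (by positivity)]; linarith [(Nat.cast_nonneg k : (0 : ℝ) ≤ k)]
    simp only [ht]
    nlinarith
  let b : ∀ k, ContDiffBump (-(t k • e)) := fun k =>
    ⟨c * t k / 4, c * t k / 2, by have := ht0 k; positivity, by
      have := mul_pos hc (ht0 k); linarith⟩
  have hts : ∀ k, tsupport ((b k).normed volume) = Metric.closedBall (-(t k • e)) (c * t k / 2) :=
    fun k => (b k).tsupport_normed_eq
  refine ⟨fun k => (b k).normed volume, fun k => t k * (‖e‖ + c / 2),
    fun k => (b k).contDiff_normed, fun k => (b k).hasCompactSupport_normed,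
    fun k w => (b k).nonneg_normed w, fun k => (b k).integral_normed, ?_, ?_, ?_⟩
  · have h1 : Tendsto t atTop (𝓝 0) := by
      have := (tendsto_one_div_add_atTop_nhds_zero_nat (𝕜 := ℝ)).const_mul (r / 2)
      rwa [mul_zero] at this
    simpa using h1.mul_const (‖e‖ + c / 2)
  · intro k w hw
    have h1 : w ∈ tsupport ((b k).normed volume) := subset_tsupport _ hw
    rw [hts, Metric.mem_closedBall, dist_eq_norm, sub_neg_eq_add] at h1
    have h2 : ‖w‖ ≤ ‖w + t k • e‖ + ‖t k • e‖ := by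
      simpa using norm_sub_le (w + t k • e) (t k • e)
    rw [norm_smul, Real.norm_of_nonneg (ht0 k).le] at h2
    linarith
  · intro k x hx w hw
    rw [hts, Metric.mem_closedBall, dist_eq_norm, sub_neg_eq_add] at hw
    refine h.cone x hx (t k) ⟨ht0 k, htr k⟩ ?_
    rw [Metric.mem_ball, dist_eq_norm]
    have : x - w - (x + t k • e) = -(w + t k • e) := by module
    rw [this, norm_neg]
    have := mul_pos hc (ht0 k)
    linarith

theorem pderiv_smul {χ : Vec n → ℝ} {f : Vec n → Vec m} {x : Vec n} (hχ : DifferentiableAt ℝ χ x)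
    (hf : DifferentiableAt ℝ f x) (j : Fin n) :
    pderiv j (fun x => χ x • f x) x = pderiv j χ x • f x + χ x • pderiv j f x := by
  rw [pderiv, fderiv_fun_smul hχ hf, pderiv, pderiv]
  simp [add_comm]

theorem pderiv_sum {ι : Type*} [Fintype ι] {G : Type*} [NormedAddCommGroup G] [NormedSpace ℝ G]
    {f : ι → Vec n → G} {x : Vec n}
    (hf : ∀ i, DifferentiableAt ℝ (f i) x) (j : Fin n) :
    pderiv j (fun x => ∑ i, f i x) x = ∑ i, pderiv j (f i) x := by
  rw [pderiv, fderiv_fun_sum fun i _ => hf i]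
  simp [pderiv]

theorem continuous_pderiv {G : Type*} [NormedAddCommGroup G] [NormedSpace ℝ G]
    {f : Vec n → G} (hf : ContDiff ℝ 1 f) (j : Fin n) : Continuous (pderiv j f) :=
  (hf.continuous_fderiv one_ne_zero).clm_apply continuous_const

theorem eLpNorm_smul_le_of_bound {α G : Type*} [MeasurableSpace α] [NormedAddCommGroup G]
    [NormedSpace ℝ G] {μ : Measure α} {a : α → ℝ} {C : ℝ} (ha : ∀ᵐ x ∂μ, |a x| ≤ C)
    (f : α → G) : eLpNorm (fun x => a x • f x) 1 μ ≤ ENNReal.ofReal C * eLpNorm f 1 μ := by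
  refine (eLpNorm_le_mul_eLpNorm_of_ae_le_mul (g := f) ?_ 1)
  filter_upwards [ha] with x hx
  rw [norm_smul]
  gcongr
  exact hx

/-- Functions that are smooth up to the boundary are dense in `W^{1,1}` of a Lipschitz domain. -/
theorem IsLipschitzDomain.exists_smooth_approx (hΩ : IsLipschitzDomain Ω) {y : Vec n → Vec m}
    {z : Vec n → Jac n m} (hy : IsSobolev Ω 1 y z) :
    ∃ u : ℕ → Vec n → Vec m, (∀ k, ContDiff ℝ ∞ (u k)) ∧
      Tendsto (fun k => eLpNorm (u k - y) 1 (volume.restrict Ω)) atTop (𝓝 0) ∧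
      (∀ j, Tendsto (fun k => eLpNorm (fun x => pderiv j (u k) x - z x j) 1 (volume.restrict Ω))
        atTop (𝓝 0)) := by
  obtain ⟨ι, _, x₀, r, e, c, χ, A⟩ := hΩ.exists_isAtlas
  choose ρ d hρs hρc hρ0 hρ1 hd hρd hρΩ using fun i => (A.isLocalDomain i).exists_kernels
  have hΩm := hΩ.isOpen.measurableSet
  set yt := Ω.indicator y with hyt
  set zt : Fin n → Vec n → Vec m := fun j => Ω.indicator fun x => z x j with hzt
  have hyL : MemLp yt 1 volume := (memLp_indicator_iff_restrict hΩm).2 hy.memLp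
  have hzL : ∀ j, MemLp (zt j) 1 volume := fun j =>
    (memLp_indicator_iff_restrict hΩm).2 (hy.memLp_deriv j)
  have hae : ∀ᵐ x ∂volume.restrict Ω, x ∈ Ω := ae_restrict_mem hΩm
  have hmol : ∀ (f : Vec n → Vec m), MemLp f 1 volume → ∀ i,
      Tendsto (fun k => eLpNorm (mollify (ρ i k) f - f) 1 (volume.restrict Ω)) atTop (𝓝 0) :=
    fun f hf i => tendsto_of_tendsto_of_tendsto_of_le_of_le tendsto_const_nhds
      (tendsto_eLpNorm_mollify (fun k => (hρs i k).continuous) (hρc i) (hρ0 i) (hρ1 i) (hd i)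
        (hρd i) hf) (fun k => zero_le) (fun k => eLpNorm_restrict_le _ _ _ _)
  have hmsm : ∀ i k, ContDiff ℝ ∞ (mollify (ρ i k) yt) := fun i k =>
    contDiff_mollify (hρs i k) (hρc i k) hyL
  have hmc : ∀ i k, Continuous (mollify (ρ i k) yt) := fun i k => (hmsm i k).continuous
  have hmcz : ∀ i k j, Continuous (mollify (ρ i k) (zt j)) := fun i k j =>
    (contDiff_mollify (hρs i k) (hρc i k) (hzL j)).continuous
  have hχ1 : ∀ i, ∀ᵐ x ∂volume.restrict Ω, |χ i x| ≤ 1 := fun i => by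
    filter_upwards [hae] with x hx
    rw [abs_of_nonneg (A.nonneg i x), ← A.sum_eq_one x (subset_closure hx)]
    exact Finset.single_le_sum (fun i _ => A.nonneg i x) (Finset.mem_univ i)
  have hχd : ∀ i, Differentiable ℝ (χ i) := fun i => (A.smooth i).differentiable (by simp)
  have hpχ : ∀ i j, Continuous (pderiv j (χ i)) := fun i j =>
    continuous_pderiv ((A.smooth i).of_le (by norm_cast)) j
  have hC : ∀ i j, ∃ C : ℝ, ∀ᵐ x ∂volume.restrict Ω, |pderiv j (χ i) x| ≤ C := fun i j => by
    obtain ⟨C, hC⟩ := hΩ.isBounded.isCompact_closure.exists_bound_of_continuousOn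
      (hpχ i j).continuousOn
    exact ⟨C, by filter_upwards [hae] with x hx using hC x (subset_closure hx)⟩
  choose C hC using hC
  refine ⟨fun k x => ∑ i, χ i x • mollify (ρ i k) yt x, fun k =>
    ContDiff.sum fun i _ => (A.smooth i).smul (hmsm i k), ?_, fun j => ?_⟩
  · have hb : ∀ k, eLpNorm ((fun x => ∑ i, χ i x • mollify (ρ i k) yt x) - y) 1 (volume.restrict Ω)
        ≤ ∑ i, ENNReal.ofReal 1 * eLpNorm (mollify (ρ i k) yt - yt) 1 (volume.restrict Ω) := by
      intro k
      have h1 : eLpNorm ((fun x => ∑ i, χ i x • mollify (ρ i k) yt x) - y) 1 (volume.restrict Ω)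
          = eLpNorm (∑ i, fun x => χ i x • (mollify (ρ i k) yt - yt) x) 1 (volume.restrict Ω) := by
        refine eLpNorm_congr_ae ?_
        filter_upwards [hae] with x hx
        simp only [Pi.sub_apply, Finset.sum_apply, smul_sub, Finset.sum_sub_distrib]
        rw [← Finset.sum_smul, A.sum_eq_one x (subset_closure hx), one_smul, hyt,
          indicator_of_mem hx]
      rw [h1]
      refine (eLpNorm_sum_le (fun i _ => ?_) le_rfl).trans (Finset.sum_le_sum fun i _ =>
        eLpNorm_smul_le_of_bound (hχ1 i) _)
      exact ((A.smooth i).continuous.aestronglyMeasurable).smul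
        ((hmc i k).aestronglyMeasurable.sub hyL.1.restrict)
    refine tendsto_of_tendsto_of_tendsto_of_le_of_le tendsto_const_nhds ?_ (fun k => zero_le) hb
    rw [show (0 : ℝ≥0∞) = ∑ i : ι, ENNReal.ofReal 1 * 0 by simp]
    exact tendsto_finsetSum _ fun i _ => ENNReal.Tendsto.const_mul (hmol _ hyL i)
      (Or.inr ENNReal.ofReal_ne_top)
  · have hb : ∀ k, eLpNorm (fun x => pderiv j (fun x => ∑ i, χ i x • mollify (ρ i k) yt x) x - z x j)
          1 (volume.restrict Ω)
        ≤ ∑ i, (ENNReal.ofReal (C i j) * eLpNorm (mollify (ρ i k) yt - yt) 1 (volume.restrict Ω)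
          + ENNReal.ofReal 1 * eLpNorm (mollify (ρ i k) (zt j) - zt j) 1 (volume.restrict Ω)) := by
      intro k
      have h1 : eLpNorm (fun x => pderiv j (fun x => ∑ i, χ i x • mollify (ρ i k) yt x) x - z x j)
          1 (volume.restrict Ω)
          = eLpNorm (∑ i, ((fun x => pderiv j (χ i) x • (mollify (ρ i k) yt - yt) x)
            + fun x => χ i x • (mollify (ρ i k) (zt j) - zt j) x)) 1 (volume.restrict Ω) := by
        refine eLpNorm_congr_ae ?_
        filter_upwards [hae] with x hx
        -- Because the derivatives of the partition of unity sum to zero, `y` may be subtracted in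
        -- the terms where they occur, and those terms tend to zero.
        have h0 : ∑ i, pderiv j (χ i) x = 0 := by
          rw [← pderiv_sum (fun i => hχd i x), pderiv]
          have : (fun x => ∑ i, χ i x) =ᶠ[𝓝 x] fun _ => 1 := by
            filter_upwards [hΩ.isOpen.mem_nhds hx] with w hw
              using A.sum_eq_one w (subset_closure hw)
          rw [this.fderiv_eq]
          simp
        have hterm : ∀ i, pderiv j (fun x => χ i x • mollify (ρ i k) yt x) x
            = pderiv j (χ i) x • mollify (ρ i k) yt x + χ i x • mollify (ρ i k) (zt j) x := by
          intro i
          rw [pderiv_smul (hχd i x) ((hmsm i k).differentiable (by simp) x)]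
          -- Off the ball of index `i` the kernel may leave `Ω`, but there `χ i` vanishes.
          by_cases hxi : χ i x = 0
          · rw [hxi, zero_smul, zero_smul]
          · rw [pderiv_mollify_eq hy hΩm hy.memLp (hρs i k) (hρc i k)
              (hρΩ i k x ⟨hx, A.subordinate i (subset_tsupport _ hxi)⟩)]
        rw [pderiv_sum (f := fun i x => χ i x • mollify (ρ i k) yt x)
          (fun i => (hχd i x).smul ((hmsm i k).differentiable (by simp) x))]
        simp only [hterm, Finset.sum_apply, Pi.add_apply, Pi.sub_apply, smul_sub,
          Finset.sum_add_distrib, Finset.sum_sub_distrib]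
        rw [← Finset.sum_smul, ← Finset.sum_smul, h0, A.sum_eq_one x (subset_closure hx), one_smul,
          zero_smul, sub_zero]
        simp only [hzt, indicator_of_mem hx]
        abel
      rw [h1]
      have hm1 : ∀ i, AEStronglyMeasurable (fun x => pderiv j (χ i) x • (mollify (ρ i k) yt - yt) x)
          (volume.restrict Ω) := fun i =>
        (hpχ i j).aestronglyMeasurable.smul ((hmc i k).aestronglyMeasurable.sub hyL.1.restrict)
      have hm2 : ∀ i, AEStronglyMeasurable (fun x => χ i x • (mollify (ρ i k) (zt j) - zt j) x)
          (volume.restrict Ω) := fun i =>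
        (A.smooth i).continuous.aestronglyMeasurable.smul
          ((hmcz i k j).aestronglyMeasurable.sub (hzL j).1.restrict)
      refine (eLpNorm_sum_le (fun i _ => (hm1 i).add (hm2 i)) le_rfl).trans
        (Finset.sum_le_sum fun i _ => ?_)
      exact (eLpNorm_add_le (hm1 i) (hm2 i) le_rfl).trans
        (add_le_add (eLpNorm_smul_le_of_bound (hC i j) _) (eLpNorm_smul_le_of_bound (hχ1 i) _))
    refine tendsto_of_tendsto_of_tendsto_of_le_of_le tendsto_const_nhds ?_ (fun k => zero_le) hb
    rw [show (0 : ℝ≥0∞) = ∑ i : ι, (ENNReal.ofReal (C i j) * 0 + ENNReal.ofReal 1 * 0) by simp]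
    exact tendsto_finsetSum _ fun i _ => (ENNReal.Tendsto.const_mul (hmol _ hyL i)
      (Or.inr ENNReal.ofReal_ne_top)).add (ENNReal.Tendsto.const_mul (hmol _ (hzL j) i)
      (Or.inr ENNReal.ofReal_ne_top))

end Density

/-! ### Traces -/

section Trace

variable {n m : ℕ} {Ω : Set (Vec n)}

theorem IsLipschitzDomain.isFiniteMeasure_vol (hΩ : IsLipschitzDomain Ω) :
    IsFiniteMeasure (volume.restrict Ω) :=
  ⟨by rw [Measure.restrict_apply_univ]; exact hΩ.isBounded.measure_lt_top⟩

theorem IsLipschitzDomain.integral_pderiv (hΩ : IsLipschitzDomain Ω) {φ : Vec n → ℝ}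
    (hφ : ContDiff ℝ 1 φ) (j : Fin n) :
    ∫ x in Ω, pderiv j φ x = ∫ x, φ x * outerNormal Ω x j ∂surf Ω := by
  have := hΩ.divergence hφ (EuclideanSpace.single j 1)
  simpa [pderiv, EuclideanSpace.inner_single_right] using this

theorem IsLipschitzDomain.integrable_mul_normal_apply (hΩ : IsLipschitzDomain Ω) {f : Vec n → ℝ}
    (hf : Integrable f (surf Ω)) (j : Fin n) :
    Integrable (fun x => f x * outerNormal Ω x j) (surf Ω) := by
  simpa [EuclideanSpace.inner_single_right] using
    hΩ.integrable_mul_normal hf (EuclideanSpace.single j 1)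

theorem pderiv_mul {f g : Vec n → ℝ} {x : Vec n} (hf : DifferentiableAt ℝ f x)
    (hg : DifferentiableAt ℝ g x) (j : Fin n) :
    pderiv j (fun x => f x * g x) x = pderiv j f x * g x + f x * pderiv j g x := by
  rw [pderiv, fderiv_fun_mul hf hg, pderiv, pderiv]
  simp; ring

theorem contDiff_coord {X : Vec n → Vec n} {k : WithTop ℕ∞} (hX : ContDiff ℝ k X) (j : Fin n) :
    ContDiff ℝ k fun x => X x j := by fun_prop

theorem IsLipschitzDomain.vector_divergence (hΩ : IsLipschitzDomain Ω) {φ : Vec n → ℝ}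
    {X : Vec n → Vec n} (hφ : ContDiff ℝ 1 φ) (hX : ContDiff ℝ 1 X) :
    ∫ x in Ω, ∑ j, (pderiv j φ x * X x j + φ x * pderiv j (fun x => X x j) x)
      = ∫ x, φ x * inner ℝ (outerNormal Ω x) (X x) ∂surf Ω := by
  have hXj := contDiff_coord hX
  have h1 : ∀ j x, pderiv j φ x * X x j + φ x * pderiv j (fun x => X x j) x
      = pderiv j (fun x => φ x * X x j) x := fun j x =>
    (pderiv_mul (hφ.differentiable one_ne_zero x) ((hXj j).differentiable one_ne_zero x) j).symm
  simp_rw [h1]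
  rw [integral_finsetSum _ fun j _ => hΩ.integrable_vol (continuous_pderiv (hφ.mul (hXj j)) j)]
  simp_rw [fun j => hΩ.integral_pderiv (hφ.mul (hXj j)) j]
  rw [← integral_finsetSum _ fun j _ => hΩ.integrable_mul_normal_apply
    (hΩ.integrable_surf (hφ.mul (hXj j)).continuous) j]
  refine integral_congr_ae (ae_of_all _ fun x => ?_)
  simp only [PiLp.inner_apply, RCLike.inner_apply, conj_trivial, Finset.mul_sum]
  exact Finset.sum_congr rfl fun j _ => by ring

/-- By Cauchy–Schwarz and `‖u‖ ≤ √(‖u‖² + ε²)`. This regularization makes the norm of `u`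
differentiable at the zeros of `u`, without increasing the gradient bound. -/
theorem abs_pderiv_sqrt_le {u : Vec n → Vec m} (hu : ContDiff ℝ 1 u) {ε : ℝ} (hε : 0 < ε)
    (j : Fin n) (x : Vec n) :
    |pderiv j (fun x => √(‖u x‖ ^ 2 + ε ^ 2)) x| ≤ ‖pderiv j u x‖ := by
  have hd := (hu.differentiable one_ne_zero x).hasFDerivAt
  have h1 := (hd.norm_sq.add_const (ε ^ 2)).sqrt (by positivity)
  rw [pderiv, h1.fderiv, pderiv]
  have hpos : 0 < √(‖u x‖ ^ 2 + ε ^ 2) := Real.sqrt_pos.2 (by positivity)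
  have hle : ‖u x‖ ≤ √(‖u x‖ ^ 2 + ε ^ 2) := Real.le_sqrt_of_sq_le (by nlinarith)
  set v := fderiv ℝ u x (EuclideanSpace.single j 1) with hv
  have h2 : ((1 / (2 * √(‖u x‖ ^ 2 + ε ^ 2))) • (2 • (innerSL ℝ (u x)).comp (fderiv ℝ u x)))
      (EuclideanSpace.single j 1) = inner ℝ (u x) v / √(‖u x‖ ^ 2 + ε ^ 2) := by
    simp [hv]
    field_simp
  rw [h2, abs_div, abs_of_pos hpos, div_le_iff₀ hpos]
  calc |inner ℝ (u x) v| ≤ ‖u x‖ * ‖v‖ := abs_real_inner_le_norm _ _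
    _ ≤ ‖v‖ * √(‖u x‖ ^ 2 + ε ^ 2) := by rw [mul_comm]; gcongr

/-- The trace inequality. -/
theorem IsLipschitzDomain.exists_trace_bound (hΩ : IsLipschitzDomain Ω) (m : ℕ) :
    ∃ C : ℝ, ∀ u : Vec n → Vec m, ContDiff ℝ 1 u →
      eLpNorm u 1 (surf Ω) ≤ ENNReal.ofReal C * (eLpNorm u 1 (volume.restrict Ω)
        + ∑ j, eLpNorm (pderiv j u) 1 (volume.restrict Ω)) := by
  obtain ⟨X, hX, δ, hδ, hXδ⟩ := hΩ.exists_transverse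
  have := hΩ.isFiniteMeasure_vol
  have hX1 : ContDiff ℝ 1 X := hX.of_le (by norm_cast)
  have hXj := contDiff_coord hX1
  have hcpt := hΩ.isBounded.isCompact_closure
  obtain ⟨C₁, hC₁⟩ := hcpt.exists_bound_of_continuousOn hX1.continuous.continuousOn
  choose C₂ hC₂ using fun j => hcpt.exists_bound_of_continuousOn
    (continuous_pderiv (hXj j) j).continuousOn
  have hae : ∀ᵐ x ∂volume.restrict Ω, x ∈ Ω := ae_restrict_mem hΩ.isOpen.measurableSet
  set D : ℝ := |C₁| + ∑ j, |C₂ j| with hD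
  have hD0 : 0 ≤ D := by positivity
  refine ⟨D / δ, fun u hu => ?_⟩
  -- The divergence theorem is applied to `φ X`, where `X` is transverse to the boundary and `φ =
  -- √(‖u‖² + ε²)`. The boundary integrand dominates `δ ‖u‖`, and the divergence is controlled by
  -- `u` and its first derivatives.
  have key : ∀ ε > 0, δ * ∫ x, ‖u x‖ ∂surf Ω ≤ D * ((∫ x in Ω, (‖u x‖ + ε))
      + ∑ j, ∫ x in Ω, ‖pderiv j u x‖) := by
    intro ε hε
    set φ : Vec n → ℝ := fun x => √(‖u x‖ ^ 2 + ε ^ 2) with hφdef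
    have hφ : ContDiff ℝ 1 φ := by
      refine ContDiff.sqrt ((hu.norm_sq ℝ).add contDiff_const) fun x => ?_
      positivity
    have hle : ∀ x, ‖u x‖ ≤ φ x := fun x => Real.le_sqrt_of_sq_le (by nlinarith)
    have hφle : ∀ x, φ x ≤ ‖u x‖ + ε := fun x => by
      refine Real.sqrt_le_iff.2 ⟨by positivity, ?_⟩
      nlinarith [norm_nonneg (u x)]
    have hφ0 : ∀ x, 0 ≤ φ x := fun x => Real.sqrt_nonneg _
    calc δ * ∫ x, ‖u x‖ ∂surf Ω = ∫ x, ‖u x‖ * δ ∂surf Ω := by rw [integral_mul_const, mul_comm]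
      _ ≤ ∫ x, φ x * inner ℝ (outerNormal Ω x) (X x) ∂surf Ω := by
          refine integral_mono_ae ((hΩ.integrable_surf hu.continuous).norm.mul_const _) ?_ ?_
          · have : ∀ x, φ x * inner ℝ (outerNormal Ω x) (X x)
                = ∑ j, (φ x * X x j) * outerNormal Ω x j := fun x => by
              simp only [PiLp.inner_apply, RCLike.inner_apply, conj_trivial, Finset.mul_sum]
              exact Finset.sum_congr rfl fun j _ => by ring
            simp_rw [this]
            exact integrable_finsetSum _ fun j _ => hΩ.integrable_mul_normal_apply
              (hΩ.integrable_surf (hφ.mul (hXj j)).continuous) j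
          · filter_upwards [hXδ] with x hx
            exact mul_le_mul (hle x) hx hδ.le (hφ0 x)
      _ = ∫ x in Ω, ∑ j, (pderiv j φ x * X x j + φ x * pderiv j (fun x => X x j) x) :=
          (hΩ.vector_divergence hφ hX1).symm
      _ ≤ ∫ x in Ω, D * ((‖u x‖ + ε) + ∑ j, ‖pderiv j u x‖) := by
          refine integral_mono_ae ?_ ?_ ?_
          · refine integrable_finsetSum _ fun j _ => hΩ.integrable_vol ?_
            exact ((continuous_pderiv hφ j).mul (hXj j).continuous).add
              (hφ.continuous.mul (continuous_pderiv (hXj j) j))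
          · refine hΩ.integrable_vol ?_
            have := fun j => continuous_pderiv hu j
            have := hu.continuous
            fun_prop
          · filter_upwards [hae] with x hx
            have hxc := subset_closure hx
            rw [Finset.sum_add_distrib]
            have h1 : ∑ j, pderiv j φ x * X x j ≤ D * ∑ j, ‖pderiv j u x‖ := by
              rw [Finset.mul_sum]
              refine Finset.sum_le_sum fun j _ => ?_
              refine (le_abs_self _).trans ?_
              rw [abs_mul, mul_comm]
              refine mul_le_mul ?_ (abs_pderiv_sqrt_le hu hε j x) (abs_nonneg _) hD0
              have h2 : |X x j| ≤ ‖X x‖ := PiLp.norm_apply_le (X x) j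
              have h3 := hC₁ x hxc
              have h4 : 0 ≤ ∑ j, |C₂ j| := by positivity
              have h5 := le_abs_self C₁
              linarith
            have h2 : ∑ j, φ x * pderiv j (fun x => X x j) x ≤ D * (‖u x‖ + ε) := by
              rw [← Finset.mul_sum, mul_comm]
              refine mul_le_mul ?_ (hφle x) (hφ0 x) hD0
              have h3 : ∑ j, pderiv j (fun x => X x j) x ≤ ∑ j, |C₂ j| :=
                Finset.sum_le_sum fun j _ => (le_abs_self _).trans
                  ((hC₂ j x hxc).trans (le_abs_self _))
              have h5 := abs_nonneg C₁
              linarith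
            rw [mul_add]
            linarith
      _ = D * ((∫ x in Ω, (‖u x‖ + ε)) + ∑ j, ∫ x in Ω, ‖pderiv j u x‖) := by
          rw [integral_const_mul, integral_add, integral_finsetSum]
          · exact fun j _ => (hΩ.integrable_vol (continuous_pderiv hu j)).norm
          · exact hΩ.integrable_vol (hu.continuous.norm.add continuous_const)
          · exact integrable_finsetSum _ fun j _ =>
              (hΩ.integrable_vol (continuous_pderiv hu j)).norm
  have key0 : δ * ∫ x, ‖u x‖ ∂surf Ω ≤ D * ((∫ x in Ω, ‖u x‖)
      + ∑ j, ∫ x in Ω, ‖pderiv j u x‖) := by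
    set V := (volume.restrict Ω).real univ with hV
    have hlim : Tendsto (fun ε : ℝ => D * ((∫ x in Ω, ‖u x‖) + ε * V
        + ∑ j, ∫ x in Ω, ‖pderiv j u x‖)) (𝓝[>] 0) (𝓝 (D * ((∫ x in Ω, ‖u x‖) + 0 * V
        + ∑ j, ∫ x in Ω, ‖pderiv j u x‖))) := by
      refine Tendsto.mono_left (Continuous.tendsto ?_ 0) nhdsWithin_le_nhds
      fun_prop
    rw [zero_mul, add_zero] at hlim
    refine ge_of_tendsto hlim ?_
    filter_upwards [self_mem_nhdsWithin] with ε hε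
    refine (key ε hε).trans_eq ?_
    rw [integral_add (hΩ.integrable_vol hu.continuous).norm (integrable_const _), integral_const,
      smul_eq_mul, mul_comm ε]
  simp_rw [eLpNorm_one_eq_lintegral_enorm]
  rw [← ofReal_integral_norm_eq_lintegral_enorm (hΩ.integrable_surf hu.continuous),
    ← ofReal_integral_norm_eq_lintegral_enorm (hΩ.integrable_vol hu.continuous)]
  simp_rw [fun j => (ofReal_integral_norm_eq_lintegral_enorm
    (hΩ.integrable_vol (continuous_pderiv hu j))).symm]
  rw [← ENNReal.ofReal_sum_of_nonneg fun j _ => by positivity, ← ENNReal.ofReal_add (by positivity)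
    (by positivity), ← ENNReal.ofReal_mul (by positivity)]
  refine ENNReal.ofReal_le_ofReal ?_
  rw [div_mul_eq_mul_div, le_div_iff₀ hδ, mul_comm]
  exact key0

theorem IsSobolev.mono {p q : ℝ≥0∞} {y : Vec n → Vec m} {z : Vec n → Jac n m}
    (hΩ : IsLipschitzDomain Ω) (hpq : q ≤ p) (h : IsSobolev Ω p y z) : IsSobolev Ω q y z :=
  have := hΩ.isFiniteMeasure_vol
  ⟨h.memLp.mono_exponent hpq, fun j => (h.memLp_deriv j).mono_exponent hpq, h.weakDeriv⟩

theorem pderiv_sub {G : Type*} [NormedAddCommGroup G] [NormedSpace ℝ G] {f g : Vec n → G}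
    {x : Vec n} (hf : DifferentiableAt ℝ f x) (hg : DifferentiableAt ℝ g x) (j : Fin n) :
    pderiv j (f - g) x = pderiv j f x - pderiv j g x := by
  rw [pderiv, fderiv_sub hf hg]; rfl

/-- Functions in `W^{1,1}` of a Lipschitz domain have traces. -/
theorem IsLipschitzDomain.exists_isTrace (hΩ : IsLipschitzDomain Ω) {y : Vec n → Vec m}
    {z : Vec n → Jac n m} (hy : IsSobolev Ω 1 y z) : ∃ T, IsTrace Ω y z T := by
  have := hΩ.isFiniteMeasure_surf
  obtain ⟨u, hus, huy, huz⟩ := hΩ.exists_smooth_approx hy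
  obtain ⟨C, hC⟩ := hΩ.exists_trace_bound m
  have hu1 : ∀ k, ContDiff ℝ 1 (u k) := fun k => (hus k).of_le (by norm_cast)
  have huL : ∀ k, MemLp (u k) 1 (surf Ω) := fun k =>
    memLp_one_iff_integrable.2 (hΩ.integrable_surf (hus k).continuous)
  have huΩ : ∀ k, AEStronglyMeasurable (u k) (volume.restrict Ω) := fun k =>
    (hus k).continuous.aestronglyMeasurable
  have hpΩ : ∀ k j, AEStronglyMeasurable (pderiv j (u k)) (volume.restrict Ω) := fun k j =>
    (continuous_pderiv (hu1 k) j).aestronglyMeasurable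
  set a : ℕ → ℝ≥0∞ := fun k => eLpNorm (u k - y) 1 (volume.restrict Ω)
    + ∑ j, eLpNorm (fun x => pderiv j (u k) x - z x j) 1 (volume.restrict Ω) with ha
  have ha0 : Tendsto a atTop (𝓝 0) := by
    rw [show (0 : ℝ≥0∞) = 0 + ∑ j : Fin n, 0 by simp]
    exact huy.add (tendsto_finsetSum _ fun j _ => huz j)
  -- The trace inequality for differences makes the boundary values of the approximations a Cauchy
  -- sequence in `L¹`.
  have hdiff : ∀ k l, eLpNorm (u k - u l) 1 (surf Ω) ≤ ENNReal.ofReal C * (a k + a l) := by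
    intro k l
    refine (hC (u k - u l) ((hu1 k).sub (hu1 l))).trans (mul_le_mul' le_rfl ?_)
    have h1 : eLpNorm (u k - u l) 1 (volume.restrict Ω) ≤ eLpNorm (u k - y) 1 (volume.restrict Ω)
        + eLpNorm (u l - y) 1 (volume.restrict Ω) := by
      have : u k - u l = (u k - y) - (u l - y) := by abel
      rw [this]
      exact eLpNorm_sub_le ((huΩ k).sub hy.memLp.1) ((huΩ l).sub hy.memLp.1) le_rfl
    have h2 : ∀ j, eLpNorm (pderiv j (u k - u l)) 1 (volume.restrict Ω)
        ≤ eLpNorm (fun x => pderiv j (u k) x - z x j) 1 (volume.restrict Ω)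
        + eLpNorm (fun x => pderiv j (u l) x - z x j) 1 (volume.restrict Ω) := by
      intro j
      have : pderiv j (u k - u l) = (fun x => pderiv j (u k) x - z x j)
          - (fun x => pderiv j (u l) x - z x j) := by
        ext1 x
        rw [pderiv_sub ((hu1 k).differentiable one_ne_zero x)
          ((hu1 l).differentiable one_ne_zero x)]
        simp
      rw [this]
      exact eLpNorm_sub_le ((hpΩ k j).sub (hy.memLp_deriv j).1)
        ((hpΩ l j).sub (hy.memLp_deriv j).1) le_rfl
    calc _ ≤ (eLpNorm (u k - y) 1 (volume.restrict Ω) + eLpNorm (u l - y) 1 (volume.restrict Ω))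
          + ∑ j, (eLpNorm (fun x => pderiv j (u k) x - z x j) 1 (volume.restrict Ω)
            + eLpNorm (fun x => pderiv j (u l) x - z x j) 1 (volume.restrict Ω)) :=
          add_le_add h1 (Finset.sum_le_sum fun j _ => h2 j)
      _ = a k + a l := by rw [ha, Finset.sum_add_distrib]; simp only; ring
  have hcau : CauchySeq fun k => (huL k).toLp := by
    rw [EMetric.cauchySeq_iff]
    intro ε hε
    have h1 : Tendsto (fun q : ℕ × ℕ => ENNReal.ofReal C * (a q.1 + a q.2)) (atTop ×ˢ atTop)
        (𝓝 (ENNReal.ofReal C * (0 + 0))) :=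
      ENNReal.Tendsto.const_mul ((ha0.comp tendsto_fst).add (ha0.comp tendsto_snd))
        (Or.inr ENNReal.ofReal_ne_top)
    rw [add_zero, mul_zero] at h1
    have h2 := h1.eventually (gt_mem_nhds hε)
    rw [prod_atTop_atTop_eq, eventually_atTop_prod_self'] at h2
    obtain ⟨N, hN⟩ := h2
    refine ⟨N, fun k hk l hl => ?_⟩
    rw [Lp.edist_toLp_toLp]
    exact (hdiff k l).trans_lt (hN k hk l hl)
  obtain ⟨L, hL⟩ := cauchySeq_tendsto_of_complete hcau
  refine ⟨L, Lp.memLp L, u, hus, huy, huz, ?_⟩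
  rw [tendsto_iff_edist_tendsto_0] at hL
  refine hL.congr fun k => ?_
  conv_lhs => rw [← Lp.toLp_coeFn L (Lp.memLp L)]
  rw [Lp.edist_toLp_toLp]

theorem tendsto_integral_inner {α : Type*} [MeasurableSpace α] {μ : Measure α}
    {f : ℕ → α → Vec m} {g a : α → Vec m} (hf : ∀ k, MemLp (f k) 1 μ) (hg : MemLp g 1 μ)
    (hfg : Tendsto (fun k => eLpNorm (f k - g) 1 μ) atTop (𝓝 0))
    (ha : AEStronglyMeasurable a μ) {C : ℝ} (hC : ∀ᵐ x ∂μ, ‖a x‖ ≤ C) :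
    Tendsto (fun k => ∫ x, inner ℝ (f k x) (a x) ∂μ) atTop (𝓝 (∫ x, inner ℝ (g x) (a x) ∂μ)) := by
  have hint : ∀ h : α → Vec m, MemLp h 1 μ → Integrable (fun x => inner ℝ (h x) (a x)) μ := by
    intro h hh
    refine ((memLp_one_iff_integrable.1 hh).norm.mul_const C).mono' (hh.1.inner ha) ?_
    filter_upwards [hC] with x hx
    refine (norm_inner_le_norm _ _).trans (by gcongr)
  refine tendsto_integral_of_L1' _ (hint g hg).1
    (Eventually.of_forall fun k => hint _ (hf k)) ?_
  have hb : ∀ k, eLpNorm ((fun x => inner ℝ (f k x) (a x)) - fun x => inner ℝ (g x) (a x)) 1 μ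
      ≤ ENNReal.ofReal C * eLpNorm (f k - g) 1 μ := fun k => by
    refine eLpNorm_le_mul_eLpNorm_of_ae_le_mul ?_ 1
    filter_upwards [hC] with x hx
    rw [Pi.sub_apply, ← inner_sub_left, mul_comm]
    refine (norm_inner_le_norm _ _).trans (by gcongr; rfl)
  refine tendsto_of_tendsto_of_tendsto_of_le_of_le tendsto_const_nhds ?_ (fun k => zero_le) hb
  simpa using ENNReal.Tendsto.const_mul hfg (Or.inr ENNReal.ofReal_ne_top) (a := ENNReal.ofReal C)

theorem pderiv_inner {f g : Vec n → Vec m} {x : Vec n} (hf : DifferentiableAt ℝ f x)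
    (hg : DifferentiableAt ℝ g x) (j : Fin n) :
    pderiv j (fun x => (inner ℝ (f x) (g x) : ℝ)) x
      = inner ℝ (f x) (pderiv j g x) + inner ℝ (pderiv j f x) (g x) := by
  rw [pderiv, fderiv_inner_apply ℝ hf hg]; rfl

/-- Integration by parts for Sobolev functions and their traces. -/
theorem IsTrace.integral_eq (hΩ : IsLipschitzDomain Ω) {y : Vec n → Vec m}
    {z : Vec n → Jac n m} {T : Vec n → Vec m} (hy : IsSobolev Ω 1 y z) (hT : IsTrace Ω y z T)
    {φ : Vec n → Vec m} (hφ : ContDiff ℝ ∞ φ) (j : Fin n) :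
    ∫ x in Ω, (inner ℝ (y x) (pderiv j φ x) + inner ℝ (z x j) (φ x))
      = ∫ x, inner ℝ (T x) (φ x) * outerNormal Ω x j ∂surf Ω := by
  have := hΩ.isFiniteMeasure_surf
  have := hΩ.isFiniteMeasure_vol
  obtain ⟨hTL, u, hus, huy, huz, huT⟩ := hT
  have hu1 : ∀ k, ContDiff ℝ 1 (u k) := fun k => (hus k).of_le (by norm_cast)
  have hφ1 : ContDiff ℝ 1 φ := hφ.of_le (by norm_cast)
  have hcpt := hΩ.isBounded.isCompact_closure
  obtain ⟨C₁, hC₁⟩ := hcpt.exists_bound_of_continuousOn hφ1.continuous.continuousOn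
  obtain ⟨C₂, hC₂⟩ := hcpt.exists_bound_of_continuousOn (continuous_pderiv hφ1 j).continuousOn
  have hae : ∀ᵐ x ∂volume.restrict Ω, x ∈ Ω := ae_restrict_mem hΩ.isOpen.measurableSet
  have huL : ∀ k, MemLp (u k) 1 (surf Ω) := fun k =>
    memLp_one_iff_integrable.2 (hΩ.integrable_surf (hus k).continuous)
  have huV : ∀ k, MemLp (u k) 1 (volume.restrict Ω) := fun k =>
    memLp_one_iff_integrable.2 (hΩ.integrable_vol (hus k).continuous)
  have hpV : ∀ k, MemLp (pderiv j (u k)) 1 (volume.restrict Ω) := fun k =>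
    memLp_one_iff_integrable.2 (hΩ.integrable_vol (continuous_pderiv (hu1 k) j))
  have hnm := hΩ.aestronglyMeasurable_normal
  have hnj : AEStronglyMeasurable (fun x => outerNormal Ω x j) (surf Ω) :=
    (by fun_prop : Continuous fun v : Vec n => v j).comp_aestronglyMeasurable hnm
  have l1 := tendsto_integral_inner huV hy.memLp huy
    (continuous_pderiv hφ1 j).aestronglyMeasurable
    (by filter_upwards [hae] with x hx using hC₂ x (subset_closure hx))
  have l2 := tendsto_integral_inner hpV (hy.memLp_deriv j) (huz j)
    hφ1.continuous.aestronglyMeasurable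
    (by filter_upwards [hae] with x hx using hC₁ x (subset_closure hx))
  have l3 := tendsto_integral_inner huL hTL huT
    (a := fun x => outerNormal Ω x j • φ x) (C := C₁)
    (hnj.smul hφ1.continuous.aestronglyMeasurable)
    (by
      filter_upwards [ae_surf_mem_closure] with x hx
      have h1 : ‖outerNormal Ω x j‖ ≤ 1 := (PiLp.norm_apply_le _ j).trans (norm_outerNormal_le x)
      rw [norm_smul]
      nlinarith [hC₁ x hx, norm_nonneg (φ x), norm_nonneg (outerNormal Ω x j)])
  have hint : ∀ f a : Vec n → Vec m, MemLp f 1 (volume.restrict Ω) → Continuous a →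
      Integrable (fun x => (inner ℝ (f x) (a x) : ℝ)) (volume.restrict Ω) := by
    intro f a hf ha
    obtain ⟨C, hC⟩ := hcpt.exists_bound_of_continuousOn ha.continuousOn
    refine ((memLp_one_iff_integrable.1 hf).norm.mul_const C).mono'
      (hf.1.inner ha.aestronglyMeasurable) ?_
    filter_upwards [hae] with x hx
    refine (norm_inner_le_norm _ _).trans ?_
    gcongr
    exact hC x (subset_closure hx)
  have heq : ∀ k, (∫ x in Ω, inner ℝ (u k x) (pderiv j φ x)) + ∫ x in Ω, inner ℝ (pderiv j (u k) x) (φ x)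
      = ∫ x, inner ℝ (u k x) (outerNormal Ω x j • φ x) ∂surf Ω := by
    intro k
    rw [← integral_add (hint _ _ (huV k) (continuous_pderiv hφ1 j))
      (hint _ _ (hpV k) hφ1.continuous)]
    have h1 := hΩ.integral_pderiv ((hu1 k).inner ℝ hφ1) j
    simp_rw [fun x => pderiv_inner ((hu1 k).differentiable one_ne_zero x)
      (hφ1.differentiable one_ne_zero x) j] at h1
    rw [h1]
    congr 1
    ext1 x
    rw [real_inner_smul_right, mul_comm]
  have l4 := tendsto_nhds_unique ((l1.add l2).congr heq) l3
  rw [integral_add (hint _ _ hy.memLp (continuous_pderiv hφ1 j))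
      (hint _ _ (hy.memLp_deriv j) hφ1.continuous), l4]
  congr 1
  ext1 x
  rw [real_inner_smul_right, mul_comm]

/-- A boundary function that satisfies the integration by parts formula is the trace. -/
theorem IsTrace.of_integral_eq (hΩ : IsLipschitzDomain Ω) {y : Vec n → Vec m}
    {z : Vec n → Jac n m} {T : Vec n → Vec m} (hy : IsSobolev Ω 1 y z) (hTL : MemLp T 1 (surf Ω))
    (hT : ∀ φ : Vec n → Vec m, ContDiff ℝ ∞ φ → ∀ j,
      ∫ x in Ω, (inner ℝ (y x) (pderiv j φ x) + inner ℝ (z x j) (φ x))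
        = ∫ x, inner ℝ (T x) (φ x) * outerNormal Ω x j ∂surf Ω) : IsTrace Ω y z T := by
  have := hΩ.isFiniteMeasure_surf
  obtain ⟨T', hT'⟩ := hΩ.exists_isTrace hy
  have hTi := memLp_one_iff_integrable.1 hTL
  have hTi' := memLp_one_iff_integrable.1 hT'.1
  have hci : ∀ S : Vec n → Vec m, Integrable S (surf Ω) → ∀ i, Integrable (fun x => S x i) (surf Ω) :=
    fun S hS i => (EuclideanSpace.proj (𝕜 := ℝ) i).integrable_comp hS
  -- `T` is compared with an existing trace `T'`. Testing with `g` times a basis vector isolates one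
  -- component of `T - T'` times one component of the normal, and at almost every boundary point
  -- some component of the normal is nonzero.
  have hzero : ∀ i j, ∀ᵐ x ∂surf Ω, (T x i - T' x i) * outerNormal Ω x j = 0 := by
    intro i j
    have hI1 := hΩ.integrable_mul_normal_apply (hci T hTi i) j
    have hI2 := hΩ.integrable_mul_normal_apply (hci T' hTi' i) j
    have hI : Integrable (fun x => (T x i - T' x i) * outerNormal Ω x j) (surf Ω) := by
      refine (hI1.sub hI2).congr (ae_of_all _ fun x => ?_)
      simp only [Pi.sub_apply]; ring
    refine ae_eq_zero_of_integral_contDiff_smul_eq_zero hI.locallyIntegrable fun g hg hgc => ?_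
    have hφ : ContDiff ℝ ∞ fun x => g x • (EuclideanSpace.single i 1 : Vec m) :=
      hg.smul contDiff_const
    have h1 := (hT _ hφ j).symm.trans (hT'.integral_eq hΩ hy hφ j)
    have hgb : ∃ C, ∀ x, ‖g x‖ ≤ C := hgc.exists_bound_of_continuous hg.continuous
    obtain ⟨C, hC⟩ := hgb
    have hs : ∀ (S : Vec n → Vec m) (x : Vec n),
        inner ℝ (S x) (g x • (EuclideanSpace.single i 1 : Vec m)) * outerNormal Ω x j
          = g x * (S x i * outerNormal Ω x j) := fun S x => by
      rw [real_inner_smul_right, EuclideanSpace.inner_single_right]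
      simp; ring
    simp_rw [hs] at h1
    have h2 : ∀ x, g x • ((T x i - T' x i) * outerNormal Ω x j)
        = g x * (T x i * outerNormal Ω x j) - g x * (T' x i * outerNormal Ω x j) := fun x => by
      rw [smul_eq_mul]; ring
    simp_rw [h2]
    rw [integral_sub (hI1.bdd_mul hg.continuous.aestronglyMeasurable (ae_of_all _ hC))
      (hI2.bdd_mul hg.continuous.aestronglyMeasurable (ae_of_all _ hC)), h1, sub_self]
  have hae : T =ᵐ[surf Ω] T' := by
    filter_upwards [ae_all_iff.2 fun i => ae_all_iff.2 fun j => hzero i j, hΩ.ae_normal]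
      with x hx ⟨ν, hν⟩
    rw [hν.outerNormal_eq] at hx
    have hν0 : ν ≠ 0 := fun h0 => by have := hν.1; simp [h0] at this
    obtain ⟨j, hj⟩ : ∃ j, ν j ≠ 0 := by
      by_contra! h
      exact hν0 (by ext j; simpa using h j)
    ext i
    have := (mul_eq_zero.1 (hx i j)).resolve_right hj
    linarith
  obtain ⟨-, u, hus, huy, huz, huT⟩ := hT'
  refine ⟨hTL, u, hus, huy, huz, huT.congr fun k => eLpNorm_congr_ae ?_⟩
  filter_upwards [hae] with x hx
  rw [Pi.sub_apply, Pi.sub_apply, hx]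

end Trace

/-! ### Chain rule up to the boundary: bounded test functions -/

section ChainRule

variable {n m : ℕ} {Ω : Set (Vec n)} {y : Vec n → Vec m} {z : Vec n → Jac n m} {T : Vec n → Vec m}

theorem pderiv_comp_prodMk {φ : Vec n × Vec m → ℝ} {u : Vec n → Vec m} {x : Vec n}
    (hφ : DifferentiableAt ℝ φ (x, u x)) (hu : DifferentiableAt ℝ u x) (j : Fin n) :
    pderiv j (fun x => φ (x, u x)) x
      = fderiv ℝ φ (x, u x) (EuclideanSpace.single j 1, pderiv j u x) := by
  have h := hφ.hasFDerivAt.comp x ((hasFDerivAt_id x).prodMk hu.hasFDerivAt)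
  have h2 : HasFDerivAt (fun x => φ (x, u x))
      ((fderiv ℝ φ (x, u x)).comp ((ContinuousLinearMap.id ℝ (Vec n)).prod (fderiv ℝ u x))) x := h
  rw [pderiv, h2.fderiv]
  rfl

theorem exists_subseq_ae_tendsto {α G : Type*} [MeasurableSpace α] [NormedAddCommGroup G]
    {μ : Measure α} {f : ℕ → α → G} {g : α → G}
    (hf : ∀ k, AEStronglyMeasurable (f k) μ) (hg : AEStronglyMeasurable g μ)
    (hfg : Tendsto (fun k => eLpNorm (f k - g) 1 μ) atTop (𝓝 0)) :
    ∃ ns : ℕ → ℕ, StrictMono ns ∧ ∀ᵐ x ∂μ, Tendsto (fun k => f (ns k) x) atTop (𝓝 (g x)) :=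
  (tendstoInMeasure_of_tendsto_eLpNorm one_ne_zero hf hg hfg).exists_seq_tendsto_ae

/-- The trace of a Sobolev function is approached, also almost everywhere, by smooth functions. -/
theorem IsTrace.exists_ae_approx (hy : IsSobolev Ω 1 y z) (hT : IsTrace Ω y z T) :
    ∃ u : ℕ → Vec n → Vec m, (∀ k, ContDiff ℝ ∞ (u k)) ∧
    (∀ j, Tendsto (fun k => eLpNorm (fun x => pderiv j (u k) x - z x j) 1 (volume.restrict Ω))
      atTop (𝓝 0)) ∧
    (∀ᵐ x ∂volume.restrict Ω, Tendsto (fun k => u k x) atTop (𝓝 (y x))) ∧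
    ∀ᵐ x ∂surf Ω, Tendsto (fun k => u k x) atTop (𝓝 (T x)) := by
  obtain ⟨hTL, u, hu, huy, huz, huT⟩ := hT
  obtain ⟨a, ha, hay⟩ := exists_subseq_ae_tendsto
    (fun k => (hu k).continuous.aestronglyMeasurable) hy.memLp.1 huy
  obtain ⟨b, hb, hbT⟩ := exists_subseq_ae_tendsto (f := fun k => u (a k))
    (fun k => (hu (a k)).continuous.aestronglyMeasurable) hTL.1 (huT.comp ha.tendsto_atTop)
  refine ⟨fun k => u (a (b k)), fun k => hu _, fun j => ?_, ?_, hbT⟩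
  · exact (huz j).comp (ha.comp hb).tendsto_atTop
  · filter_upwards [hay] with x hx
    exact hx.comp hb.tendsto_atTop

theorem norm_clm_prod_apply_le {φ' : Vec n × Vec m →L[ℝ] ℝ} {C : ℝ} (h : ‖φ'‖ ≤ C) (j : Fin n)
    (v : Vec m) : ‖φ' (EuclideanSpace.single j 1, v)‖ ≤ C * (1 + ‖v‖) := by
  have hC : 0 ≤ C := (norm_nonneg _).trans h
  refine (φ'.le_opNorm _).trans (mul_le_mul h ?_ (norm_nonneg _) hC)
  rw [Prod.norm_def]
  simp only [PiLp.norm_single, norm_one]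
  exact max_le (by linarith [norm_nonneg v]) (by linarith)

/-- The chain rule up to the boundary, for functions with bounded derivative. -/
theorem IsTrace.chain_rule_of_bounded (hΩ : IsLipschitzDomain Ω) (hy : IsSobolev Ω 1 y z)
    (hT : IsTrace Ω y z T) {φ : Vec n × Vec m → ℝ} (hφ : ContDiff ℝ 1 φ) {C : ℝ}
    (hC : ∀ x ∈ closure Ω, ∀ b, |φ (x, b)| ≤ C ∧ ‖fderiv ℝ φ (x, b)‖ ≤ C) (j : Fin n) :
    ∫ x in Ω, fderiv ℝ φ (x, y x) (EuclideanSpace.single j 1, z x j)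
      = ∫ x, φ (x, T x) * outerNormal Ω x j ∂surf Ω := by
  have := hΩ.isFiniteMeasure_vol
  have := hΩ.isFiniteMeasure_surf
  obtain ⟨u, hu, huz, huy, huT⟩ := hT.exists_ae_approx hy
  have hu1 : ∀ k, ContDiff ℝ 1 (u k) := fun k => (hu k).of_le (by norm_cast)
  have hφ' : Continuous (fderiv ℝ φ) := hφ.continuous_fderiv one_ne_zero
  have hΩm := hΩ.isOpen.measurableSet
  have hdu : ∀ k, Continuous (pderiv j (u k)) := fun k => continuous_pderiv (hu1 k) j
  have hzi : Integrable (fun x => z x j) (volume.restrict Ω) :=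
    memLp_one_iff_integrable.1 (hy.memLp_deriv j)
  have hbd : ∀ v : Vec n → Vec m, ∀ᵐ x ∂volume.restrict Ω, ∀ b,
      ‖fderiv ℝ φ (x, v x) (EuclideanSpace.single j 1, b)‖ ≤ C * (1 + ‖b‖) := by
    intro v
    filter_upwards [ae_restrict_mem hΩm] with x hx b
    exact norm_clm_prod_apply_le (hC x (subset_closure hx) _).2 j b
  have e1 : ∀ k, ∫ x in Ω, fderiv ℝ φ (x, u k x) (EuclideanSpace.single j 1, pderiv j (u k) x)
      = ∫ x, φ (x, u k x) * outerNormal Ω x j ∂surf Ω := by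
    intro k
    rw [← hΩ.integral_pderiv (φ := fun x => φ (x, u k x))
      (hφ.comp (contDiff_id.prodMk (hu1 k))) j]
    congr 1
    ext1 x
    rw [pderiv_comp_prodMk (hφ.differentiable one_ne_zero _)
      ((hu1 k).differentiable one_ne_zero _)]
  have hmeas : ∀ k, AEStronglyMeasurable
      (fun x => fderiv ℝ φ (x, u k x) (EuclideanSpace.single j 1, z x j)) (volume.restrict Ω) := by
    intro k
    have h1 : Continuous fun x => fderiv ℝ φ (x, u k x) :=
      hφ'.comp (continuous_id.prodMk (hu k).continuous)
    exact (ContinuousLinearMap.apply ℝ ℝ).flip.aestronglyMeasurable_comp₂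
      h1.aestronglyMeasurable (aestronglyMeasurable_const.prodMk hzi.1)
  have hdom : Integrable (fun x => C * (1 + ‖z x j‖)) (volume.restrict Ω) :=
    ((integrable_const 1).add hzi.norm).const_mul C
  -- The derivative of `u k` is replaced by its limit `z` first. With `z` fixed, boundedness of the
  -- derivative of `φ` gives an integrable majorant. The replacement error is treated in `t2`, where
  -- convergence in `L¹` suffices.
  have t1 : Tendsto (fun k => ∫ x in Ω, fderiv ℝ φ (x, u k x) (EuclideanSpace.single j 1, z x j))
      atTop (𝓝 (∫ x in Ω, fderiv ℝ φ (x, y x) (EuclideanSpace.single j 1, z x j))) := by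
    refine tendsto_integral_of_dominated_convergence _ hmeas hdom (fun k => ?_) ?_
    · filter_upwards [hbd (u k)] with x hx using hx _
    · filter_upwards [huy] with x hx
      have : Continuous fun b => fderiv ℝ φ (x, b) (EuclideanSpace.single j 1, z x j) :=
        (hφ'.comp (by fun_prop)).clm_apply continuous_const
      exact (this.tendsto _).comp hx
  have t2 : Tendsto (fun k => ∫ x in Ω,
      (fderiv ℝ φ (x, u k x) (EuclideanSpace.single j 1, pderiv j (u k) x)
        - fderiv ℝ φ (x, u k x) (EuclideanSpace.single j 1, z x j))) atTop (𝓝 0) := by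
    have h0 := (ENNReal.tendsto_toReal ENNReal.zero_ne_top).comp (huz j)
    have h1 := h0.const_mul C
    rw [ENNReal.toReal_zero, mul_zero] at h1
    refine squeeze_zero_norm (fun k => ?_) h1
    have hL : MemLp (fun x => pderiv j (u k) x - z x j) 1 (volume.restrict Ω) :=
      (memLp_one_iff_integrable.2 (hΩ.integrable_vol (hdu k))).sub (hy.memLp_deriv j)
    have hLi := memLp_one_iff_integrable.1 hL
    have h2 : (eLpNorm (fun x => pderiv j (u k) x - z x j) 1 (volume.restrict Ω)).toReal
        = ∫ x in Ω, ‖pderiv j (u k) x - z x j‖ := by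
      rw [eLpNorm_one_eq_lintegral_enorm, integral_norm_eq_lintegral_enorm hL.1]
    simp only [Function.comp_apply]
    rw [h2, ← integral_const_mul]
    refine norm_integral_le_of_norm_le (hLi.norm.const_mul C) ?_
    filter_upwards [ae_restrict_mem hΩm] with x hx
    rw [← map_sub, Prod.mk_sub_mk, sub_self]
    refine (ContinuousLinearMap.le_opNorm _ _).trans ?_
    rw [Prod.norm_def]
    simp only [norm_zero, norm_nonneg, sup_of_le_right]
    exact mul_le_mul_of_nonneg_right (hC x (subset_closure hx) _).2 (norm_nonneg _)
  have t3 : Tendsto (fun k => ∫ x, φ (x, u k x) * outerNormal Ω x j ∂surf Ω) atTop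
      (𝓝 (∫ x, φ (x, T x) * outerNormal Ω x j ∂surf Ω)) := by
    have hi : ∀ k, Integrable (fun x => φ (x, u k x)) (surf Ω) := fun k =>
      hΩ.integrable_surf (hφ.continuous.comp (continuous_id.prodMk (hu k).continuous))
    refine tendsto_integral_of_dominated_convergence (fun _ => C)
      (fun k => (hΩ.integrable_mul_normal_apply (hi k) j).1) (integrable_const C) (fun k => ?_) ?_
    · filter_upwards [ae_surf_mem_closure] with x hx
      rw [norm_mul]
      have h1 := (hC x hx (u k x)).1
      calc _ ≤ C * 1 := mul_le_mul h1 ((PiLp.norm_apply_le _ j).trans (norm_outerNormal_le _))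
            (norm_nonneg _) ((abs_nonneg _).trans h1)
        _ = C := mul_one C
    · filter_upwards [huT] with x hx
      have : Continuous fun b => φ (x, b) * outerNormal Ω x j :=
        (hφ.continuous.comp (by fun_prop)).mul continuous_const
      exact (this.tendsto _).comp hx
  refine tendsto_nhds_unique ?_ (t3.congr fun k => (e1 k).symm)
  have t4 := t2.add t1
  rw [zero_add] at t4
  refine t4.congr fun k => ?_
  have hI2 : Integrable (fun x => fderiv ℝ φ (x, u k x) (EuclideanSpace.single j 1, z x j))
      (volume.restrict Ω) := by
    refine hdom.mono' (hmeas k) ?_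
    filter_upwards [hbd (u k)] with x hx using hx _
  have hI1 : Integrable (fun x => fderiv ℝ φ (x, u k x)
      (EuclideanSpace.single j 1, pderiv j (u k) x)) (volume.restrict Ω) := by
    refine hΩ.integrable_vol ?_
    exact (hφ'.comp (continuous_id.prodMk (hu k).continuous)).clm_apply
      (continuous_const.prodMk (hdu k))
  rw [integral_sub hI1 hI2]
  ring

end ChainRule

/-! ### Traces of functions with values in a closed set -/

section TraceProperties

variable {n m : ℕ} {Ω : Set (Vec n)} {y : Vec n → Vec m} {z : Vec n → Jac n m} {T : Vec n → Vec m}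

theorem exists_forall_closure_norm_le (hΩ : IsLipschitzDomain Ω) {G : Type*} [NormedAddCommGroup G]
    {f : Vec n → G} (hf : Continuous f) : ∃ C : ℝ, 0 ≤ C ∧ ∀ x ∈ closure Ω, ‖f x‖ ≤ C := by
  obtain ⟨C, hC⟩ := hΩ.isBounded.isCompact_closure.exists_bound_of_continuousOn hf.continuousOn
  exact ⟨max C 0, le_max_right _ _, fun x hx => (hC x hx).trans (le_max_left _ _)⟩

theorem fderiv_fst_mul_snd {g : Vec n → ℝ} {b : Vec m → ℝ} (hg : ContDiff ℝ 1 g)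
    (hb : ContDiff ℝ 1 b) (x : Vec n) (v : Vec m) :
    fderiv ℝ (fun w : Vec n × Vec m => g w.1 * b w.2) (x, v)
      = g x • (fderiv ℝ b v).comp (ContinuousLinearMap.snd ℝ _ _)
        + b v • (fderiv ℝ g x).comp (ContinuousLinearMap.fst ℝ _ _) := by
  have h1 : HasFDerivAt (fun w : Vec n × Vec m => g w.1)
      ((fderiv ℝ g x).comp (ContinuousLinearMap.fst ℝ _ _)) (x, v) :=
    (hg.differentiable one_ne_zero x).hasFDerivAt.comp (x, v) hasFDerivAt_fst
  have h2 : HasFDerivAt (fun w : Vec n × Vec m => b w.2)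
      ((fderiv ℝ b v).comp (ContinuousLinearMap.snd ℝ _ _)) (x, v) :=
    (hb.differentiable one_ne_zero v).hasFDerivAt.comp (x, v) hasFDerivAt_snd
  exact (h1.mul h2).fderiv

theorem IsTrace.chain_rule_mul (hΩ : IsLipschitzDomain Ω) (hy : IsSobolev Ω 1 y z)
    (hT : IsTrace Ω y z T) {g : Vec n → ℝ} (hg : ContDiff ℝ 1 g) {b : Vec m → ℝ}
    (hb : ContDiff ℝ 1 b) {B : ℝ} (hB : ∀ v, |b v| ≤ B ∧ ‖fderiv ℝ b v‖ ≤ B) (j : Fin n) :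
    ∫ x in Ω, (pderiv j g x * b (y x) + g x * fderiv ℝ b (y x) (z x j))
      = ∫ x, g x * b (T x) * outerNormal Ω x j ∂surf Ω := by
  obtain ⟨C₁, hC₁, hg₁⟩ := exists_forall_closure_norm_le hΩ hg.continuous
  obtain ⟨C₂, hC₂, hg₂⟩ := exists_forall_closure_norm_le hΩ (hg.continuous_fderiv one_ne_zero)
  have hB0 : 0 ≤ B := (abs_nonneg _).trans (hB 0).1
  have h := hT.chain_rule_of_bounded hΩ hy (φ := fun w : Vec n × Vec m => g w.1 * b w.2)
    ((hg.comp contDiff_fst).mul (hb.comp contDiff_snd)) (C := C₁ * B + B * C₂) ?_ j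
  · rw [← h]
    congr 1
    ext1 x
    rw [fderiv_fst_mul_snd hg hb]
    simp [pderiv]
    ring
  · intro x hx v
    have h1 := hg₁ x hx
    have h2 := hg₂ x hx
    obtain ⟨h3, h4⟩ := hB v
    constructor
    · rw [abs_mul]
      have : |g x| * |b v| ≤ C₁ * B := mul_le_mul h1 h3 (abs_nonneg _) hC₁
      nlinarith
    · rw [fderiv_fst_mul_snd hg hb]
      refine (norm_add_le _ _).trans (add_le_add ?_ ?_)
      · rw [norm_smul]
        refine mul_le_mul h1 ?_ (norm_nonneg _) hC₁
        refine (ContinuousLinearMap.opNorm_comp_le _ _).trans ?_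
        calc _ ≤ B * 1 := mul_le_mul h4 (ContinuousLinearMap.norm_snd_le ..) (norm_nonneg _) hB0
          _ = B := mul_one B
      · rw [norm_smul]
        refine mul_le_mul h3 ?_ (norm_nonneg _) hB0
        refine (ContinuousLinearMap.opNorm_comp_le _ _).trans ?_
        calc _ ≤ C₂ * 1 := mul_le_mul h2 (ContinuousLinearMap.norm_fst_le ..) (norm_nonneg _) hC₂
          _ = C₂ := mul_one C₂

theorem IsSobolev.integrable_deriv_comp (hΩ : IsLipschitzDomain Ω) (hy : IsSobolev Ω 1 y z)
    {g : Vec n → ℝ} (hg : Continuous g) {b : Vec m → ℝ}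
    (hb : ContDiff ℝ 1 b) {B : ℝ} (hB : ∀ v, ‖fderiv ℝ b v‖ ≤ B) (j : Fin n) :
    Integrable (fun x => g x * fderiv ℝ b (y x) (z x j)) (volume.restrict Ω) := by
  have hzi := memLp_one_iff_integrable.1 (hy.memLp_deriv j)
  obtain ⟨C₁, hC₁, hg₁⟩ := exists_forall_closure_norm_le hΩ hg
  have hm : AEStronglyMeasurable (fun x => fderiv ℝ b (y x) (z x j)) (volume.restrict Ω) :=
    (ContinuousLinearMap.apply ℝ ℝ).flip.aestronglyMeasurable_comp₂
      ((hb.continuous_fderiv one_ne_zero).comp_aestronglyMeasurable hy.memLp.1) hzi.1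
  refine ((hzi.norm.const_mul B).const_mul C₁).mono' (hg.aestronglyMeasurable.mul hm) ?_
  filter_upwards [ae_restrict_mem hΩ.isOpen.measurableSet] with x hx
  rw [norm_mul]
  exact mul_le_mul (hg₁ x (subset_closure hx)) ((fderiv ℝ b (y x)).le_of_opNorm_le (hB _) _)
    (norm_nonneg _) hC₁

theorem IsSobolev.integrable_field_summand (hΩ : IsLipschitzDomain Ω) (hy : IsSobolev Ω 1 y z)
    {X : Vec n → Vec n} (hX : ContDiff ℝ 1 X) {b : Vec m → ℝ}
    (hb : ContDiff ℝ 1 b) {B : ℝ} (hB : ∀ v, |b v| ≤ B ∧ ‖fderiv ℝ b v‖ ≤ B) (j : Fin n) :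
    Integrable (fun x => pderiv j (fun x => X x j) x * b (y x) + X x j * fderiv ℝ b (y x) (z x j))
      (volume.restrict Ω) := by
  have := hΩ.isFiniteMeasure_vol
  have hXj := contDiff_coord hX
  refine Integrable.add ?_ (hy.integrable_deriv_comp hΩ (hXj j).continuous hb
    (fun v => (hB v).2) j)
  exact (hΩ.integrable_vol (continuous_pderiv (hXj j) j)).mul_bdd (c := B)
    (hb.continuous.comp_aestronglyMeasurable hy.memLp.1) (ae_of_all _ fun x => (hB _).1)

/-- Sums the scalar chain rule over the components of `X`. With `X` transverse and `b ≥ 0`, the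
boundary term has a sign and controls the integral of `b ∘ T`. -/
theorem IsTrace.chain_rule_field (hΩ : IsLipschitzDomain Ω) (hy : IsSobolev Ω 1 y z)
    (hT : IsTrace Ω y z T) {X : Vec n → Vec n} (hX : ContDiff ℝ 1 X) {b : Vec m → ℝ}
    (hb : ContDiff ℝ 1 b) {B : ℝ} (hB : ∀ v, |b v| ≤ B ∧ ‖fderiv ℝ b v‖ ≤ B) :
    ∫ x in Ω, ∑ j, (pderiv j (fun x => X x j) x * b (y x) + X x j * fderiv ℝ b (y x) (z x j))
      = ∫ x, b (T x) * inner ℝ (outerNormal Ω x) (X x) ∂surf Ω := by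
  have := hΩ.isFiniteMeasure_vol
  have := hΩ.isFiniteMeasure_surf
  have hXj := contDiff_coord hX
  have hbc := hb.continuous
  rw [integral_finsetSum]
  · rw [Finset.sum_congr rfl fun j _ => hT.chain_rule_mul hΩ hy (hXj j) hb hB j,
      ← integral_finsetSum]
    · congr 1
      ext1 x
      rw [PiLp.inner_apply, Finset.mul_sum]
      refine Finset.sum_congr rfl fun j _ => ?_
      simp only [RCLike.inner_apply, conj_trivial]
      ring
    · intro j _
      refine hΩ.integrable_mul_normal_apply ?_ j
      refine (hΩ.integrable_surf (hXj j).continuous).mul_bdd (c := B)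
        (hbc.comp_aestronglyMeasurable hT.1.1) (ae_of_all _ fun x => (hB _).1)
  · exact fun j _ => hy.integrable_field_summand hΩ hX hb hB j

theorem exists_bound_contDiff_compactSupport {b : Vec m → ℝ} (hb : ContDiff ℝ 1 b)
    (hc : HasCompactSupport b) : ∃ B, ∀ v, |b v| ≤ B ∧ ‖fderiv ℝ b v‖ ≤ B := by
  obtain ⟨B₁, h₁⟩ := hc.exists_bound_of_continuous hb.continuous
  obtain ⟨B₂, h₂⟩ := (hc.fderiv ℝ).exists_bound_of_continuous (hb.continuous_fderiv one_ne_zero)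
  exact ⟨max B₁ B₂, fun v => ⟨(h₁ v).trans (le_max_left _ _), (h₂ v).trans (le_max_right _ _)⟩⟩

/-- If a Sobolev function takes its values in a closed set, then so does its trace. -/
theorem IsTrace.ae_mem_of_isClosed (hΩ : IsLipschitzDomain Ω) (hy : IsSobolev Ω 1 y z)
    (hT : IsTrace Ω y z T) {K : Set (Vec m)} (hK : IsClosed K)
    (hyK : ∀ᵐ x ∂volume.restrict Ω, y x ∈ K) : ∀ᵐ x ∂surf Ω, T x ∈ K := by
  have := hΩ.isFiniteMeasure_surf
  obtain ⟨X, hX, δ, hδ, hXδ⟩ := hΩ.exists_transverse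
  have hX1 : ContDiff ℝ 1 X := hX.of_le (by norm_cast)
  have key : ∀ R : ℕ, ∀ᵐ x ∂surf Ω, T x ∉ Kᶜ ∩ Metric.ball 0 R := by
    intro R
    -- A nonnegative function whose support is exactly the forbidden set. The ball of radius `R`
    -- makes `b` and its derivative bounded.
    obtain ⟨b, hbs, hb, hb0⟩ := (hK.isOpen_compl.inter
      (Metric.isOpen_ball (x := (0 : Vec m)) (ε := R))).exists_contDiff_support_eq (n := 1)
    have hb0' : ∀ v, 0 ≤ b v := fun v => (hb0 (mem_range_self v)).1
    have hbc : HasCompactSupport b := by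
      refine HasCompactSupport.of_support_subset_isCompact
        (isCompact_closedBall (0 : Vec m) R) ?_
      rw [hbs]
      exact inter_subset_right.trans Metric.ball_subset_closedBall
    obtain ⟨B, hB⟩ := exists_bound_contDiff_compactSupport hb hbc
    have hz : ∀ v ∈ K, b v = 0 := fun v hv => by
      by_contra h
      have : v ∈ Function.support b := h
      rw [hbs] at this
      exact this.1 hv
    -- Points of `K` are minima of `b`, so its derivative vanishes there as well. Hence the bulk
    -- side of the chain rule is zero, and so is the nonnegative boundary integrand.
    have hdz : ∀ v ∈ K, fderiv ℝ b v = 0 := fun v hv =>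
      IsLocalMin.fderiv_eq_zero (Eventually.of_forall fun w => by rw [hz v hv]; exact hb0' w)
    have h1 := hT.chain_rule_field hΩ hy hX1 hb hB
    have h2 : ∫ x in Ω, ∑ j, (pderiv j (fun x => X x j) x * b (y x)
        + X x j * fderiv ℝ b (y x) (z x j)) = 0 := by
      refine integral_eq_zero_of_ae ?_
      filter_upwards [hyK] with x hx
      simp [hz _ hx, hdz _ hx]
    rw [h2] at h1
    have hbT : Integrable (fun x => b (T x)) (surf Ω) :=
      (integrable_const B).mono' (hb.continuous.comp_aestronglyMeasurable hT.1.1)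
        (ae_of_all _ fun x => (hB _).1)
    obtain ⟨C, hC0, hC⟩ := exists_forall_closure_norm_le hΩ hX1.continuous
    have hint : Integrable (fun x => b (T x) * inner ℝ (outerNormal Ω x) (X x)) (surf Ω) := by
      refine hbT.mul_bdd (c := C)
        (hΩ.aestronglyMeasurable_normal.inner hX1.continuous.aestronglyMeasurable) ?_
      filter_upwards [ae_surf_mem_closure] with x hx
      refine (norm_inner_le_norm _ _).trans ?_
      calc _ ≤ 1 * C := mul_le_mul (norm_outerNormal_le x) (hC x hx) (norm_nonneg _) zero_le_one
        _ = C := one_mul C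
    have h3 := (integral_eq_zero_iff_of_nonneg_ae ?_ hint).1 h1.symm
    · filter_upwards [h3, hXδ] with x hx hx'
      have hx0 : b (T x) = 0 := by
        rcases mul_eq_zero.1 hx with h | h
        · exact h
        · linarith
      rw [← hbs]
      simpa using hx0
    · filter_upwards [hXδ] with x hx
      exact mul_nonneg (hb0' _) (hδ.le.trans hx)
  filter_upwards [ae_all_iff.2 key] with x hx
  by_contra h
  obtain ⟨R, hR⟩ := exists_nat_gt ‖T x‖
  exact hx R ⟨h, by simpa using hR⟩

end TraceProperties

/-! ### Traces of functions in `W^{1,p}` belong to `L^p` -/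

section TraceMoments

variable {n m : ℕ} {Ω : Set (Vec n)} {y : Vec n → Vec m} {z : Vec n → Jac n m} {T : Vec n → Vec m}

/-- A smooth bounded function increasing to `(1 + ‖v‖²) ^ (p / 2)` as `ε` decreases to `0`. -/
def satPow (p ε : ℝ) (v : Vec m) : ℝ := (√(‖v‖ ^ 2 + 1) / (1 + ε * √(‖v‖ ^ 2 + 1))) ^ p

theorem hasDerivAt_satPow {p ε t : ℝ} (hε : 0 ≤ ε) (ht : 0 < t) :
    HasDerivAt (fun t : ℝ => (t / (1 + ε * t)) ^ p)
      (((1 + ε * t) ^ 2)⁻¹ * p * (t / (1 + ε * t)) ^ (p - 1)) t := by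
  have hpos : 0 < 1 + ε * t := by positivity
  have h1 : HasDerivAt (fun t : ℝ => t / (1 + ε * t)) (((1 + ε * t) ^ 2)⁻¹) t := by
    have := (hasDerivAt_id t).div (((hasDerivAt_id t).const_mul ε).const_add 1) hpos.ne'
    refine this.congr_deriv ?_
    simp only [id]
    field_simp
    ring
  exact h1.rpow_const (Or.inl (by positivity))

theorem sqrt_norm_sq_add_one_le (v : Vec m) : √(‖v‖ ^ 2 + 1) ≤ 1 + ‖v‖ := by
  rw [Real.sqrt_le_left (by positivity)]
  nlinarith [norm_nonneg v]

theorem norm_le_sqrt_norm_sq_add_one (v : Vec m) : ‖v‖ ≤ √(‖v‖ ^ 2 + 1) :=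
  Real.le_sqrt_of_sq_le (by linarith)

theorem hasFDerivAt_satPow {p ε : ℝ} (hε : 0 ≤ ε) (v : Vec m) :
    HasFDerivAt (satPow p ε : Vec m → ℝ)
      ((((1 + ε * √(‖v‖ ^ 2 + 1)) ^ 2)⁻¹ * p
        * (√(‖v‖ ^ 2 + 1) / (1 + ε * √(‖v‖ ^ 2 + 1))) ^ (p - 1)) •
        ((1 / (2 * √(‖v‖ ^ 2 + 1))) • (2 • innerSL ℝ v))) v := by
  have h1 := ((hasStrictFDerivAt_norm_sq v).hasFDerivAt.add_const 1).sqrt (by positivity)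
  have hpos : 0 < √(‖v‖ ^ 2 + 1) := Real.sqrt_pos.2 (by positivity)
  exact (hasDerivAt_satPow (p := p) hε hpos).comp_hasFDerivAt v h1

theorem contDiff_satPow {p ε : ℝ} (hε : 0 ≤ ε) : ContDiff ℝ 1 (satPow p ε : Vec m → ℝ) := by
  have hs : ContDiff ℝ 1 fun v : Vec m => √(‖v‖ ^ 2 + 1) :=
    ((contDiff_norm_sq ℝ).add contDiff_const).sqrt fun v => by positivity
  refine (hs.div (contDiff_const.add (contDiff_const.mul hs)) fun v => ?_).rpow_const_of_ne
    fun v => ?_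
  · have : 0 < √(‖v‖ ^ 2 + 1) := Real.sqrt_pos.2 (by positivity)
    exact (by positivity : 1 + ε * √(‖v‖ ^ 2 + 1) ≠ 0)
  · have hpos : 0 < √(‖v‖ ^ 2 + 1) := Real.sqrt_pos.2 (by positivity)
    exact (by positivity : √(‖v‖ ^ 2 + 1) / (1 + ε * √(‖v‖ ^ 2 + 1)) ≠ 0)

theorem satPow_nonneg (p ε : ℝ) (hε : 0 ≤ ε) (v : Vec m) : 0 ≤ satPow p ε v := by
  rw [satPow]; positivity

/-- Used with two values of `a`: the constant `1 / ε`, which makes the chain rule for bounded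
functions applicable, and `1 + ‖v‖`, which gives estimates independent of `ε`. -/
theorem satPow_bounds {p ε : ℝ} (hp : 1 ≤ p) (hε : 0 ≤ ε) (v : Vec m) {a : ℝ} (ha : 0 < a)
    (h : √(‖v‖ ^ 2 + 1) / (1 + ε * √(‖v‖ ^ 2 + 1)) ≤ a) :
    satPow p ε v ≤ a ^ p ∧ ‖fderiv ℝ (satPow p ε : Vec m → ℝ) v‖ ≤ p * a ^ (p - 1) := by
  have hpos : 0 < √(‖v‖ ^ 2 + 1) := Real.sqrt_pos.2 (by positivity)
  have hq : 0 ≤ √(‖v‖ ^ 2 + 1) / (1 + ε * √(‖v‖ ^ 2 + 1)) := by positivity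
  refine ⟨Real.rpow_le_rpow hq h (by linarith), ?_⟩
  rw [(hasFDerivAt_satPow hε v).fderiv, norm_smul]
  have h1 : ‖(1 / (2 * √(‖v‖ ^ 2 + 1))) • (2 • innerSL ℝ v)‖ ≤ 1 := by
    rw [norm_smul, ← Nat.cast_smul_eq_nsmul ℝ, norm_smul, innerSL_apply_norm, Real.norm_of_nonneg (by positivity)]
    rw [div_mul_eq_mul_div, div_le_one (by positivity)]
    have := norm_le_sqrt_norm_sq_add_one v
    norm_num
    linarith
  have h2 : ((1 + ε * √(‖v‖ ^ 2 + 1)) ^ 2)⁻¹ ≤ 1 := by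
    apply inv_le_one_of_one_le₀
    have : 0 ≤ ε * √(‖v‖ ^ 2 + 1) := by positivity
    nlinarith
  have h3 : (√(‖v‖ ^ 2 + 1) / (1 + ε * √(‖v‖ ^ 2 + 1))) ^ (p - 1) ≤ a ^ (p - 1) :=
    Real.rpow_le_rpow hq h (by linarith)
  rw [Real.norm_of_nonneg (by positivity)]
  calc _ ≤ 1 * p * a ^ (p - 1) * 1 := by gcongr
    _ = _ := by ring

/-- A crude Young inequality: the product is at most the `p`-th power of the larger of `s` and `a`.
-/
theorem rpow_sub_one_mul_le {p s a : ℝ} (hp : 1 ≤ p) (hs : 0 < s) (ha : 0 ≤ a) :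
    s ^ (p - 1) * a ≤ s ^ p + a ^ p := by
  rcases le_total a s with h | h
  · have h1 : s ^ (p - 1) * a ≤ s ^ (p - 1) * s := by gcongr
    rw [← Real.rpow_add_one hs.ne', sub_add_cancel] at h1
    have : 0 ≤ a ^ p := by positivity
    linarith
  · have h0 : 0 < a := hs.trans_le h
    have h1 : s ^ (p - 1) * a ≤ a ^ (p - 1) * a := by
      have := Real.rpow_le_rpow hs.le h (by linarith : 0 ≤ p - 1)
      gcongr
    rw [← Real.rpow_add_one h0.ne', sub_add_cancel] at h1
    have : 0 ≤ s ^ p := by positivity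
    linarith

theorem IsSobolev.integrable_rpow (hΩ : IsLipschitzDomain Ω) {p : ℝ≥0∞} (hp : 1 ≤ p) (hp' : p ≠ ⊤)
    (hy : IsSobolev Ω p y z) :
    Integrable (fun x => (1 + ‖y x‖) ^ p.toReal) (volume.restrict Ω) ∧
    ∀ j, Integrable (fun x => ‖z x j‖ ^ p.toReal) (volume.restrict Ω) := by
  have := hΩ.isFiniteMeasure_vol
  have hp0 : p ≠ 0 := (zero_lt_one.trans_le hp).ne'
  refine ⟨?_, fun j => (hy.memLp_deriv j).integrable_norm_rpow hp0 hp'⟩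
  have h0 : MemLp (fun _ : Vec n => (1 : ℝ)) p (volume.restrict Ω) := memLp_const 1
  have h1 : MemLp (fun x => 1 + ‖y x‖) p (volume.restrict Ω) := h0.add hy.memLp.norm
  refine (h1.integrable_norm_rpow hp0 hp').congr (ae_of_all _ fun x => ?_)
  simp only
  rw [Real.norm_of_nonneg (by positivity)]

/-- The trace of a `W^{1,p}` function is in `L^p`. -/
theorem IsTrace.memLp (hΩ : IsLipschitzDomain Ω) {p : ℝ≥0∞} (hp : 1 ≤ p) (hp' : p ≠ ⊤)
    (hy : IsSobolev Ω p y z) (hT : IsTrace Ω y z T) : MemLp T p (surf Ω) := by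
  have := hΩ.isFiniteMeasure_surf
  obtain ⟨X, hX, δ, hδ, hXδ⟩ := hΩ.exists_transverse
  have hX1 : ContDiff ℝ 1 X := hX.of_le (by norm_cast)
  have hXj := contDiff_coord hX1
  have hy1 := hy.mono hΩ hp
  have hp0 : p ≠ 0 := (zero_lt_one.trans_le hp).ne'
  set q := p.toReal with hq
  have hq1 : 1 ≤ q := by
    rw [hq, ← ENNReal.toReal_one]; exact ENNReal.toReal_mono hp' hp
  obtain ⟨hyi, hzi⟩ := hy.integrable_rpow hΩ hp hp'
  choose C₁ hC₁ hXb using fun j => exists_forall_closure_norm_le hΩ (hXj j).continuous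
  choose C₂ hC₂ hXd using fun j => exists_forall_closure_norm_le hΩ (continuous_pderiv (hXj j) j)
  -- A majorant of the bulk integrand that does not depend on `ε`.
  set G : Vec n → ℝ := fun x => ∑ j, (C₂ j * (1 + ‖y x‖) ^ q
    + C₁ j * (q * ((1 + ‖y x‖) ^ q + ‖z x j‖ ^ q))) with hG
  have hGi : Integrable G (volume.restrict Ω) := integrable_finsetSum _ fun j _ =>
    (hyi.const_mul _).add (((hyi.add (hzi j)).const_mul q).const_mul _)
  have hsmall : ∀ (ε : ℝ) (hε : 0 < ε) (v : Vec m),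
      √(‖v‖ ^ 2 + 1) / (1 + ε * √(‖v‖ ^ 2 + 1)) ≤ 1 / ε := by
    intro ε hε v
    rw [div_le_div_iff₀ (by positivity) hε]
    linarith
  have hbig : ∀ (ε : ℝ) (hε : 0 < ε) (v : Vec m),
      √(‖v‖ ^ 2 + 1) / (1 + ε * √(‖v‖ ^ 2 + 1)) ≤ 1 + ‖v‖ := by
    intro ε hε v
    refine (div_le_self (by positivity) ?_).trans (sqrt_norm_sq_add_one_le v)
    have : 0 ≤ ε * √(‖v‖ ^ 2 + 1) := by positivity
    linarith
  have key : ∀ ε : ℝ, 0 < ε → ∫⁻ x, ENNReal.ofReal (satPow q ε (T x)) ∂surf Ω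
      ≤ ENNReal.ofReal ((∫ x in Ω, G x) / δ) := by
    intro ε hε
    have hb := contDiff_satPow (m := m) (p := q) hε.le
    have hB : ∀ v : Vec m, |satPow q ε v| ≤ max ((1 / ε) ^ q) (q * (1 / ε) ^ (q - 1)) ∧
        ‖fderiv ℝ (satPow q ε : Vec m → ℝ) v‖ ≤ max ((1 / ε) ^ q) (q * (1 / ε) ^ (q - 1)) := by
      intro v
      obtain ⟨h1, h2⟩ := satPow_bounds hq1 hε.le v (by positivity) (hsmall ε hε v)
      rw [abs_of_nonneg (satPow_nonneg q ε hε.le v)]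
      exact ⟨h1.trans (le_max_left _ _), h2.trans (le_max_right _ _)⟩
    have h1 := hT.chain_rule_field hΩ hy1 hX1 hb hB
    have hbT : Integrable (fun x => satPow q ε (T x)) (surf Ω) :=
      (integrable_const _).mono' (hb.continuous.comp_aestronglyMeasurable hT.1.1)
        (ae_of_all _ fun x => (hB _).1)
    obtain ⟨C, hC0, hC⟩ := exists_forall_closure_norm_le hΩ hX1.continuous
    have hint : Integrable (fun x => satPow q ε (T x) * inner ℝ (outerNormal Ω x) (X x))
        (surf Ω) := by
      refine hbT.mul_bdd (c := C)
        (hΩ.aestronglyMeasurable_normal.inner hX1.continuous.aestronglyMeasurable) ?_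
      filter_upwards [ae_surf_mem_closure] with x hx
      refine (norm_inner_le_norm _ _).trans ?_
      calc _ ≤ 1 * C := mul_le_mul (norm_outerNormal_le x) (hC x hx) (norm_nonneg _) zero_le_one
        _ = C := one_mul C
    have h2 : δ * ∫ x, satPow q ε (T x) ∂surf Ω ≤ ∫ x in Ω, G x := by
      rw [← integral_const_mul]
      refine (integral_mono_ae (hbT.const_mul δ) hint ?_).trans ?_
      · filter_upwards [hXδ] with x hx
        rw [mul_comm]
        exact mul_le_mul_of_nonneg_left hx (satPow_nonneg q ε hε.le _)
      · rw [← h1]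
        refine integral_mono_ae (integrable_finsetSum _ fun j _ =>
          hy1.integrable_field_summand hΩ hX1 hb hB j) hGi ?_
        filter_upwards [ae_restrict_mem hΩ.isOpen.measurableSet] with x hx
        refine Finset.sum_le_sum fun j _ => ?_
        obtain ⟨h3, h4⟩ := satPow_bounds hq1 hε.le (y x) (by positivity) (hbig ε hε (y x))
        refine add_le_add ?_ ?_
        · refine mul_le_mul ((le_abs_self _).trans (hXd j x (subset_closure hx))) h3
            (satPow_nonneg q ε hε.le _) (hC₂ j)
        · refine (le_abs_self _).trans ?_
          rw [abs_mul]
          refine mul_le_mul (hXb j x (subset_closure hx)) ?_ (abs_nonneg _) (hC₁ j)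
          refine ((fderiv ℝ (satPow q ε) (y x)).le_of_opNorm_le h4 _).trans ?_
          rw [mul_assoc]
          gcongr
          exact rpow_sub_one_mul_le hq1 (by positivity) (norm_nonneg _)
    rw [← ofReal_integral_eq_lintegral_ofReal hbT
      (ae_of_all _ fun x => satPow_nonneg q ε hε.le _)]
    refine ENNReal.ofReal_le_ofReal ?_
    rw [le_div_iff₀ hδ]
    linarith
  refine ⟨hT.1.1, ?_⟩
  rw [eLpNorm_lt_top_iff_lintegral_rpow_enorm_lt_top hp0 hp', ← hq]
  refine lt_of_le_of_lt ?_ (ENNReal.ofReal_lt_top (r := (∫ x in Ω, G x) / δ))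
  have hlim : ∀ x, ‖T x‖ₑ ^ q
      ≤ liminf (fun k : ℕ => ENNReal.ofReal (satPow q (1 / ((k : ℝ) + 1)) (T x))) atTop := by
    intro x
    have h1 : Tendsto (fun k : ℕ => ENNReal.ofReal (satPow q (1 / ((k : ℝ) + 1)) (T x))) atTop
        (𝓝 (ENNReal.ofReal ((√(‖T x‖ ^ 2 + 1) / (1 + 0 * √(‖T x‖ ^ 2 + 1))) ^ q))) := by
      refine ENNReal.tendsto_ofReal ((tendsto_const_nhds.div (tendsto_const_nhds.add
        (tendsto_one_div_add_atTop_nhds_zero_nat.mul_const _)) ?_).rpow_const (Or.inr ?_))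
      · simp
      · linarith
    rw [h1.liminf_eq, zero_mul, add_zero, div_one, ← ofReal_norm,
      ENNReal.ofReal_rpow_of_nonneg (norm_nonneg _) (by linarith)]
    exact ENNReal.ofReal_le_ofReal (Real.rpow_le_rpow (norm_nonneg _)
      (norm_le_sqrt_norm_sq_add_one _) (by linarith))
  -- Fatou's lemma along `ε = 1 / (k + 1)`, with the uniform bound `key`.
  refine (lintegral_mono hlim).trans ((lintegral_liminf_le' fun k => ?_).trans ?_)
  · exact ((contDiff_satPow (by positivity)).continuous.comp_aestronglyMeasurable
      hT.1.1).aemeasurable.ennreal_ofReal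
  · refine liminf_le_of_le ?_ fun b hb => ?_
    · isBoundedDefault
    · obtain ⟨k, hk⟩ := hb.exists
      exact hk.trans (key _ (by positivity))

end TraceMoments

/-! ### Chain rule up to the boundary: removing boundedness by cutoffs -/

section GeneralChainRule

variable {n m : ℕ} {Ω : Set (Vec n)} {y : Vec n → Vec m} {z : Vec n → Jac n m} {T : Vec n → Vec m}

/-- Dilations of one bump function. On the support of the derivative `‖v‖ ≤ 2 (k + 1)`, so the
dilation factor `1 / (k + 1)` decays like `1 / (1 + ‖v‖)` uniformly in `k`. This decay produces the
weight in the second integrability hypothesis of `IsTrace.chain_rule`. -/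
theorem exists_cutoff (m : ℕ) : ∃ (κ : ℕ → Vec m → ℝ) (C : ℝ), (∀ k, ContDiff ℝ ∞ (κ k)) ∧
    (∀ k, HasCompactSupport (κ k)) ∧ (∀ k v, |κ k v| ≤ 1) ∧
    (∀ k v, ‖fderiv ℝ (κ k) v‖ ≤ C / (1 + ‖v‖)) ∧ ∀ v, ∀ᶠ k in atTop, κ k =ᶠ[𝓝 v] 1 := by
  let χ : ContDiffBump (0 : Vec m) := ⟨1, 2, one_pos, by norm_num⟩
  have hχ1 : ContDiff ℝ 1 χ := χ.contDiff
  obtain ⟨C, hC⟩ := (χ.hasCompactSupport.fderiv ℝ).exists_bound_of_continuous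
    (hχ1.continuous_fderiv one_ne_zero)
  have hC0 : 0 ≤ C := (norm_nonneg _).trans (hC 0)
  have hpos : ∀ k : ℕ, (0 : ℝ) < ((k : ℝ) + 1)⁻¹ := fun k => by positivity
  -- The factor `3` bounds `(1 + ‖v‖) / (k + 1)` on the support of the derivative.
  refine ⟨fun k v => χ (((k : ℝ) + 1)⁻¹ • v), 3 * C, fun k => ?_, fun k => ?_, fun k v => ?_,
    fun k v => ?_, fun v => ?_⟩
  · exact χ.contDiff.comp (contDiff_const_smul _)
  · exact χ.hasCompactSupport.comp_smul (hpos k).ne'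
  · rw [abs_of_nonneg χ.nonneg]
    exact χ.le_one
  · rw [le_div_iff₀ (by positivity)]
    have h1 : fderiv ℝ (fun v => χ (((k : ℝ) + 1)⁻¹ • v)) v
        = ((k : ℝ) + 1)⁻¹ • fderiv ℝ χ (((k : ℝ) + 1)⁻¹ • v) := fderiv_comp_smul _
    rw [h1, norm_smul, Real.norm_of_nonneg (hpos k).le]
    by_cases hv : ((k : ℝ) + 1)⁻¹ • v ∈ tsupport χ
    · rw [χ.tsupport_eq] at hv
      have h2 : ((k : ℝ) + 1)⁻¹ * ‖v‖ ≤ 2 := by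
        simpa [norm_smul, abs_of_pos (by positivity : (0 : ℝ) < (k : ℝ) + 1)] using hv
      have h3 : ((k : ℝ) + 1)⁻¹ ≤ 1 := inv_le_one_of_one_le₀ (by linarith [k.cast_nonneg (α := ℝ)])
      have h4 := hC (((k : ℝ) + 1)⁻¹ • v)
      calc _ = (((k : ℝ) + 1)⁻¹ + ((k : ℝ) + 1)⁻¹ * ‖v‖) * ‖fderiv ℝ χ (((k : ℝ) + 1)⁻¹ • v)‖ := by
            ring
        _ ≤ 3 * C := mul_le_mul (by linarith) h4 (norm_nonneg _) (by norm_num)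
    · have h2 : fderiv ℝ χ (((k : ℝ) + 1)⁻¹ • v) = 0 := by
        by_contra h
        exact hv (support_fderiv_subset ℝ h)
      rw [h2, norm_zero, mul_zero, zero_mul]
      positivity
  · obtain ⟨N, hN⟩ := exists_nat_gt ‖v‖
    filter_upwards [eventually_ge_atTop N] with k hk
    have h1 : Metric.ball (0 : Vec m) (k + 1) ∈ 𝓝 v := by
      refine Metric.isOpen_ball.mem_nhds ?_
      have : (N : ℝ) ≤ k := by exact_mod_cast hk
      simp only [Metric.mem_ball, dist_zero_right]
      linarith
    filter_upwards [h1] with w hw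
    refine χ.one_of_mem_closedBall ?_
    have hw' : ‖w‖ < k + 1 := by simpa using hw
    rw [mem_closedBall_zero_iff, norm_smul, Real.norm_of_nonneg (hpos k).le]
    change ((k : ℝ) + 1)⁻¹ * ‖w‖ ≤ 1
    rw [inv_mul_le_iff₀ (by positivity)]
    linarith

theorem fderiv_mul_snd {φ : Vec n × Vec m → ℝ} {κ : Vec m → ℝ} (hφ : ContDiff ℝ 1 φ)
    (hκ : ContDiff ℝ 1 κ) (w : Vec n × Vec m) :
    fderiv ℝ (fun w : Vec n × Vec m => φ w * κ w.2) w
      = φ w • (fderiv ℝ κ w.2).comp (ContinuousLinearMap.snd ℝ _ _) + κ w.2 • fderiv ℝ φ w := by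
  have h2 : HasFDerivAt (fun w : Vec n × Vec m => κ w.2)
      ((fderiv ℝ κ w.2).comp (ContinuousLinearMap.snd ℝ _ _)) w :=
    (hκ.differentiable one_ne_zero w.2).hasFDerivAt.comp w hasFDerivAt_snd
  exact ((hφ.differentiable one_ne_zero w).hasFDerivAt.mul h2).fderiv

/-- The chain rule up to the boundary. -/
theorem IsTrace.chain_rule (hΩ : IsLipschitzDomain Ω) (hy : IsSobolev Ω 1 y z)
    (hT : IsTrace Ω y z T) {φ : Vec n × Vec m → ℝ} (hφ : ContDiff ℝ 1 φ) (j : Fin n)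
    (h1 : Integrable (fun x => fderiv ℝ φ (x, y x) (EuclideanSpace.single j 1, z x j))
      (volume.restrict Ω))
    (h2 : Integrable (fun x => φ (x, y x) * (‖z x j‖ / (1 + ‖y x‖))) (volume.restrict Ω))
    (h3 : Integrable (fun x => φ (x, T x)) (surf Ω)) :
    ∫ x in Ω, fderiv ℝ φ (x, y x) (EuclideanSpace.single j 1, z x j)
      = ∫ x, φ (x, T x) * outerNormal Ω x j ∂surf Ω := by
  obtain ⟨κ, C, hκ, hκc, hκ1, hκd, hκlim⟩ := exists_cutoff m
  have hκ' : ∀ k, ContDiff ℝ 1 (κ k) := fun k => (hκ k).of_le (by norm_cast)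
  have hψ : ∀ k, ContDiff ℝ 1 fun w : Vec n × Vec m => φ w * κ k w.2 := fun k =>
    hφ.mul ((hκ' k).comp contDiff_snd)
  have hbound : ∀ k, ∃ B, ∀ x ∈ closure Ω, ∀ b, |φ (x, b) * κ k b| ≤ B ∧
      ‖fderiv ℝ (fun w : Vec n × Vec m => φ w * κ k w.2) (x, b)‖ ≤ B := by
    intro k
    have hK : IsCompact (closure Ω ×ˢ tsupport (κ k)) :=
      hΩ.isBounded.isCompact_closure.prod (hκc k)
    obtain ⟨B₁, hB₁⟩ := hK.exists_bound_of_continuousOn (hψ k).continuous.continuousOn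
    obtain ⟨B₂, hB₂⟩ := hK.exists_bound_of_continuousOn
      ((hψ k).continuous_fderiv one_ne_zero).continuousOn
    refine ⟨max (max B₁ B₂) 0, fun x hx b => ?_⟩
    by_cases hb : b ∈ tsupport (κ k)
    · exact ⟨((hB₁ (x, b) ⟨hx, hb⟩).trans (le_max_left _ _)).trans (le_max_left _ _),
        ((hB₂ (x, b) ⟨hx, hb⟩).trans (le_max_right _ _)).trans (le_max_left _ _)⟩
    · have hb0 : κ k b = 0 := image_eq_zero_of_notMem_tsupport hb
      have hd0 : fderiv ℝ (κ k) b = 0 := by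
        by_contra h
        exact hb (support_fderiv_subset ℝ h)
      rw [fderiv_mul_snd hφ (hκ' k)]
      simp [hb0, hd0]
  have heq : ∀ k, ∫ x in Ω, (φ (x, y x) * fderiv ℝ (κ k) (y x) (z x j)
        + κ k (y x) * fderiv ℝ φ (x, y x) (EuclideanSpace.single j 1, z x j))
      = ∫ x, κ k (T x) * (φ (x, T x) * outerNormal Ω x j) ∂surf Ω := by
    intro k
    obtain ⟨B, hB⟩ := hbound k
    have := hT.chain_rule_of_bounded hΩ hy (hψ k) hB j
    simp only [fderiv_mul_snd hφ (hκ' k)] at this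
    convert this using 2
    · ext1 x
      simp
    · ext1 x
      ring
  have hφy : AEStronglyMeasurable (fun x => φ (x, y x)) (volume.restrict Ω) :=
    hφ.continuous.comp_aestronglyMeasurable (aestronglyMeasurable_id.prodMk hy.memLp.1)
  -- The term with the derivative of the cutoff is dominated by `C |φ| ‖z‖ / (1 + ‖y‖)`, integrable
  -- by `h2`, and at each point it vanishes for large `k`.
  have t1 : Tendsto (fun k => ∫ x in Ω, (φ (x, y x) * fderiv ℝ (κ k) (y x) (z x j)
        + κ k (y x) * fderiv ℝ φ (x, y x) (EuclideanSpace.single j 1, z x j))) atTop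
      (𝓝 (∫ x in Ω, fderiv ℝ φ (x, y x) (EuclideanSpace.single j 1, z x j))) := by
    refine tendsto_integral_of_dominated_convergence _ (fun k => ?_)
      ((h2.norm.const_mul C).add h1.norm) (fun k => ae_of_all _ fun x => ?_)
      (ae_of_all _ fun x => ?_)
    · refine (hφy.mul ?_).add
        (((hκ' k).continuous.comp_aestronglyMeasurable hy.memLp.1).mul h1.1)
      exact (ContinuousLinearMap.apply ℝ ℝ).flip.aestronglyMeasurable_comp₂
        (((hκ' k).continuous_fderiv one_ne_zero).comp_aestronglyMeasurable hy.memLp.1)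
        (hy.memLp_deriv j).1
    · refine (norm_add_le _ _).trans (add_le_add ?_ ?_)
      · beta_reduce
        rw [norm_mul, norm_mul, Real.norm_of_nonneg (by positivity : 0 ≤ ‖z x j‖ / (1 + ‖y x‖))]
        calc _ ≤ ‖φ (x, y x)‖ * (C / (1 + ‖y x‖) * ‖z x j‖) :=
              mul_le_mul_of_nonneg_left
                ((fderiv ℝ (κ k) (y x)).le_of_opNorm_le (hκd k _) _) (norm_nonneg _)
          _ = _ := by ring
      · rw [norm_mul]
        exact mul_le_of_le_one_left (norm_nonneg _) (hκ1 k _)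
    · refine tendsto_const_nhds.congr' ?_
      filter_upwards [hκlim (y x)] with k hk
      have hd : fderiv ℝ (κ k) (y x) = 0 := by
        rw [hk.fderiv_eq]
        exact fderiv_const_apply 1
      rw [hk.eq_of_nhds, hd]
      simp
  have t2 : Tendsto (fun k => ∫ x, κ k (T x) * (φ (x, T x) * outerNormal Ω x j) ∂surf Ω) atTop
      (𝓝 (∫ x, φ (x, T x) * outerNormal Ω x j ∂surf Ω)) := by
    have h3' := hΩ.integrable_mul_normal_apply h3 j
    refine tendsto_integral_of_dominated_convergence _ (fun k => ?_) h3'.norm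
      (fun k => ae_of_all _ fun x => ?_) (ae_of_all _ fun x => ?_)
    · exact ((hκ' k).continuous.comp_aestronglyMeasurable hT.1.1).mul h3'.1
    · rw [norm_mul]
      exact mul_le_of_le_one_left (norm_nonneg _) (hκ1 k _)
    · refine tendsto_const_nhds.congr' ?_
      filter_upwards [hκlim (T x)] with k hk
      rw [hk.eq_of_nhds]
      simp
  exact tendsto_nhds_unique t1 (t2.congr fun k => (heq k).symm)

theorem fderiv_prod_apply {φ : Vec n × Vec m → ℝ} (hφ : ContDiff ℝ 1 φ) (x : Vec n) (v b : Vec m)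
    (j : Fin n) : fderiv ℝ φ (x, v) (EuclideanSpace.single j 1, b)
      = pderiv j (fun a => φ (a, v)) x + fderiv ℝ (fun b => φ (x, b)) v b := by
  have hd := (hφ.differentiable one_ne_zero (x, v)).hasFDerivAt
  have h1 : HasFDerivAt (fun a => φ (a, v)) _ x := hd.comp x (hasFDerivAt_prodMk_left x v)
  have h2 : HasFDerivAt (fun b => φ (x, b)) _ v := hd.comp v (hasFDerivAt_prodMk_right x v)
  rw [pderiv, h1.fderiv, h2.fderiv, ContinuousLinearMap.comp_apply, ContinuousLinearMap.comp_apply,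
    ← map_add]
  simp

/-- The chain rule for essentially bounded functions. -/
theorem IsTrace.chain_rule_top (hΩ : IsLipschitzDomain Ω) (hy : IsSobolev Ω ⊤ y z)
    (hT : IsTrace Ω y z T) {φ : Vec n × Vec m → ℝ} (hφ : ContDiff ℝ 1 φ) (j : Fin n) :
    ∫ x in Ω, fderiv ℝ φ (x, y x) (EuclideanSpace.single j 1, z x j)
      = ∫ x, φ (x, T x) * outerNormal Ω x j ∂surf Ω := by
  have := hΩ.isFiniteMeasure_vol
  have := hΩ.isFiniteMeasure_surf
  have hy1 := hy.mono hΩ (q := 1) le_top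
  have hbdd : ∀ f : Vec n → Vec m, MemLp f ⊤ (volume.restrict Ω) →
      ∃ R : ℝ, ∀ᵐ x ∂volume.restrict Ω, ‖f x‖ ≤ R := fun f hf =>
    ⟨_, (ae_le_lpNorm_exponent_top hf)⟩
  obtain ⟨R, hR⟩ := hbdd y hy.memLp
  obtain ⟨S, hS⟩ := hbdd _ (hy.memLp_deriv j)
  -- The essential bound on `y` passes to the trace because a closed ball is closed.
  have hTR := hT.ae_mem_of_isClosed hΩ hy1 (K := Metric.closedBall 0 R) Metric.isClosed_closedBall
    (by filter_upwards [hR] with x hx; simpa using hx)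
  have hK : IsCompact (closure Ω ×ˢ Metric.closedBall (0 : Vec m) R) :=
    hΩ.isBounded.isCompact_closure.prod (isCompact_closedBall _ _)
  obtain ⟨B₁, hB₁⟩ := hK.exists_bound_of_continuousOn hφ.continuous.continuousOn
  obtain ⟨B₂, hB₂⟩ := hK.exists_bound_of_continuousOn
    (hφ.continuous_fderiv one_ne_zero).continuousOn
  have hφy : AEStronglyMeasurable (fun x => φ (x, y x)) (volume.restrict Ω) :=
    hφ.continuous.comp_aestronglyMeasurable (aestronglyMeasurable_id.prodMk hy.memLp.1)
  have hφT : AEStronglyMeasurable (fun x => φ (x, T x)) (surf Ω) :=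
    hφ.continuous.comp_aestronglyMeasurable (aestronglyMeasurable_id.prodMk hT.1.1)
  have hdφ : AEStronglyMeasurable (fun x => fderiv ℝ φ (x, y x)) (volume.restrict Ω) :=
    (hφ.continuous_fderiv one_ne_zero).comp_aestronglyMeasurable
      (aestronglyMeasurable_id.prodMk hy.memLp.1)
  refine hT.chain_rule hΩ hy1 hφ j ?_ ?_ ?_
  · refine (integrable_const (B₂ * (1 + S))).mono'
      ((ContinuousLinearMap.apply ℝ ℝ).flip.aestronglyMeasurable_comp₂ hdφ
        (aestronglyMeasurable_const.prodMk (hy.memLp_deriv j).1)) ?_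
    filter_upwards [hR, hS, ae_restrict_mem hΩ.isOpen.measurableSet] with x h1 h2 hx
    have h3 := hB₂ (x, y x) ⟨subset_closure hx, by simpa using h1⟩
    refine (norm_clm_prod_apply_le h3 j _).trans ?_
    have : 0 ≤ B₂ := (norm_nonneg _).trans h3
    gcongr
  · refine (integrable_const (B₁ * S)).mono' (hφy.mul ((hy.memLp_deriv j).1.norm.aemeasurable.div
      (hy.memLp.1.norm.aemeasurable.const_add 1)).aestronglyMeasurable) ?_
    filter_upwards [hR, hS, ae_restrict_mem hΩ.isOpen.measurableSet] with x h1 h2 hx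
    have h3 := hB₁ (x, y x) ⟨subset_closure hx, by simpa using h1⟩
    rw [norm_mul, Real.norm_of_nonneg (by positivity : 0 ≤ ‖z x j‖ / (1 + ‖y x‖))]
    refine mul_le_mul h3 ?_ (by positivity) ((norm_nonneg _).trans h3)
    exact (div_le_self (norm_nonneg _) (by linarith [norm_nonneg (y x)])).trans h2
  · refine (integrable_const B₁).mono' hφT ?_
    filter_upwards [hTR, ae_surf_mem_closure] with x h1 hx
    exact hB₁ (x, T x) ⟨hx, h1⟩

end GeneralChainRule

/-! ### Chain rule for the test class `𝐅_p` -/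

section TestFunctions

variable {n m : ℕ} {I : Type*} {P : Problem n m I} {y : Vec n → Vec m} {z : Vec n → Jac n m}
  {T : Vec n → Vec m}

theorem one_add_rpow_le {a t : ℝ} (ha : 0 ≤ a) (ht : 0 ≤ t) : 1 + a ^ t ≤ 2 * (1 + a) ^ t := by
  have h1 : (1 : ℝ) ≤ (1 + a) ^ t := Real.one_le_rpow (by linarith) ht
  have h2 : a ^ t ≤ (1 + a) ^ t := Real.rpow_le_rpow ha (by linarith) ht
  linarith

/-- The growth conditions are what `IsTrace.chain_rule` needs. The bound on the `y`-derivative times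
`‖z‖` is integrable by Young's inequality, and so is `|φ| ‖z‖ / (1 + ‖y‖)`. On the boundary, the
trace is in `L^p`. -/
theorem Problem.IsTest.chain_rule (hΩ : IsLipschitzDomain P.Ω) {p : ℝ≥0∞} (hp : 1 ≤ p)
    (hY : IsClosed P.Y) (hy : IsSobolev P.Ω p y z) (hT : IsTrace P.Ω y z T)
    (hyY : ∀ᵐ x ∂volume.restrict P.Ω, y x ∈ P.Y) {φ : Vec n × Vec m → ℝ} (hφ : P.IsTest p φ)
    (j : Fin n) :
    ∫ x in P.Ω, (pderiv j (fun a => φ (a, y x)) x + fderiv ℝ (fun b => φ (x, b)) (y x) (z x j))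
      = ∫ x, φ (x, T x) * outerNormal P.Ω x j ∂surf P.Ω := by
  have hφ1 : ContDiff ℝ 1 φ := hφ.smooth.of_le (by norm_cast)
  simp only [← fderiv_prod_apply hφ1]
  by_cases hp' : p = ⊤
  · subst hp'
    exact hT.chain_rule_top hΩ hy hφ1 j
  have := hΩ.isFiniteMeasure_vol
  have := hΩ.isFiniteMeasure_surf
  have hy1 := hy.mono hΩ hp
  have hp0 : p ≠ 0 := (zero_lt_one.trans_le hp).ne'
  obtain ⟨c, hc, hgr⟩ := hφ.growth hp'
  obtain ⟨hyi, hzi⟩ := hy.integrable_rpow hΩ hp hp'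
  have hTp := hT.memLp hΩ hp hp' hy
  set q := p.toReal with hq
  have hq1 : 1 ≤ q := by
    rw [hq, ← ENNReal.toReal_one]; exact ENNReal.toReal_mono hp' hp
  have hφy : AEStronglyMeasurable (fun x => φ (x, y x)) (volume.restrict P.Ω) :=
    hφ1.continuous.comp_aestronglyMeasurable (aestronglyMeasurable_id.prodMk hy.memLp.1)
  have hφT : AEStronglyMeasurable (fun x => φ (x, T x)) (surf P.Ω) :=
    hφ1.continuous.comp_aestronglyMeasurable (aestronglyMeasurable_id.prodMk hT.1.1)
  have hdφ : AEStronglyMeasurable (fun x => fderiv ℝ φ (x, y x)) (volume.restrict P.Ω) :=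
    (hφ1.continuous_fderiv one_ne_zero).comp_aestronglyMeasurable
      (aestronglyMeasurable_id.prodMk hy.memLp.1)
  have hyoung : ∀ x, (1 + ‖y x‖) ^ (q - 1) * ‖z x j‖ ≤ (1 + ‖y x‖) ^ q + ‖z x j‖ ^ q := fun x =>
    rpow_sub_one_mul_le hq1 (by positivity) (norm_nonneg _)
  refine hT.chain_rule hΩ hy1 hφ1 j ?_ ?_ ?_
  · refine ((hyi.const_mul (2 * c)).add ((hyi.add (hzi j)).const_mul (2 * c))).mono'
      ((ContinuousLinearMap.apply ℝ ℝ).flip.aestronglyMeasurable_comp₂ hdφ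
        (aestronglyMeasurable_const.prodMk (hy.memLp_deriv j).1)) ?_
    filter_upwards [hyY, ae_restrict_mem hΩ.isOpen.measurableSet] with x h1 hx
    obtain ⟨g1, g2, -⟩ := hgr x hx (y x) h1
    rw [fderiv_prod_apply hφ1]
    refine (norm_add_le _ _).trans (add_le_add ?_ ?_)
    · have h2 := (fderiv ℝ (fun a => φ (a, y x)) x).le_of_opNorm_le g1 (EuclideanSpace.single j 1)
      rw [PiLp.norm_single, norm_one, mul_one] at h2
      refine h2.trans ?_
      have := one_add_rpow_le (norm_nonneg (y x)) (by linarith : 0 ≤ q)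
      calc _ ≤ c * (2 * (1 + ‖y x‖) ^ q) := by gcongr
        _ = _ := by ring
    · refine ((fderiv ℝ (fun b => φ (x, b)) (y x)).le_of_opNorm_le g2 _).trans ?_
      have := one_add_rpow_le (norm_nonneg (y x)) (by linarith : 0 ≤ q - 1)
      calc _ ≤ c * (2 * (1 + ‖y x‖) ^ (q - 1)) * ‖z x j‖ := by gcongr
        _ = 2 * c * ((1 + ‖y x‖) ^ (q - 1) * ‖z x j‖) := by ring
        _ ≤ _ := mul_le_mul_of_nonneg_left (hyoung x) (by positivity)
  · refine ((hyi.add (hzi j)).const_mul (2 * c)).mono' (hφy.mul ((hy.memLp_deriv j).1.norm.aemeasurable.div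
      (hy.memLp.1.norm.aemeasurable.const_add 1)).aestronglyMeasurable) ?_
    filter_upwards [hyY, ae_restrict_mem hΩ.isOpen.measurableSet] with x h1 hx
    obtain ⟨-, -, g3⟩ := hgr x hx (y x) h1
    have hpos : 0 < 1 + ‖y x‖ := by positivity
    rw [norm_mul, Real.norm_of_nonneg (by positivity : 0 ≤ ‖z x j‖ / (1 + ‖y x‖))]
    have := one_add_rpow_le (norm_nonneg (y x)) (by linarith : 0 ≤ q)
    calc _ ≤ (c * (2 * (1 + ‖y x‖) ^ q)) * (‖z x j‖ / (1 + ‖y x‖)) := by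
          refine mul_le_mul_of_nonneg_right (g3.trans ?_) (by positivity)
          gcongr
      _ = 2 * c * ((1 + ‖y x‖) ^ (q - 1) * ‖z x j‖) := by
          rw [Real.rpow_sub_one hpos.ne']
          field_simp
      _ ≤ _ := mul_le_mul_of_nonneg_left (hyoung x) (by positivity)
  · refine ((((integrable_const 1).add (hTp.integrable_norm_rpow hp0 hp')).const_mul c)).mono' hφT ?_
    filter_upwards [hT.ae_mem_of_isClosed hΩ hy1 hY hyY, ae_surf_mem_closure] with x h1 hx
    -- The growth bound is assumed for `x ∈ Ω` only. With the second argument frozen at the trace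
    -- value, which lies in `Y`, it extends to the closure by continuity.
    have hcl : IsClosed {a | |φ (a, T x)| ≤ c * (1 + ‖T x‖ ^ q)} :=
      isClosed_le ((hφ1.continuous.comp (by fun_prop : Continuous fun a => (a, T x))).abs)
        continuous_const
    exact closure_minimal (fun a ha => (hgr a ha _ h1).2.2) hcl hx

end TestFunctions

/-! ### Extended integrals and push-forward -/

section ExtIntegral

/-- The data are Borel only where they are used. Extension by zero supplies a globally measurable
function with the same integrals over measures carried by `s`. -/
theorem measurable_indicator_of_domRestrict {α : Type*} [MeasurableSpace α] {s : Set α}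
    (hs : MeasurableSet s) {f : α → ℝ} (hf : Measurable (s.domRestrict f)) :
    Measurable (s.indicator f) := by
  refine measurable_of_restrict_of_restrict_compl hs ?_ ?_
  · convert hf using 1
    ext x
    simp
  · convert (measurable_const : Measurable fun _ : (sᶜ : Set α) => (0 : ℝ)) using 1
    ext x
    simpa using fun h => absurd h x.2

theorem extIntegral_congr {α : Type*} [MeasurableSpace α] {μ : Measure α} {f g : α → ℝ}
    (h : f =ᵐ[μ] g) : extIntegral μ f = extIntegral μ g := by
  have h1 : ∫⁻ a, ENNReal.ofReal (f a) ∂μ = ∫⁻ a, ENNReal.ofReal (g a) ∂μ :=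
    lintegral_congr_ae (h.fun_comp ENNReal.ofReal)
  have h2 : ∫⁻ a, ENNReal.ofReal (-f a) ∂μ = ∫⁻ a, ENNReal.ofReal (-g a) ∂μ :=
    lintegral_congr_ae (h.fun_comp fun t => ENNReal.ofReal (-t))
  rw [extIntegral, extIntegral, h1, h2]

theorem extIntegral_map {α β : Type*} [MeasurableSpace α] [MeasurableSpace β] {ν : Measure α}
    {g : α → β} (hg : AEMeasurable g ν) {f : β → ℝ} (hf : AEMeasurable f (ν.map g)) :
    extIntegral (ν.map g) f = extIntegral ν (fun a => f (g a)) := by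
  rw [extIntegral, extIntegral, lintegral_map' hf.ennreal_ofReal hg,
    lintegral_map' (f := fun a => ENNReal.ofReal (-f a)) hf.neg.ennreal_ofReal hg]

theorem extIntegral_map_restrict {α β : Type*} [MeasurableSpace α] [MeasurableSpace β]
    {ν : Measure α} {g : α → β} (hg : AEMeasurable g ν) {s : Set β} (hs : MeasurableSet s)
    (hgs : ∀ᵐ a ∂ν, g a ∈ s) {f : β → ℝ} (hf : Measurable (s.domRestrict f)) :
    extIntegral ((ν.map g).restrict s) f = extIntegral ν (fun a => f (g a)) := by
  have hmem : ∀ᵐ b ∂ν.map g, b ∈ s := (ae_map_iff hg hs).2 hgs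
  have hf' := measurable_indicator_of_domRestrict hs hf
  rw [Measure.restrict_eq_self_of_ae_mem hmem]
  have h1 : f =ᵐ[ν.map g] s.indicator f := by
    filter_upwards [hmem] with b hb
    rw [indicator_of_mem hb]
  exact extIntegral_map hg ⟨_, hf', h1⟩

end ExtIntegral

/-! ### Occupation measures of admissible functions: constraints -/

section OccupationOfFunction

variable {n m : ℕ} {I : Type*} {P : Problem n m I} {y : Vec n → Vec m} {z : Vec n → Jac n m}
  {T : Vec n → Vec m} {p : ℝ≥0∞}

theorem Problem.measurableSet_bulk (hΩ : IsLipschitzDomain P.Ω) (hc : P.IsConvex) :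
    MeasurableSet P.bulk :=
  hΩ.isOpen.measurableSet.prod (hc.Y_closed.measurableSet.prod hc.Z_closed.measurableSet)

theorem Problem.isClosed_bdry (hc : P.IsConvex) : IsClosed P.bdry :=
  isClosed_frontier.prod hc.Y_closed

theorem IsSobolev.aemeasurable_graph {Ω : Set (Vec n)} (hy : IsSobolev Ω p y z) :
    AEMeasurable (fun x => (x, y x, z x)) (volume.restrict Ω) :=
  aemeasurable_id.prodMk (hy.memLp.1.aemeasurable.prodMk
    (aemeasurable_pi_iff.2 fun j => (hy.memLp_deriv j).1.aemeasurable))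

theorem IsTrace.aemeasurable_graph {Ω : Set (Vec n)} (hT : IsTrace Ω y z T) :
    AEMeasurable (fun x => (x, T x)) (surf Ω) :=
  aemeasurable_id.prodMk hT.1.1.aemeasurable

theorem ae_surf_mem_frontier {Ω : Set (Vec n)} : ∀ᵐ x ∂surf Ω, x ∈ frontier Ω :=
  ae_restrict_mem isClosed_frontier.measurableSet

variable (P y z T) in
/-- The occupation measure of a function. -/
def occ : Measure (Vec n × Vec m × Jac n m) := (volume.restrict P.Ω).map fun x => (x, y x, z x)

variable (P T) in
/-- The boundary occupation measure of a function. -/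
def bdryOcc : Measure (Vec n × Vec m) := (surf P.Ω).map fun x => (x, T x)

theorem Problem.IsAdmissible.ae_mem_bulk (hΩ : IsLipschitzDomain P.Ω)
    (h : P.IsAdmissible p y z T) : ∀ᵐ x ∂volume.restrict P.Ω, (x, y x, z x) ∈ P.bulk := by
  filter_upwards [h.mem_Y, h.mem_Z, ae_restrict_mem hΩ.isOpen.measurableSet] with x h1 h2 h3
    using ⟨h3, h1, h2⟩

theorem Problem.IsAdmissible.ae_mem_bdry (hΩ : IsLipschitzDomain P.Ω) (hc : P.IsConvex)
    (hp : 1 ≤ p) (h : P.IsAdmissible p y z T) : ∀ᵐ x ∂surf P.Ω, (x, T x) ∈ P.bdry := by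
  filter_upwards [h.trace.ae_mem_of_isClosed hΩ (h.sobolev.mono hΩ hp) hc.Y_closed h.mem_Y,
    ae_surf_mem_frontier] with x h1 h2 using ⟨h2, h1⟩

theorem Problem.IsAdmissible.ae_occ_mem_bulk (hΩ : IsLipschitzDomain P.Ω) (hc : P.IsConvex)
    (h : P.IsAdmissible p y z T) : ∀ᵐ w ∂occ P y z, w ∈ P.bulk :=
  (ae_map_iff h.sobolev.aemeasurable_graph (P.measurableSet_bulk hΩ hc)).2 (h.ae_mem_bulk hΩ)

theorem Problem.IsAdmissible.ae_bdryOcc_mem_bdry (hΩ : IsLipschitzDomain P.Ω) (hc : P.IsConvex)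
    (hp : 1 ≤ p) (h : P.IsAdmissible p y z T) : ∀ᵐ w ∂bdryOcc P T, w ∈ P.bdry :=
  (ae_map_iff h.trace.aemeasurable_graph (P.isClosed_bdry hc).measurableSet).2
    (h.ae_mem_bdry hΩ hc hp)

/-- Almost everywhere constraints place the support in the closure of the constraint set, and
relative closedness removes the closure. On the boundary the whole support lies in the closed set
`P.bdry`. In the bulk the support may touch `∂Ω`, so only its part in `P.bulk` is considered. -/
theorem Problem.IsAdmissible.isFeasible (hΩ : IsLipschitzDomain P.Ω) (hr : P.IsRegular)
    (hc : P.IsConvex) (hp : 1 ≤ p) (h : P.IsAdmissible p y z T) :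
    P.IsFeasible (occ P y z) (bdryOcc P T) := by
  have hg := h.sobolev.aemeasurable_graph
  have hg' := h.trace.aemeasurable_graph
  have hb := h.ae_mem_bulk hΩ
  have hb' := h.ae_mem_bdry hΩ hc hp
  have hm := P.measurableSet_bulk hΩ hc
  have hcl := P.isClosed_bdry hc
  refine ⟨?_, fun i => ?_, fun i => ?_, fun i => ?_, fun i => ?_⟩
  · exact mem_ae_iff.1 (h.ae_occ_mem_bulk hΩ hc)
  · have h1 : (occ P y z).support ⊆ closure (P.bulkSet i) := by
      refine Measure.support_subset_of_isClosed isClosed_closure ?_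
      refine (ae_map_iff hg isClosed_closure.measurableSet).2 ?_
      filter_upwards [hb, h.bulk_constr i] with x h1 h2 using subset_closure ⟨h1, h2⟩
    exact (inter_subset_inter_left _ h1).trans (hr.closed i)
  · have h1 : (bdryOcc P T).support ⊆ closure (P.bdrySet i) := by
      refine Measure.support_subset_of_isClosed isClosed_closure ?_
      refine (ae_map_iff hg' isClosed_closure.measurableSet).2 ?_
      filter_upwards [hb', h.bdry_constr i] with x h1 h2 using subset_closure ⟨h1, h2⟩
    have h2 : (bdryOcc P T).support ⊆ P.bdry :=
      Measure.support_subset_of_isClosed hcl (h.ae_bdryOcc_mem_bdry hΩ hc hp)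
    exact (subset_inter h1 h2).trans (hr.closed' i)
  · rw [occ, extIntegral_map_restrict hg hm hb (hr.C_meas i)]
    exact h.bulk_int i
  · rw [bdryOcc, extIntegral_map_restrict hg' hcl.measurableSet hb' (hr.C'_meas i)]
    exact h.bdry_int i

theorem Problem.IsAdmissible.bulk_integral_eq (hΩ : IsLipschitzDomain P.Ω) (hc : P.IsConvex)
    (h : P.IsAdmissible p y z T) {f : Vec n × Vec m × Jac n m → ℝ} (hf : Continuous f) :
    ∫ w in P.bulk, f w ∂occ P y z = ∫ x in P.Ω, f (x, y x, z x) := by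
  have hg := h.sobolev.aemeasurable_graph
  rw [Measure.restrict_eq_self_of_ae_mem (h.ae_occ_mem_bulk hΩ hc), occ,
    integral_map hg hf.aestronglyMeasurable]

theorem Problem.IsAdmissible.bdry_integral_eq (hΩ : IsLipschitzDomain P.Ω) (hc : P.IsConvex)
    (hp : 1 ≤ p) (h : P.IsAdmissible p y z T) {f : Vec n × Vec m → ℝ} (hf : Continuous f)
    (j : Fin n) :
    ∫ w in P.bdry, f w * outerNormal P.Ω w.1 j ∂bdryOcc P T
      = ∫ x, f (x, T x) * outerNormal P.Ω x j ∂surf P.Ω := by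
  have hg := h.trace.aemeasurable_graph
  have hfst : (bdryOcc P T).map Prod.fst = surf P.Ω := by
    rw [bdryOcc, AEMeasurable.map_map_of_aemeasurable measurable_fst.aemeasurable hg]
    exact Measure.map_id
  have hN : AEStronglyMeasurable (fun w : Vec n × Vec m => outerNormal P.Ω w.1)
      (bdryOcc P T) :=
    (hfst.symm ▸ hΩ.aestronglyMeasurable_normal).comp_measurable measurable_fst
  rw [Measure.restrict_eq_self_of_ae_mem (h.ae_bdryOcc_mem_bdry hΩ hc hp), bdryOcc,
    integral_map hg]
  exact hf.aestronglyMeasurable.mul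
    ((EuclideanSpace.proj (𝕜 := ℝ) j).continuous.comp_aestronglyMeasurable hN)

end OccupationOfFunction

/-! ### Occupation measures of admissible functions: moments and Liouville equations -/

section OccupationIsOcc

variable {n m : ℕ} {I : Type*} {P : Problem n m I} {y : Vec n → Vec m} {z : Vec n → Jac n m}
  {T : Vec n → Vec m} {p : ℝ≥0∞}

theorem isCompact_support_of_ae_mem {X : Type*} [TopologicalSpace X] [T2Space X]
    [MeasurableSpace X] {μ : Measure X} {K : Set X} (hK : IsCompact K) (h : ∀ᵐ x ∂μ, x ∈ K) :
    IsCompact μ.support :=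
  hK.of_isClosed_subset Measure.isClosed_support
    (Measure.support_subset_of_isClosed hK.isClosed h)

theorem exists_ae_mem_closedBall {α : Type*} [MeasurableSpace α] {μ : Measure α} {f : α → Vec m}
    (hf : MemLp f ⊤ μ) : ∃ R : ℝ, ∀ᵐ x ∂μ, f x ∈ Metric.closedBall (0 : Vec m) R := by
  refine ⟨lpNorm f ⊤ μ, ?_⟩
  filter_upwards [ae_le_lpNorm_exponent_top hf] with x hx
  simpa using hx

theorem Problem.IsAdmissible.isCompact_support (hΩ : IsLipschitzDomain P.Ω)
    (h : P.IsAdmissible ⊤ y z T) :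
    IsCompact (occ P y z).support ∧ IsCompact (bdryOcc P T).support := by
  have hg := h.sobolev.aemeasurable_graph
  have hg' := h.trace.aemeasurable_graph
  obtain ⟨R, hR⟩ := exists_ae_mem_closedBall h.sobolev.memLp
  choose S hS using fun j => exists_ae_mem_closedBall (h.sobolev.memLp_deriv j)
  constructor
  · have hK : IsCompact (closure P.Ω ×ˢ Metric.closedBall (0 : Vec m) R ×ˢ
        Set.univ.pi fun j => Metric.closedBall (0 : Vec m) (S j)) :=
      hΩ.isBounded.isCompact_closure.prod ((isCompact_closedBall _ _).prod
        (isCompact_univ_pi fun j => isCompact_closedBall _ _))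
    refine isCompact_support_of_ae_mem hK ((ae_map_iff hg hK.measurableSet).2 ?_)
    filter_upwards [hR, ae_all_iff.2 hS, ae_restrict_mem hΩ.isOpen.measurableSet] with x h1 h2 h3
      using ⟨subset_closure h3, h1, fun j _ => h2 j⟩
  · have hK : IsCompact (closure P.Ω ×ˢ Metric.closedBall (0 : Vec m) R) :=
      hΩ.isBounded.isCompact_closure.prod (isCompact_closedBall _ _)
    refine isCompact_support_of_ae_mem hK ((ae_map_iff hg' hK.measurableSet).2 ?_)
    filter_upwards [h.trace.ae_mem_of_isClosed hΩ (h.sobolev.mono hΩ (q := 1) le_top)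
      Metric.isClosed_closedBall hR, ae_surf_mem_closure] with x h1 h3 using ⟨h3, h1⟩

theorem Problem.IsAdmissible.moment (hΩ : IsLipschitzDomain P.Ω) (hp : 1 ≤ p) (hp' : p ≠ ⊤)
    (h : P.IsAdmissible p y z T) :
    ∫⁻ w, (‖w.2.1‖ₑ ^ p.toReal + ∑ j, ‖w.2.2 j‖ₑ ^ p.toReal) ∂occ P y z < ⊤ ∧
    ∫⁻ w, ‖w.2‖ₑ ^ p.toReal ∂bdryOcc P T < ⊤ := by
  have hp0 : p ≠ 0 := (zero_lt_one.trans_le hp).ne'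
  have hL : ∀ {α : Type} [MeasurableSpace α] {μ : Measure α} {f : α → Vec m}, MemLp f p μ →
      ∫⁻ x, ‖f x‖ₑ ^ p.toReal ∂μ < ⊤ := fun hf =>
    (eLpNorm_lt_top_iff_lintegral_rpow_enorm_lt_top hp0 hp').1 hf.2
  constructor
  · rw [occ, lintegral_map' (by fun_prop) h.sobolev.aemeasurable_graph]
    have hm : ∀ j, AEMeasurable (fun x => ‖z x j‖ₑ ^ p.toReal) (volume.restrict P.Ω) := fun j =>
      ((h.sobolev.memLp_deriv j).1.enorm).pow_const _
    rw [lintegral_add_left' ((h.sobolev.memLp.1.enorm).pow_const _),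
      lintegral_finsetSum' _ fun j _ => hm j]
    exact ENNReal.add_lt_top.2 ⟨hL h.sobolev.memLp,
      ENNReal.sum_lt_top.2 fun j _ => hL (h.sobolev.memLp_deriv j)⟩
  · rw [bdryOcc, lintegral_map' (by fun_prop) h.trace.aemeasurable_graph]
    exact hL (h.trace.memLp hΩ hp hp' h.sobolev)

theorem Problem.IsAdmissible.liouville (hΩ : IsLipschitzDomain P.Ω) (hp : 1 ≤ p)
    (h : P.IsAdmissible p y z T) {φ₁ : Vec n → ℝ} {φ₂ : Vec n → Vec m} (h₁ : ContDiff ℝ ∞ φ₁)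
    (h₂ : ContDiff ℝ ∞ φ₂) (j : Fin n) :
    ∫ x in P.Ω, (pderiv j φ₁ x + inner ℝ (y x) (pderiv j φ₂ x) + inner ℝ (φ₂ x) (z x j))
      = ∫ x, (φ₁ x + inner ℝ (T x) (φ₂ x)) * outerNormal P.Ω x j ∂surf P.Ω := by
  have hy1 := h.sobolev.mono hΩ hp
  have h₁' : ContDiff ℝ 1 φ₁ := h₁.of_le (by norm_cast)
  have h₂' : ContDiff ℝ 1 φ₂ := h₂.of_le (by norm_cast)
  have e1 := hΩ.integral_pderiv h₁' j
  have e2 := h.trace.integral_eq hΩ hy1 h₂ j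
  have hb : ∀ (μ : Measure (Vec n)) (f g : Vec n → Vec m), Integrable f μ → Continuous g →
      (∀ᵐ x ∂μ, x ∈ closure P.Ω) → Integrable (fun x => (inner ℝ (f x) (g x) : ℝ)) μ := by
    intro μ f g hf hg hμ
    obtain ⟨C, hC0, hC⟩ := exists_forall_closure_norm_le hΩ hg
    refine (hf.norm.mul_const C).mono' (hf.1.inner hg.aestronglyMeasurable) ?_
    filter_upwards [hμ] with x hx
    exact (norm_inner_le_norm _ _).trans (mul_le_mul_of_nonneg_left (hC x hx) (norm_nonneg _))
  have hcl : ∀ᵐ x ∂volume.restrict P.Ω, x ∈ closure P.Ω := by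
    filter_upwards [ae_restrict_mem hΩ.isOpen.measurableSet] with x hx using subset_closure hx
  have i1 := hb _ _ _ (memLp_one_iff_integrable.1 hy1.memLp) (continuous_pderiv h₂' j) hcl
  have i2 := hb _ _ _ (memLp_one_iff_integrable.1 (hy1.memLp_deriv j)) h₂.continuous hcl
  have i3 := hb _ _ _ (memLp_one_iff_integrable.1 h.trace.1) h₂.continuous ae_surf_mem_closure
  have e3 : ∫ x in P.Ω, (pderiv j φ₁ x + inner ℝ (y x) (pderiv j φ₂ x) + inner ℝ (φ₂ x) (z x j))
      = (∫ x in P.Ω, pderiv j φ₁ x)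
        + ∫ x in P.Ω, (inner ℝ (y x) (pderiv j φ₂ x) + inner ℝ (z x j) (φ₂ x)) := by
    refine Eq.trans ?_ (integral_add (hΩ.integrable_vol (continuous_pderiv h₁' j)) (i1.add i2))
    congr 1
    ext1 x
    rw [add_assoc, real_inner_comm (φ₂ x)]
  rw [e3, e1, e2, ← integral_add
    (hΩ.integrable_mul_normal_apply (hΩ.integrable_surf h₁.continuous) j)
    (hΩ.integrable_mul_normal_apply i3 j)]
  congr 1
  ext1 x
  ring

theorem Problem.IsAdmissible.isOcc (hΩ : IsLipschitzDomain P.Ω) (hc : P.IsConvex) (hp : 1 ≤ p)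
    (h : P.IsAdmissible p y z T) : P.IsOcc p (occ P y z) (bdryOcc P T) := by
  have hg := h.sobolev.aemeasurable_graph
  have hg' := h.trace.aemeasurable_graph
  have := hΩ.isFiniteMeasure_vol
  have := hΩ.isFiniteMeasure_surf
  have hf : IsFiniteMeasure (occ P y z) := by rw [occ]; infer_instance
  have hf' : IsFiniteMeasure (bdryOcc P T) := by rw [bdryOcc]; infer_instance
  have hb := h.ae_occ_mem_bulk hΩ hc
  have hb' := h.ae_bdryOcc_mem_bdry hΩ hc hp
  have hcl : ∀ᵐ w ∂occ P y z, w ∈ closure P.Ω ×ˢ P.Y ×ˢ P.Z := by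
    filter_upwards [hb] with w hw using ⟨subset_closure hw.1, hw.2⟩
  have hfst : Measure.QuasiMeasurePreserving Prod.fst (bdryOcc P T) (surf P.Ω) := by
    refine ⟨measurable_fst, ?_⟩
    rw [bdryOcc, AEMeasurable.map_map_of_aemeasurable measurable_fst.aemeasurable hg']
    exact (Measure.map_id (μ := surf P.Ω)).absolutelyContinuous
  refine ⟨⟨inferInstance, inferInstance, mem_ae_iff.1 hcl, mem_ae_iff.1 hb', ?_, ?_, ?_,
    hfst.ae hΩ.ae_normal, ?_⟩, ?_⟩
  · have hu : closure P.Ω ×ˢ P.Y ×ˢ P.Z =ᵐ[occ P y z] univ := eventuallyEq_univ.2 hcl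
    rw [measure_congr hu, occ, Measure.map_apply_of_aemeasurable hg MeasurableSet.univ]
    simp
  · rintro rfl
    exact h.isCompact_support hΩ
  · intro hp'
    rw [Measure.restrict_eq_self_of_ae_mem hb, Measure.restrict_eq_self_of_ae_mem hb']
    exact h.moment hΩ hp hp'
  · intro φ₁ φ₂ h₁ h₂ j
    have c₁ : Continuous (pderiv j φ₁) := continuous_pderiv (h₁.of_le (by norm_cast)) j
    have c₂ : Continuous (pderiv j φ₂) := continuous_pderiv (h₂.of_le (by norm_cast)) j
    have c₃ := h₁.continuous
    have c₄ := h₂.continuous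
    rw [h.bulk_integral_eq hΩ hc (f := fun w => pderiv j φ₁ w.1 + inner ℝ w.2.1 (pderiv j φ₂ w.1)
        + inner ℝ (φ₂ w.1) (w.2.2 j)) (by fun_prop),
      h.bdry_integral_eq hΩ hc hp (f := fun w => φ₁ w.1 + inner ℝ w.2 (φ₂ w.1)) (by fun_prop)]
    exact h.liouville hΩ hp h₁ h₂ j
  · intro φ hφ j
    have hφ1 : ContDiff ℝ 1 φ := hφ.smooth.of_le (by norm_cast)
    have hd := hφ1.continuous_fderiv one_ne_zero
    rw [h.bulk_integral_eq hΩ hc (f := fun w => pderiv j (fun a => φ (a, w.2.1)) w.1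
        + fderiv ℝ (fun b => φ (w.1, b)) w.2.1 (w.2.2 j)) ?_,
      h.bdry_integral_eq hΩ hc hp hφ1.continuous]
    · exact hφ.chain_rule hΩ hp hc.Y_closed h.sobolev h.trace h.mem_Y j
    · simp only [← fderiv_prod_apply hφ1]
      exact (hd.comp (by fun_prop)).clm_apply (by fun_prop)

theorem Problem.Mr_le_M (hΩ : IsLipschitzDomain P.Ω) (hr : P.IsRegular) (hc : P.IsConvex)
    (hp : 1 ≤ p) : P.Mr p ≤ P.M p := by
  refine le_sInf ?_
  rintro _ ⟨y, z, T, h, rfl⟩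
  refine sInf_le ⟨occ P y z, bdryOcc P T, h.isOcc hΩ hc hp, h.isFeasible hΩ hr hc hp, ?_⟩
  rw [occ, extIntegral_map_restrict h.sobolev.aemeasurable_graph (P.measurableSet_bulk hΩ hc)
    (h.ae_mem_bulk hΩ) hr.L_meas]

theorem Problem.MrAff_le_Mr : P.MrAff p ≤ P.Mr p := by
  refine sInf_le_sInf ?_
  rintro _ ⟨μ, μ', h, hf, rfl⟩
  exact ⟨μ, μ', h.toIsAffOcc, hf, rfl⟩

end OccupationIsOcc

/-! ### Barycentres and Jensen's inequality in finite dimension -/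

section Barycenter

/-- A point outside a convex set of a finite-dimensional space can be weakly separated from it. -/
theorem exists_dual_nonneg_of_zero_notMem {V : Type*} [NormedAddCommGroup V] [NormedSpace ℝ V]
    [FiniteDimensional ℝ V] [Nontrivial V] {C : Set V} (hC : Convex ℝ C) (h0 : (0 : V) ∉ C) :
    ∃ ℓ : V →ₗ[ℝ] ℝ, ℓ ≠ 0 ∧ ∀ x ∈ C, 0 ≤ ℓ x := by
  by_cases hint : (interior C).Nonempty
  · obtain ⟨g, hg⟩ := geometric_hahn_banach_open_point hC.interior isOpen_interior
      fun h => h0 (interior_subset h)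
    obtain ⟨c, hc⟩ := hint
    refine ⟨-g.toLinearMap, fun h => ?_, fun x hx => ?_⟩
    · have h1 := hg c hc
      have h2 : -(g c) = 0 := LinearMap.congr_fun h c
      rw [map_zero] at h1
      linarith
    · have hcl : closure (interior C) ⊆ {x | g x ≤ 0} :=
        closure_minimal (fun x hx => by simpa using (hg x hx).le)
          (isClosed_le g.continuous continuous_const)
      have hx' : x ∈ closure (interior C) := by
        rw [hC.closure_interior_eq_closure_of_nonempty_interior ⟨c, hc⟩]
        exact subset_closure hx
      have h1 : g x ≤ 0 := hcl hx'
      change 0 ≤ -(g x)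
      linarith
  -- Without interior points `C` lies in a proper affine subspace, and a nonzero functional that is
  -- constant on it, with the right sign, will do.
  · rw [hC.interior_nonempty_iff_affineSpan_eq_top] at hint
    rcases C.eq_empty_or_nonempty with rfl | ⟨c, hc⟩
    · obtain ⟨ℓ, hℓ0, -⟩ := Submodule.exists_le_ker_of_lt_top (⊥ : Submodule ℝ V) bot_lt_top
      exact ⟨ℓ, hℓ0, fun x hx => absurd hx (notMem_empty x)⟩
    · have hne : (affineSpan ℝ C : Set V).Nonempty := ⟨c, subset_affineSpan ℝ C hc⟩
      have hD : (affineSpan ℝ C).direction < ⊤ := by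
        rw [lt_top_iff_ne_top]
        exact fun h => hint ((AffineSubspace.direction_eq_top_iff_of_nonempty hne).1 h)
      obtain ⟨ℓ, hℓ0, hℓ⟩ := Submodule.exists_le_ker_of_lt_top _ hD
      have hconst : ∀ x ∈ C, ℓ x = ℓ c := by
        intro x hx
        have : x -ᵥ c ∈ (affineSpan ℝ C).direction :=
          AffineSubspace.vsub_mem_direction (subset_affineSpan ℝ C hx) (subset_affineSpan ℝ C hc)
        have h1 : ℓ (x - c) = 0 := hℓ this
        rw [map_sub] at h1
        linarith
      rcases le_total 0 (ℓ c) with h | h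
      · exact ⟨ℓ, hℓ0, fun x hx => by rw [hconst x hx]; exact h⟩
      · refine ⟨-ℓ, neg_ne_zero.2 hℓ0, fun x hx => ?_⟩
        rw [LinearMap.neg_apply, hconst x hx]
        linarith

/-- The mean of a random vector of a finite-dimensional space with values in a convex set, which
need not be closed, belongs to this set. -/
theorem Convex.integral_mem_of_finiteDimensional {α E : Type*} [MeasurableSpace α]
    {μ : Measure α} [IsProbabilityMeasure μ] [NormedAddCommGroup E] [NormedSpace ℝ E]
    [FiniteDimensional ℝ E] {C : Set E} (hC : Convex ℝ C) {f : α → E}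
    (hf : ∀ᵐ a ∂μ, f a ∈ C) (hfi : Integrable f μ) : ∫ a, f a ∂μ ∈ C := by
  by_contra hb
  set b := ∫ a, f a ∂μ with hbdef
  -- Descent on the dimension of a subspace containing `f - b` almost surely. If `b ∉ C`, a
  -- supporting functional is nonnegative on `f - b` and has zero mean, so it vanishes almost surely
  -- and the subspace shrinks. In the trivial subspace `f = b` almost surely, which contradicts `b ∉
  -- C`.
  have claim : ∀ k : ℕ, ∀ W : Submodule ℝ E, Module.finrank ℝ W = k →
      ¬ ∀ᵐ a ∂μ, f a - b ∈ W := by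
    intro k
    induction k using Nat.strong_induction_on with
    | _ k ih =>
      intro W hk hW
      rcases subsingleton_or_nontrivial W with hs | hs
      · obtain ⟨a, h1, h2⟩ := (hf.and hW).exists
        have h3 : (⟨f a - b, h2⟩ : W) = 0 := Subsingleton.elim _ _
        have h4 : f a - b = 0 := congrArg Subtype.val h3
        exact hb (sub_eq_zero.1 h4 ▸ h1)
      · have hCW : Convex ℝ {w : W | b + (w : E) ∈ C} :=
          (hC.translate_preimage_right b).linear_preimage W.subtype
        obtain ⟨ℓ, hℓ0, hℓ⟩ := exists_dual_nonneg_of_zero_notMem hCW (by simpa using hb)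
        obtain ⟨g, hg⟩ := ℓ.exists_extend
        have hgw : ∀ w : W, g w = ℓ w := fun w => LinearMap.congr_fun hg w
        have hge : ∀ᵐ a ∂μ, 0 ≤ g (f a - b) := by
          filter_upwards [hf, hW] with a h1 h2
          have := hℓ ⟨f a - b, h2⟩ (by simpa using h1)
          rwa [← hgw] at this
        have hgi : Integrable (fun a => g (f a - b)) μ :=
          (LinearMap.toContinuousLinearMap g).integrable_comp (hfi.sub (integrable_const b))
        have hg0 : ∫ a, g (f a - b) ∂μ = 0 := by
          have := (LinearMap.toContinuousLinearMap g).integral_comp_comm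
            (hfi.sub (integrable_const b))
          simp only [Pi.sub_apply, LinearMap.coe_toContinuousLinearMap'] at this
          rw [this, integral_sub hfi (integrable_const b)]
          simp [← hbdef]
        have hgz := (integral_eq_zero_iff_of_nonneg_ae hge hgi).1 hg0
        have hlt : W ⊓ LinearMap.ker g < W := by
          refine lt_of_le_of_ne inf_le_left fun h => hℓ0 ?_
          ext w
          have : (w : E) ∈ W ⊓ LinearMap.ker g := h.symm ▸ w.2
          rw [← hgw]
          exact this.2
        refine ih _ (hk ▸ Submodule.finrank_lt_finrank_of_lt hlt) _ rfl ?_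
        filter_upwards [hW, hgz] with a h1 h2 using ⟨h1, h2⟩
  exact claim _ ⊤ rfl (ae_of_all _ fun a => Submodule.mem_top)

/-- Jensen's inequality for convex functions on a convex set of a finite-dimensional space. Neither
continuity of the function nor closedness of the set are needed. -/
theorem ConvexOn.map_integral_le_of_finiteDimensional {α E : Type*} [MeasurableSpace α]
    {μ : Measure α} [IsProbabilityMeasure μ] [NormedAddCommGroup E] [NormedSpace ℝ E]
    [FiniteDimensional ℝ E] {C : Set E} {g : E → ℝ} (hg : ConvexOn ℝ C g) {f : α → E}
    (hf : ∀ᵐ a ∂μ, f a ∈ C) (hfi : Integrable f μ) (hgi : Integrable (fun a => g (f a)) μ) :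
    g (∫ a, f a ∂μ) ≤ ∫ a, g (f a) ∂μ := by
  -- The mean of `(f, g ∘ f)` lies in the epigraph of `g`, which is convex but not necessarily
  -- closed.
  have h := Convex.integral_mem_of_finiteDimensional hg.convex_epigraph
    (f := fun a => (f a, g (f a))) (by filter_upwards [hf] with a ha using ⟨ha, le_rfl⟩)
    (hfi.prodMk hgi)
  rw [integral_pair hfi hgi] at h
  exact h.2

/-- Jensen's inequality in terms of positive and negative parts. -/
theorem ConvexOn.lintegral_jensen {α E : Type*} [MeasurableSpace α]
    {μ : Measure α} [IsProbabilityMeasure μ] [NormedAddCommGroup E] [NormedSpace ℝ E]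
    [FiniteDimensional ℝ E] {C : Set E} {g : E → ℝ} (hg : ConvexOn ℝ C g) {f : α → E}
    (hf : ∀ᵐ a ∂μ, f a ∈ C) (hfi : Integrable f μ) (hgm : AEMeasurable (fun a => g (f a)) μ)
    (hgp : ∫⁻ a, ENNReal.ofReal (g (f a)) ∂μ ≠ ⊤) :
    ENNReal.ofReal (g (∫ a, f a ∂μ)) + ∫⁻ a, ENNReal.ofReal (-g (f a)) ∂μ
      ≤ ENNReal.ofReal (-g (∫ a, f a ∂μ)) + ∫⁻ a, ENNReal.ofReal (g (f a)) ∂μ := by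
  set b := ∫ a, f a ∂μ
  have hpi : Integrable (fun a => max (g (f a)) 0) μ := by
    refine ⟨(hgm.max aemeasurable_const).aestronglyMeasurable, ?_⟩
    rw [hasFiniteIntegral_iff_ofReal (f := fun a => max (g (f a)) 0) (ae_of_all _ fun a => le_max_right _ _)]
    refine lt_of_le_of_lt (le_of_eq ?_) (lt_top_iff_ne_top.2 hgp)
    refine lintegral_congr fun a => ?_
    rw [ENNReal.ofReal_max]; simp
  -- The negative part of `g ∘ f` need not be integrable. Truncating `g` from below at `-k` keeps it
  -- convex and makes it integrable, and `k` tends to infinity by monotone convergence. Writing all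
  -- terms as sums avoids `∞ - ∞`.
  have key : ∀ k : ℕ, ENNReal.ofReal (g b) + ∫⁻ a, ENNReal.ofReal (min (-g (f a)) k) ∂μ
      ≤ ENNReal.ofReal (-g b) + ∫⁻ a, ENNReal.ofReal (g (f a)) ∂μ := by
    intro k
    have hk0 : (0 : ℝ) ≤ k := k.cast_nonneg
    have hmi : Integrable (fun a => max (min (-g (f a)) k) 0) μ := by
      refine (integrable_const (k : ℝ)).mono'
        (((hgm.neg.min aemeasurable_const).max aemeasurable_const).aestronglyMeasurable)
        (ae_of_all _ fun a => ?_)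
      rw [Real.norm_of_nonneg (le_max_right _ _)]
      exact max_le (min_le_right _ _) hk0
    have hti : ∀ a, max (g (f a)) (-k) = max (g (f a)) 0 - max (min (-g (f a)) k) 0 := by
      intro a
      rcases le_total (g (f a)) 0 with h1 | h1
      · rw [max_eq_right h1, max_eq_left (le_min (by linarith) hk0), zero_sub, ← max_neg_neg,
          neg_neg]
      · rw [max_eq_left h1, max_eq_left (by linarith), max_eq_right (min_le_of_left_le (by linarith))]
        simp
    have hconv : ConvexOn ℝ C fun x => max (g x) (-k : ℝ) := hg.sup (convexOn_const _ hg.1)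
    have hint : Integrable (fun a => max (g (f a)) (-k : ℝ)) μ := by
      simp only [hti]
      exact hpi.sub hmi
    have h1 := ConvexOn.map_integral_le_of_finiteDimensional hconv hf hfi hint
    simp only [hti] at h1
    rw [integral_sub hpi hmi] at h1
    have h2 : g b ≤ max (g b) (-k) := le_max_left _ _
    have hti' : max (g b) (-k : ℝ) ≤ ∫ a, max (g (f a)) 0 ∂μ - ∫ a, max (min (-g (f a)) k) 0 ∂μ := h1
    have e1 : ENNReal.ofReal (∫ a, max (g (f a)) 0 ∂μ) = ∫⁻ a, ENNReal.ofReal (g (f a)) ∂μ := by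
      rw [ofReal_integral_eq_lintegral_ofReal hpi (ae_of_all _ fun a => le_max_right _ _)]
      refine lintegral_congr fun a => ?_
      rw [ENNReal.ofReal_max]; simp
    have e2 : ENNReal.ofReal (∫ a, max (min (-g (f a)) k) 0 ∂μ)
        = ∫⁻ a, ENNReal.ofReal (min (-g (f a)) k) ∂μ := by
      rw [ofReal_integral_eq_lintegral_ofReal hmi (ae_of_all _ fun a => le_max_right _ _)]
      refine lintegral_congr fun a => ?_
      rw [ENNReal.ofReal_max]; simp
    have p1 : 0 ≤ ∫ a, max (g (f a)) 0 ∂μ := integral_nonneg fun a => le_max_right _ _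
    have p2 : 0 ≤ ∫ a, max (min (-g (f a)) k) 0 ∂μ := integral_nonneg fun a => le_max_right _ _
    rw [← e1, ← e2]
    rcases le_total 0 (g b) with h | h
    · rw [← ENNReal.ofReal_add h p2, ENNReal.ofReal_of_nonpos (by linarith : -g b ≤ 0), zero_add]
      exact ENNReal.ofReal_le_ofReal (by linarith)
    · rw [← ENNReal.ofReal_add (by linarith) p1, ENNReal.ofReal_of_nonpos h, zero_add]
      exact ENNReal.ofReal_le_ofReal (by linarith)
  have hlim : ∫⁻ a, ENNReal.ofReal (-g (f a)) ∂μ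
      ≤ ⨆ k : ℕ, ∫⁻ a, ENNReal.ofReal (min (-g (f a)) k) ∂μ := by
    rw [← lintegral_iSup' (f := fun (k : ℕ) a => ENNReal.ofReal (min (-g (f a)) k))
      (fun k => (hgm.neg.min aemeasurable_const).ennreal_ofReal)
      (ae_of_all _ fun a i j hij => ENNReal.ofReal_le_ofReal
        (min_le_min le_rfl (by exact_mod_cast hij)))]
    refine lintegral_mono fun a => ?_
    obtain ⟨k, hk⟩ := exists_nat_ge (-g (f a))
    refine le_trans (le_of_eq ?_) (le_iSup _ k)
    rw [min_eq_left hk]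
  calc _ ≤ ENNReal.ofReal (g b) + ⨆ k : ℕ, ∫⁻ a, ENNReal.ofReal (min (-g (f a)) k) ∂μ := by gcongr
    _ ≤ _ := by
        rw [ENNReal.add_iSup]
        exact iSup_le key

end Barycenter

/-! ### Measures with vanishing distributional gradient -/

section SmoothTests

variable {n : ℕ}

/-- Finite measures are equal on an open set if, weighted by functions without common zeros, they
agree on smooth functions with compact support in this set. -/
theorem restrict_eq_of_integral_contDiff_eq {ι : Type*} [Countable ι] {a b : Measure (Vec n)}
    [IsFiniteMeasure a] [IsFiniteMeasure b] {f : ι → Vec n → ℝ}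
    (hfa : ∀ i, Integrable (f i) a) (hfb : ∀ i, Integrable (f i) b)
    (hna : ∀ᵐ x ∂a, ∃ i, f i x ≠ 0) (hnb : ∀ᵐ x ∂b, ∃ i, f i x ≠ 0) {U : Set (Vec n)}
    (hU : IsOpen U)
    (h : ∀ φ : Vec n → ℝ, ContDiff ℝ ∞ φ → HasCompactSupport φ → tsupport φ ⊆ U →
      ∀ i, ∫ x, φ x * f i x ∂a = ∫ x, φ x * f i x ∂b) :
    a.restrict U = b.restrict U := by
  have hac : a ≪ a + b := Measure.AbsolutelyContinuous.rfl.add_right b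
  have hbc : b ≪ a + b := by
    rw [add_comm]; exact Measure.AbsolutelyContinuous.rfl.add_right a
  have := Measure.haveLebesgueDecomposition_of_sigmaFinite a (a + b)
  have := Measure.haveLebesgueDecomposition_of_sigmaFinite b (a + b)
  set α := a.rnDeriv (a + b)
  set β := b.rnDeriv (a + b)
  have hne : ∀ᵐ x ∂(a + b), ∃ i, f i x ≠ 0 := ae_add_measure_iff.2 ⟨hna, hnb⟩
  -- Expressed through densities with respect to `a + b`, the hypothesis says that the difference of
  -- the densities, multiplied by any `f i`, vanishes on `U`.
  have hz : ∀ i, ∀ᵐ x ∂(a + b), x ∈ U → ((α x).toReal • f i x - (β x).toReal • f i x) = 0 := by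
    intro i
    have ia := (integrable_rnDeriv_smul_iff hac).2 (hfa i)
    have ib := (integrable_rnDeriv_smul_iff hbc).2 (hfb i)
    refine hU.ae_eq_zero_of_integral_contDiff_smul_eq_zero
      ((ia.sub ib).locallyIntegrable.locallyIntegrableOn U) fun φ hφ hφc hφU => ?_
    obtain ⟨C, hC⟩ := hφc.exists_bound_of_continuous hφ.continuous
    have ja : Integrable (fun x => φ x * f i x) a :=
      (hfa i).bdd_mul hφ.continuous.aestronglyMeasurable (ae_of_all _ hC)
    have jb : Integrable (fun x => φ x * f i x) b :=
      (hfb i).bdd_mul hφ.continuous.aestronglyMeasurable (ae_of_all _ hC)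
    have e : ∀ x, φ x • ((α x).toReal • f i x - (β x).toReal • f i x)
        = (α x).toReal • (φ x * f i x) - (β x).toReal • (φ x * f i x) := fun x => by
      simp only [smul_eq_mul]; ring
    simp only [e]
    rw [integral_sub ((integrable_rnDeriv_smul_iff hac).2 ja)
      ((integrable_rnDeriv_smul_iff hbc).2 jb), integral_rnDeriv_smul hac,
      integral_rnDeriv_smul hbc, h φ hφ hφc hφU i, sub_self]
  have hαβ : ∀ᵐ x ∂(a + b).restrict U, α x = β x := by
    rw [ae_restrict_iff' hU.measurableSet]
    filter_upwards [ae_all_iff.2 hz, hne, a.rnDeriv_lt_top (a + b), b.rnDeriv_lt_top (a + b)]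
      with x h1 ⟨i, hi⟩ h2 h3 hx
    have h4 := h1 i hx
    rw [← sub_smul, smul_eq_mul, mul_eq_zero, or_iff_left hi, sub_eq_zero] at h4
    exact (ENNReal.toReal_eq_toReal_iff' h2.ne h3.ne).1 h4
  calc a.restrict U = ((a + b).withDensity α).restrict U :=
        congrArg (·.restrict U) (Measure.withDensity_rnDeriv_eq a (a + b) hac).symm
    _ = ((a + b).withDensity β).restrict U := by
        rw [restrict_withDensity hU.measurableSet, restrict_withDensity hU.measurableSet]
        exact withDensity_congr_ae hαβ
    _ = b.restrict U := congrArg (·.restrict U) (Measure.withDensity_rnDeriv_eq b (a + b) hbc)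

theorem hasCompactSupport_of_support_subset_closedBall {φ : Vec n → ℝ} {c : Vec n} {s : ℝ}
    (h : Function.support φ ⊆ Metric.closedBall c s) :
    HasCompactSupport φ ∧ tsupport φ ⊆ Metric.closedBall c s :=
  ⟨HasCompactSupport.of_support_subset_isCompact (isCompact_closedBall c s) h,
    closure_minimal h Metric.isClosed_closedBall⟩

/-- A measure with vanishing distributional gradient is locally invariant under translations. -/
theorem integral_translate_eq {ν : Measure (Vec n)} [IsFiniteMeasure ν] {Ω : Set (Vec n)}
    (h : ∀ φ : Vec n → ℝ, ContDiff ℝ ∞ φ → HasCompactSupport φ → tsupport φ ⊆ Ω →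
      ∀ j, ∫ x, pderiv j φ x ∂ν = 0) {φ : Vec n → ℝ} (hφ : ContDiff ℝ ∞ φ) {c : Vec n} {s : ℝ}
    (hs : Function.support φ ⊆ Metric.closedBall c s) {v : Vec n}
    (hv : Metric.closedBall c (s + ‖v‖) ⊆ Ω) : ∫ x, φ (x - v) ∂ν = ∫ x, φ x ∂ν := by
  have hφ1 : ContDiff ℝ 1 φ := hφ.of_le (by norm_cast)
  have hc := (hasCompactSupport_of_support_subset_closedBall hs).1
  obtain ⟨C₀, hC₀⟩ := hc.exists_bound_of_continuous hφ.continuous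
  obtain ⟨C, hC⟩ := (hc.fderiv ℝ).exists_bound_of_continuous (hφ1.continuous_fderiv one_ne_zero)
  have hint : ∀ g : Vec n → ℝ, Continuous g → (∃ C, ∀ x, ‖g x‖ ≤ C) → Integrable g ν :=
    fun g hg ⟨C, hC⟩ => (integrable_const C).mono' hg.aestronglyMeasurable (ae_of_all _ hC)
  -- Every intermediate translate keeps its support in `Ω`, so it is an admissible test function,
  -- and the directional derivative along `v` combines partial derivatives.
  have hzero : ∀ t ∈ Icc (0 : ℝ) 1, ∫ x, fderiv ℝ φ (x - t • v) v ∂ν = 0 := by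
    intro t ht
    have hsup : Function.support (fun x => φ (x - t • v)) ⊆ Metric.closedBall c (s + ‖v‖) := by
      intro x hx
      have h1 : x - t • v ∈ Metric.closedBall c s := hs hx
      rw [mem_closedBall_iff_norm] at h1 ⊢
      have h2 : ‖t • v‖ ≤ ‖v‖ := by
        rw [norm_smul, Real.norm_of_nonneg ht.1]
        exact mul_le_of_le_one_left (norm_nonneg _) ht.2
      calc ‖x - c‖ = ‖(x - t • v - c) + t • v‖ := by congr 1; abel
        _ ≤ s + ‖v‖ := (norm_add_le _ _).trans (add_le_add h1 h2)
    obtain ⟨hcs, hts⟩ := hasCompactSupport_of_support_subset_closedBall hsup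
    have hsm : ContDiff ℝ ∞ fun x => φ (x - t • v) := hφ.comp (contDiff_id.sub contDiff_const)
    have h1 := h _ hsm hcs (hts.trans hv)
    have h2 : ∀ j x, pderiv j (fun x => φ (x - t • v)) x
        = fderiv ℝ φ (x - t • v) (EuclideanSpace.single j 1) := by
      intro j x
      rw [pderiv, fderiv_comp_sub]
    have h3 : ∀ L : Vec n →L[ℝ] ℝ, L v = ∑ j, v j * L (EuclideanSpace.single j 1) := by
      intro L
      conv_lhs => rw [← (EuclideanSpace.basisFun (Fin n) ℝ).sum_repr v]
      simp
    simp only [h2] at h1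
    simp only [fun x => h3 (fderiv ℝ φ (x - t • v))]
    rw [integral_finsetSum]
    · simp only [integral_const_mul, h1, mul_zero, Finset.sum_const_zero]
    · intro j _
      refine Integrable.const_mul (hint _ ?_ ⟨C, fun x => ?_⟩) _
      · exact ((hφ1.continuous_fderiv one_ne_zero).comp (by fun_prop)).clm_apply continuous_const
      · refine ((fderiv ℝ φ _).le_of_opNorm_le (hC _) _).trans ?_
        rw [PiLp.norm_single]; simp
  have hderiv : ∀ t : ℝ, HasDerivAt (fun t : ℝ => ∫ x, φ (x - t • v) ∂ν)
      (∫ x, -(fderiv ℝ φ (x - t • v) v) ∂ν) t := by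
    intro t
    refine (hasDerivAt_integral_of_dominated_loc_of_deriv_le (bound := fun _ => C * ‖v‖)
      (s := univ) (F := fun t x => φ (x - t • v)) (F' := fun t x => -(fderiv ℝ φ (x - t • v) v))
      univ_mem (Eventually.of_forall fun t => ?_) (hint _ ?_ ⟨C₀, fun x => hC₀ _⟩) ?_
      (ae_of_all _ fun x t _ => ?_) (integrable_const _) (ae_of_all _ fun x t _ => ?_)).2
    · exact (hφ.continuous.comp (by fun_prop)).aestronglyMeasurable
    · exact hφ.continuous.comp (by fun_prop)
    · exact (((hφ1.continuous_fderiv one_ne_zero).comp (by fun_prop)).clm_apply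
        continuous_const).neg.aestronglyMeasurable
    · rw [norm_neg]
      exact (fderiv ℝ φ _).le_of_opNorm_le (hC _) _
    · have h1 : HasDerivAt (fun t : ℝ => x - t • v) (-v) t := by
        simpa using ((hasDerivAt_id t).smul_const v).const_sub x
      have h2 := (hφ1.differentiable one_ne_zero (x - t • v)).hasFDerivAt.comp_hasDerivAt t h1
      rw [map_neg] at h2
      exact h2
  have hcst := constant_of_has_deriv_right_zero (f := fun t : ℝ => ∫ x, φ (x - t • v) ∂ν)
    (a := 0) (b := 1) (fun t _ => (hderiv t).continuousAt.continuousWithinAt)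
    (fun t ht => by
      have := (hderiv t).hasDerivWithinAt (s := Ici t)
      rwa [integral_neg, hzero t ⟨ht.1, ht.2.le⟩, neg_zero] at this) 1 (by simp)
  simpa using hcst

/-- A measure with vanishing distributional gradient is locally a multiple of Lebesgue measure. -/
theorem exists_restrict_ball_eq_smul {ν : Measure (Vec n)} [IsFiniteMeasure ν] {Ω : Set (Vec n)}
    (h : ∀ φ : Vec n → ℝ, ContDiff ℝ ∞ φ → HasCompactSupport φ → tsupport φ ⊆ Ω →
      ∀ j, ∫ x, pderiv j φ x ∂ν = 0) {x₀ : Vec n} {r : ℝ} (hr : 0 < r)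
    (hb : Metric.closedBall x₀ (r + r) ⊆ Ω) :
    ∃ c : ℝ≥0∞, ν.restrict (Metric.ball x₀ r) = c • volume.restrict (Metric.ball x₀ r) := by
  let χ : ContDiffBump (0 : Vec n) := ⟨r / 2, r, half_pos hr, half_lt_self hr⟩
  set ρ : Vec n → ℝ := χ.normed volume with hρ
  have hρs : ContDiff ℝ ∞ ρ := χ.contDiff_normed
  have hρc : HasCompactSupport ρ := χ.hasCompactSupport_normed
  have hρ0 : ∀ x, 0 ≤ ρ x := χ.nonneg_normed
  have hρ1 : ∫ x, ρ x = 1 := χ.integral_normed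
  have hρz : ∀ x, ρ x ≠ 0 → ‖x‖ ≤ r := fun x hx => by
    have : x ∈ Function.support ρ := hx
    rw [hρ, χ.support_normed_eq] at this
    have : ‖x‖ < r := by simpa using this
    exact this.le
  have hρi : Integrable ρ := hρs.continuous.integrable_of_hasCompactSupport hρc
  obtain ⟨D, hD⟩ := hρc.exists_bound_of_continuous hρs.continuous
  set c : ℝ := ∫ x, ρ (x - x₀) ∂ν with hc
  have hconst : ∀ u ∈ Metric.closedBall x₀ r, ∫ x, ρ (x - u) ∂ν = c := by
    intro u hu
    have h1 := integral_translate_eq h (φ := fun x => ρ (x - x₀)) (c := x₀) (s := r) (v := u - x₀)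
      (hρs.comp (contDiff_id.sub contDiff_const)) (fun x hx => by
        rw [mem_closedBall_iff_norm]; exact hρz _ hx)
      ((Metric.closedBall_subset_closedBall (by
        rw [mem_closedBall_iff_norm] at hu; linarith)).trans hb)
    rw [hc, ← h1]
    congr 1
    ext1 x
    congr 1
    abel
  -- The double integral of `ρ w * φ (x - w)` is computed in two ways: translating `φ` gives `∫ φ
  -- ∂ν`, while translating `ρ` gives `c ∫ φ`. Both `φ` and `ρ` have supports of radius `r`, so the
  -- closed ball of radius `r + r` contains every translate involved.
  have key : ∀ φ : Vec n → ℝ, ContDiff ℝ ∞ φ → HasCompactSupport φ →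
      tsupport φ ⊆ Metric.ball x₀ r → ∫ x, φ x ∂ν = c * ∫ x, φ x := by
    intro φ hφ hφc hφs
    have hφs' : Function.support φ ⊆ Metric.closedBall x₀ r :=
      (subset_tsupport φ).trans (hφs.trans Metric.ball_subset_closedBall)
    obtain ⟨C, hC⟩ := hφc.exists_bound_of_continuous hφ.continuous
    have hφi : Integrable φ := hφ.continuous.integrable_of_hasCompactSupport hφc
    have e1 : ∀ w, ∫ x, ρ w * φ (x - w) ∂ν = ρ w * ∫ x, φ x ∂ν := by
      intro w
      rw [integral_const_mul]
      by_cases hw : ρ w = 0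
      · rw [hw, zero_mul, zero_mul]
      · rw [integral_translate_eq h hφ hφs' ((Metric.closedBall_subset_closedBall
          (by linarith [hρz w hw])).trans hb)]
    have e2 : ∫ w, ∫ x, ρ w * φ (x - w) ∂ν = ∫ x, φ x ∂ν := by
      simp only [e1]
      rw [integral_mul_const, hρ1, one_mul]
    have i1 : Integrable (Function.uncurry fun (w x : Vec n) => ρ w * φ (x - w))
        (volume.prod ν) := by
      refine (hρi.mul_prod (integrable_const (μ := ν) C)).mono' ?_ (ae_of_all _ fun q => ?_)
      · have h1 := hρs.continuous
        have h2 := hφ.continuous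
        exact Continuous.aestronglyMeasurable (by fun_prop)
      · simp only [Function.uncurry]
        rw [norm_mul, Real.norm_of_nonneg (hρ0 _)]
        exact mul_le_mul_of_nonneg_left (hC _) (hρ0 _)
    have i2 : Integrable (Function.uncurry fun (x u : Vec n) => ρ (x - u) * φ u)
        (ν.prod volume) := by
      refine ((integrable_const (μ := ν) D).mul_prod hφi.norm).mono' ?_ (ae_of_all _ fun q => ?_)
      · have h1 := hρs.continuous
        have h2 := hφ.continuous
        exact Continuous.aestronglyMeasurable (by fun_prop)
      · simp only [Function.uncurry]
        rw [norm_mul]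
        exact mul_le_mul_of_nonneg_right (hD _) (norm_nonneg _)
    rw [← e2, integral_integral_swap i1]
    have e3 : ∀ x, ∫ w, ρ w * φ (x - w) = ∫ u, ρ (x - u) * φ u := fun x =>
      mollify_eq_integral ρ φ x
    simp only [e3]
    rw [integral_integral_swap i2, ← integral_const_mul]
    congr 1
    ext1 u
    rw [integral_mul_const]
    by_cases hu : φ u = 0
    · rw [hu, mul_zero, mul_zero]
    · rw [hconst u (hφs' hu)]
  have hc0 : 0 ≤ c := integral_nonneg fun x => hρ0 _
  refine ⟨ENNReal.ofReal c, ?_⟩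
  have hfin : IsFiniteMeasure (ENNReal.ofReal c • volume.restrict (Metric.ball x₀ r)) := by
    have : IsFiniteMeasure (volume.restrict (Metric.ball x₀ r)) :=
      isFiniteMeasure_restrict.2 Metric.isBounded_ball.measure_lt_top.ne
    exact Measure.smul_finite _ ENNReal.ofReal_ne_top
  have := restrict_eq_of_integral_contDiff_eq (a := ν)
    (b := ENNReal.ofReal c • volume.restrict (Metric.ball x₀ r)) (ι := Unit) (f := fun _ _ => 1)
    (fun _ => integrable_const _) (fun _ => integrable_const _)
    (ae_of_all _ fun _ => ⟨(), one_ne_zero⟩) (ae_of_all _ fun _ => ⟨(), one_ne_zero⟩)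
    (Metric.isOpen_ball (x := x₀) (ε := r)) fun φ hφ hφc hφs _ => ?_
  · rw [this, Measure.restrict_smul, Measure.restrict_restrict Metric.isOpen_ball.measurableSet,
      inter_self]
  · simp only [mul_one]
    rw [key φ hφ hφc hφs, integral_smul_measure, ENNReal.toReal_ofReal hc0, smul_eq_mul,
      setIntegral_eq_integral_of_forall_compl_eq_zero]
    intro x hx
    by_contra h
    exact hx (hφs (subset_tsupport φ h))

/-- A measure on a connected open set with vanishing distributional gradient is a multiple of
Lebesgue measure. -/
theorem exists_restrict_eq_smul {ν : Measure (Vec n)} [IsFiniteMeasure ν] {Ω : Set (Vec n)}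
    (hΩ : IsOpen Ω) (hc : IsConnected Ω)
    (h : ∀ φ : Vec n → ℝ, ContDiff ℝ ∞ φ → HasCompactSupport φ → tsupport φ ⊆ Ω →
      ∀ j, ∫ x, pderiv j φ x ∂ν = 0) : ∃ c : ℝ≥0∞, ν.restrict Ω = c • volume.restrict Ω := by
  have hloc : ∀ x, ∃ r > 0, ∃ c : ℝ≥0∞, x ∈ Ω →
      (ν.restrict (Metric.ball x r) = c • volume.restrict (Metric.ball x r)) := by
    intro x
    by_cases hx : x ∈ Ω
    · obtain ⟨r, hr, hb⟩ := Metric.nhds_basis_closedBall.mem_iff.1 (hΩ.mem_nhds hx)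
      obtain ⟨c, hc⟩ := exists_restrict_ball_eq_smul h (half_pos hr) (by rwa [add_halves])
      exact ⟨r / 2, half_pos hr, c, fun _ => hc⟩
    · exact ⟨1, one_pos, 0, fun h => absurd h hx⟩
  choose r hr c hcr using hloc
  -- Both constants describe `ν` on a small ball around `y`, whose volume is positive and finite.
  have hsame : ∀ x ∈ Ω, ∀ y ∈ Ω, y ∈ Metric.ball x (r x) → c x = c y := by
    intro x hx y hy hxy
    obtain ⟨s, hs, hsb⟩ := Metric.isOpen_iff.1 (Metric.isOpen_ball.inter Metric.isOpen_ball) y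
      ⟨hxy, Metric.mem_ball_self (hr y)⟩
    have e : ∀ z ∈ Ω, Metric.ball y s ⊆ Metric.ball z (r z) →
        ν (Metric.ball y s) = c z * volume (Metric.ball y s) := by
      intro z hz hsub
      rw [← Measure.restrict_eq_self ν hsub, hcr z hz, Measure.smul_apply,
        Measure.restrict_eq_self _ hsub, smul_eq_mul]
    have h1 := e x hx (hsb.trans inter_subset_left)
    have h2 := e y hy (hsb.trans inter_subset_right)
    rw [h1] at h2
    exact (ENNReal.mul_left_inj (Metric.measure_ball_pos volume y hs).ne'
      Metric.isBounded_ball.measure_lt_top.ne).1 h2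
  obtain ⟨x₀, hx₀⟩ := hc.nonempty
  -- The local constants are locally constant on `Ω`, hence constant by connectedness.
  have hall : ∀ x ∈ Ω, c x = c x₀ := by
    have hA : IsOpen {x ∈ Ω | c x = c x₀} := by
      rw [Metric.isOpen_iff]
      rintro x ⟨hx, hxc⟩
      obtain ⟨s, hs, hsb⟩ := Metric.isOpen_iff.1 (hΩ.inter Metric.isOpen_ball) x
        ⟨hx, Metric.mem_ball_self (hr x)⟩
      exact ⟨s, hs, fun y hy => ⟨(hsb hy).1, by rw [← hsame x hx y (hsb hy).1 (hsb hy).2, hxc]⟩⟩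
    have hB : IsOpen {x ∈ Ω | c x ≠ c x₀} := by
      rw [Metric.isOpen_iff]
      rintro x ⟨hx, hxc⟩
      obtain ⟨s, hs, hsb⟩ := Metric.isOpen_iff.1 (hΩ.inter Metric.isOpen_ball) x
        ⟨hx, Metric.mem_ball_self (hr x)⟩
      exact ⟨s, hs, fun y hy => ⟨(hsb hy).1, by rwa [← hsame x hx y (hsb hy).1 (hsb hy).2]⟩⟩
    have hsub : Ω ⊆ {x ∈ Ω | c x = c x₀} := by
      refine hc.isPreconnected.subset_left_of_subset_union hA hB ?_ ?_ ⟨x₀, hx₀, hx₀, rfl⟩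
      · rw [Set.disjoint_left]
        exact fun x h1 h2 => h2.2 h1.2
      · intro x hx
        by_cases hcx : c x = c x₀
        · exact Or.inl ⟨hx, hcx⟩
        · exact Or.inr ⟨hx, hcx⟩
    exact fun x hx => (hsub hx).2
  refine ⟨c x₀, ?_⟩
  -- A countable subcover suffices to glue the local identities of measures.
  obtain ⟨t, htΩ, htc, htcov⟩ := TopologicalSpace.countable_cover_nhdsWithin
    (f := fun x => Metric.ball x (r x)) (s := Ω)
    fun x hx => mem_nhdsWithin_of_mem_nhds (Metric.ball_mem_nhds x (hr x))
  rw [← Measure.restrict_smul]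
  refine Measure.restrict_congr_mono htcov ((Measure.restrict_biUnion_congr htc).2 fun x hx => ?_)
  rw [hcr x (htΩ hx), hall x (htΩ hx), Measure.restrict_smul]

end SmoothTests

/-! ### Disintegration and conditional means -/

section ConditionalMean

variable {X E G : Type*} [MeasurableSpace X] [NormedAddCommGroup E] [NormedSpace ℝ E]
  [FiniteDimensional ℝ E] [MeasurableSpace E] [BorelSpace E] [StandardBorelSpace E]
  [NormedAddCommGroup G] [NormedSpace ℝ G]
  {ρ : Measure (X × E)} [IsFiniteMeasure ρ]

set_option linter.unusedSectionVars false

theorem ae_condKernel {p : X × E → Prop} (h : ∀ᵐ w ∂ρ, p w) :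
    ∀ᵐ x ∂ρ.fst, ∀ᵐ e ∂ρ.condKernel x, p (x, e) := by
  rw [← ρ.disintegrate ρ.condKernel] at h
  exact Measure.ae_ae_of_ae_compProd h

theorem ae_fst_of_ae {p : X → Prop} (h : ∀ᵐ w ∂ρ, p w.1) : ∀ᵐ x ∂ρ.fst, p x := by
  filter_upwards [ae_condKernel (p := fun w => p w.1) h] with x hx
  exact hx.exists.choose_spec

variable (ρ) in
/-- The conditional mean of the second variable given the first one. -/
def condMean (x : X) : E := ∫ e, e ∂ρ.condKernel x

/-- On each fibre the kernel is a probability measure, so the norm of the mean is at most the `L^p`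
norm. Raising to the power `p` and integrating over the base gives the bound. -/
theorem memLp_integral_condKernel {p : ℝ≥0∞} (hp : 1 ≤ p) {g : X × E → G}
    (hgm : Measurable fun w => ‖g w‖ₑ) (hg : MemLp g p ρ) :
    MemLp (fun x => ∫ e, g (x, e) ∂ρ.condKernel x) p ρ.fst := by
  have hm : AEStronglyMeasurable (fun x => ∫ e, g (x, e) ∂ρ.condKernel x) ρ.fst :=
    hg.1.integral_condKernel
  by_cases hp' : p = ⊤
  · subst hp'
    refine memLp_top_of_bound hm (lpNorm g ⊤ ρ) ?_
    filter_upwards [ae_condKernel (ae_le_lpNorm_exponent_top hg)] with x hx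
    simpa using norm_integral_le_of_norm_le_const hx
  · have hp0 : p ≠ 0 := (zero_lt_one.trans_le hp).ne'
    refine ⟨hm, ?_⟩
    rw [eLpNorm_lt_top_iff_lintegral_rpow_enorm_lt_top hp0 hp']
    have hfin := (eLpNorm_lt_top_iff_lintegral_rpow_enorm_lt_top hp0 hp').1 hg.2
    rw [← Measure.lintegral_condKernel (hgm.pow_const _)] at hfin
    refine lt_of_le_of_lt (lintegral_mono_ae ?_) hfin
    filter_upwards [(memLp_one_iff_integrable.1 (hg.mono_exponent hp)).condKernel_ae] with x hx
    have hq : 0 < p.toReal := ENNReal.toReal_pos hp0 hp'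
    calc ‖∫ e, g (x, e) ∂ρ.condKernel x‖ₑ ^ p.toReal
        ≤ (eLpNorm (fun e => g (x, e)) p (ρ.condKernel x)) ^ p.toReal := by
          gcongr
          refine (enorm_integral_le_lintegral_enorm _).trans ?_
          rw [← eLpNorm_one_eq_lintegral_enorm]
          exact eLpNorm_le_eLpNorm_of_exponent_le hp hx.1
      _ = ∫⁻ e, ‖g (x, e)‖ₑ ^ p.toReal ∂ρ.condKernel x := by
          rw [eLpNorm_eq_lintegral_rpow_enorm_toReal hp0 hp', ← ENNReal.rpow_mul,
            one_div_mul_cancel hq.ne', ENNReal.rpow_one]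

/-- The exceptional set does not depend on `L`, so that `L` may later vary with `x`. -/
theorem ae_clm_condMean [CompleteSpace G] (hid : Integrable (fun w : X × E => w.2) ρ) :
    ∀ᵐ x ∂ρ.fst, ∀ L : E →L[ℝ] G, L (condMean ρ x) = ∫ e, L e ∂ρ.condKernel x := by
  filter_upwards [hid.condKernel_ae] with x hx L
  exact (L.integral_comp_comm hx).symm

theorem memLp_clm_condMean [CompleteSpace G] {p : ℝ≥0∞} (hp : 1 ≤ p)
    (hid : Integrable (fun w : X × E => w.2) ρ) (L : E →L[ℝ] G)
    (hL : MemLp (fun w : X × E => L w.2) p ρ) : MemLp (fun x => L (condMean ρ x)) p ρ.fst := by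
  have h1 : Measurable fun w : X × E => ‖L w.2‖ₑ := by
    have : Continuous fun e : E => ‖L e‖ₑ := continuous_enorm.comp L.continuous
    exact this.measurable.comp measurable_snd
  refine (memLp_congr_ae ?_).1 (memLp_integral_condKernel hp h1 hL)
  filter_upwards [ae_clm_condMean (G := G) hid] with x hx
  exact (hx L).symm

theorem integral_clm_condMean (hid : Integrable (fun w : X × E => w.2) ρ) {L : X → E →L[ℝ] ℝ}
    (hL : Integrable (fun w : X × E => L w.1 w.2) ρ) :
    ∫ x, L x (condMean ρ x) ∂ρ.fst = ∫ w, L w.1 w.2 ∂ρ := by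
  rw [← Measure.integral_condKernel hL]
  refine integral_congr_ae ?_
  filter_upwards [ae_clm_condMean (G := ℝ) hid] with x hx using hx _

/-- Fibrewise use of the barycentre theorem. The sets `C x` need neither be closed nor depend
measurably on `x`, as suits the slices of the constraint sets. -/
theorem ae_condMean_mem (hid : Integrable (fun w : X × E => w.2) ρ) {C : X → Set E}
    (hC : ∀ᵐ w ∂ρ, w.2 ∈ C w.1) (hconv : ∀ᵐ x ∂ρ.fst, Convex ℝ (C x)) :
    ∀ᵐ x ∂ρ.fst, condMean ρ x ∈ C x := by
  filter_upwards [hid.condKernel_ae, ae_condKernel hC, hconv] with x h1 h2 h3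
  exact Convex.integral_mem_of_finiteDimensional h3 h2 h1

/-- Rearranges the additive form of Jensen's inequality into a comparison of extended integrals. If
`b` is infinite the left side is `-∞`, and otherwise `B` is finite too. -/
theorem EReal_coe_sub_le_coe_sub {a b A B : ℝ≥0∞} (hA : A ≠ ⊤) (ha : a ≤ A) (h : a + B ≤ b + A) :
    (a : EReal) - b ≤ A - B := by
  have ha' : a ≠ ⊤ := ne_top_of_le_ne_top hA ha
  by_cases hb : b = ⊤
  · subst hb
    lift a to NNReal using ha'
    rw [EReal.coe_ennreal_top]
    have : ((a : ℝ≥0∞) : EReal) - ⊤ = ⊥ := EReal.sub_top _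
    rw [this]
    exact bot_le
  · have hB : B ≠ ⊤ := ne_top_of_le_ne_top (ENNReal.add_ne_top.2 ⟨hb, hA⟩) (le_add_self.trans h)
    lift a to NNReal using ha'
    lift b to NNReal using hb
    lift A to NNReal using hA
    lift B to NNReal using hB
    have h' : a + B ≤ b + A := by exact_mod_cast h
    have h'' : (a : ℝ) + B ≤ b + A := by exact_mod_cast h'
    have h3 : (a : ℝ) - b ≤ A - B := by linarith
    simp only [EReal.coe_nnreal_eq_coe_real]
    exact_mod_cast h3

/-- Jensen's inequality for the conditional mean. -/
theorem extIntegral_condMean_le (hid : Integrable (fun w : X × E => w.2) ρ) {C : X → Set E}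
    (hC : ∀ᵐ w ∂ρ, w.2 ∈ C w.1) {f : X × E → ℝ} (hf : Measurable f)
    (hconv : ∀ᵐ x ∂ρ.fst, ConvexOn ℝ (C x) fun e => f (x, e)) :
    extIntegral ρ.fst (fun x => f (x, condMean ρ x)) ≤ extIntegral ρ f := by
  have hfp : Measurable fun w => ENNReal.ofReal (f w) := hf.ennreal_ofReal
  have hfn : Measurable fun w => ENNReal.ofReal (-f w) := hf.neg.ennreal_ofReal
  by_cases hA : ∫⁻ w, ENNReal.ofReal (f w) ∂ρ = ⊤
  · have : extIntegral ρ f = ⊤ := by rw [extIntegral, if_pos hA]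
    rw [this]
    exact le_top
  have eA := Measure.lintegral_condKernel (ρ := ρ) hfp
  have eB := Measure.lintegral_condKernel (ρ := ρ) hfn
  have hFp : Measurable fun x => ∫⁻ e, ENNReal.ofReal (f (x, e)) ∂ρ.condKernel x :=
    hfp.lintegral_kernel_prod_right'
  have hFn : Measurable fun x => ∫⁻ e, ENNReal.ofReal (-f (x, e)) ∂ρ.condKernel x :=
    hfn.lintegral_kernel_prod_right'
  have hjensen : ∀ᵐ x ∂ρ.fst, ENNReal.ofReal (f (x, condMean ρ x))
        + ∫⁻ e, ENNReal.ofReal (-f (x, e)) ∂ρ.condKernel x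
      ≤ ENNReal.ofReal (-f (x, condMean ρ x))
        + ∫⁻ e, ENNReal.ofReal (f (x, e)) ∂ρ.condKernel x := by
    filter_upwards [hid.condKernel_ae, ae_condKernel hC, hconv,
      ae_lt_top hFp (by rw [eA]; exact hA)] with x h1 h2 h3 h4
    exact ConvexOn.lintegral_jensen h3 h2 h1
      (hf.comp measurable_prodMk_left).aemeasurable h4.ne
  -- Bounds the positive part after averaging, so that the extended integral of the mean does not
  -- fall under the convention for an infinite positive part.
  have hpos : ∀ᵐ x ∂ρ.fst, ENNReal.ofReal (f (x, condMean ρ x))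
      ≤ ∫⁻ e, ENNReal.ofReal (f (x, e)) ∂ρ.condKernel x := by
    filter_upwards [hjensen] with x hx
    rcases le_total (f (x, condMean ρ x)) 0 with h | h
    · rw [ENNReal.ofReal_of_nonpos h]
      exact zero_le
    · rw [ENNReal.ofReal_of_nonpos (by linarith : -f (x, condMean ρ x) ≤ 0), zero_add] at hx
      exact le_self_add.trans hx
  have ha := (lintegral_mono_ae hpos).trans_eq eA
  have hsum := lintegral_mono_ae hjensen
  rw [lintegral_add_right _ hFn, lintegral_add_right _ hFp, eA, eB] at hsum
  have e1 : extIntegral ρ f = ((∫⁻ w, ENNReal.ofReal (f w) ∂ρ : ℝ≥0∞) : EReal)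
      - ((∫⁻ w, ENNReal.ofReal (-f w) ∂ρ : ℝ≥0∞) : EReal) := by
    rw [extIntegral, if_neg hA]
  rw [e1, extIntegral, if_neg (ne_top_of_le_ne_top hA ha)]
  exact EReal_coe_sub_le_coe_sub hA ha hsum

end ConditionalMean

/-! ### Marginals of affine occupation measures -/

section Marginals

variable {n m : ℕ} {I : Type*} {P : Problem n m I} {p : ℝ≥0∞}
  {μ : Measure (Vec n × Vec m × Jac n m)} {μ' : Measure (Vec n × Vec m)}

theorem Problem.IsAffOcc.isFiniteMeasure (hΩ : IsLipschitzDomain P.Ω) (h : P.IsAffOcc p μ μ') :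
    IsFiniteMeasure μ := by
  refine ⟨?_⟩
  have hu : closure P.Ω ×ˢ P.Y ×ˢ P.Z =ᵐ[μ] univ := eventuallyEq_univ.2 (mem_ae_iff.2 h.carrier)
  rw [← measure_congr hu, h.mass]
  exact hΩ.isBounded.measure_lt_top

theorem Problem.IsAffOcc.ae_mem_bdry (h : P.IsAffOcc p μ μ') : ∀ᵐ w ∂μ', w ∈ P.bdry :=
  mem_ae_iff.2 h.carrier'

theorem Problem.IsFeasible.ae_mem_bulk (h : P.IsFeasible μ μ') : ∀ᵐ w ∂μ, w ∈ P.bulk :=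
  mem_ae_iff.2 h.carrier

/-- The mass of `μ'` is not prescribed. For `p = ∞` compact support suffices. For `p < ∞` the part
with `‖y‖ ≤ 1` lies in a compact set, and the moment bounds the rest by Markov's inequality. -/
theorem Problem.IsAffOcc.isFiniteMeasure' (hΩ : IsLipschitzDomain P.Ω)
    (hp : 1 ≤ p) (h : P.IsAffOcc p μ μ') : IsFiniteMeasure μ' := by
  have := h.radon'
  have hb := h.ae_mem_bdry
  refine ⟨?_⟩
  by_cases hp' : p = ⊤
  · have h1 := (h.compact hp').2.measure_lt_top (μ := μ')
    have hu : μ'.support =ᵐ[μ'] univ := eventuallyEq_univ.2 Measure.support_mem_ae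
    rwa [measure_congr hu] at h1
  · have hq : 0 < p.toReal := ENNReal.toReal_pos (zero_lt_one.trans_le hp).ne' hp'
    have hm := (h.moment hp').2
    rw [Measure.restrict_eq_self_of_ae_mem hb] at hm
    have hK : IsCompact (closure P.Ω ×ˢ Metric.closedBall (0 : Vec m) 1) :=
      hΩ.isBounded.isCompact_closure.prod (isCompact_closedBall _ _)
    have h1 : μ' (closure P.Ω ×ˢ Metric.closedBall (0 : Vec m) 1) < ⊤ := hK.measure_lt_top
    have h2 : μ' {w | 1 ≤ ‖w.2‖ₑ ^ p.toReal} < ⊤ := by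
      refine lt_of_le_of_lt ?_ hm
      have := mul_meas_ge_le_lintegral₀ (μ := μ') (f := fun w => ‖w.2‖ₑ ^ p.toReal)
        (by fun_prop) 1
      rwa [one_mul] at this
    have hu : μ' univ ≤ μ' (closure P.Ω ×ˢ Metric.closedBall (0 : Vec m) 1
        ∪ {w | 1 ≤ ‖w.2‖ₑ ^ p.toReal}) := by
      refine measure_mono_ae ?_
      filter_upwards [hb] with w hw _
      rcases le_total ‖w.2‖ 1 with h3 | h3
      · exact Or.inl ⟨frontier_subset_closure hw.1, by simpa using h3⟩
      · refine Or.inr ?_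
        change 1 ≤ ‖w.2‖ₑ ^ p.toReal
        refine ENNReal.one_le_rpow ?_ hq
        rw [← ofReal_norm]
        exact ENNReal.one_le_ofReal.2 h3
    exact (hu.trans (measure_union_le _ _)).trans_lt (ENNReal.add_lt_top.2 ⟨h1, h2⟩)

theorem memLp_top_of_isCompact_support {X G : Type*} [TopologicalSpace X] [MeasurableSpace X]
    [OpensMeasurableSpace X] [HereditarilyLindelofSpace X] [NormedAddCommGroup G] {ν : Measure X}
    (hν : IsCompact ν.support) {f : X → G} (hf : Continuous f) (hfm : AEStronglyMeasurable f ν) :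
    MemLp f ⊤ ν := by
  obtain ⟨C, hC⟩ := hν.exists_bound_of_continuousOn hf.continuousOn
  refine memLp_top_of_bound hfm C ?_
  filter_upwards [Measure.support_mem_ae (μ := ν)] with x hx using hC x hx

theorem Problem.IsAffOcc.memLp (hp : 1 ≤ p) (h : P.IsAffOcc p μ μ')
    (hf : P.IsFeasible μ μ') : MemLp (fun w : Vec n × Vec m × Jac n m => w.2.1) p μ ∧
      (∀ j, MemLp (fun w : Vec n × Vec m × Jac n m => w.2.2 j) p μ) ∧
      MemLp (fun w : Vec n × Vec m => w.2) p μ' := by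
  have c1 : Continuous fun w : Vec n × Vec m × Jac n m => w.2.1 := by fun_prop
  have c2 : ∀ j, Continuous fun w : Vec n × Vec m × Jac n m => w.2.2 j := fun j => by fun_prop
  have c3 : Continuous fun w : Vec n × Vec m => w.2 := by fun_prop
  by_cases hp' : p = ⊤
  · subst hp'
    obtain ⟨k1, k2⟩ := h.compact rfl
    exact ⟨memLp_top_of_isCompact_support k1 c1 c1.aestronglyMeasurable,
      fun j => memLp_top_of_isCompact_support k1 (c2 j) (c2 j).aestronglyMeasurable,
      memLp_top_of_isCompact_support k2 c3 c3.aestronglyMeasurable⟩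
  · have hp0 : p ≠ 0 := (zero_lt_one.trans_le hp).ne'
    obtain ⟨m1, m2⟩ := h.moment hp'
    rw [Measure.restrict_eq_self_of_ae_mem hf.ae_mem_bulk] at m1
    rw [Measure.restrict_eq_self_of_ae_mem h.ae_mem_bdry] at m2
    refine ⟨⟨c1.aestronglyMeasurable, ?_⟩, fun j => ⟨(c2 j).aestronglyMeasurable, ?_⟩,
      ⟨c3.aestronglyMeasurable, ?_⟩⟩
    · rw [eLpNorm_lt_top_iff_lintegral_rpow_enorm_lt_top hp0 hp']
      exact (lintegral_mono fun w => le_self_add).trans_lt m1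
    · rw [eLpNorm_lt_top_iff_lintegral_rpow_enorm_lt_top hp0 hp']
      refine (lintegral_mono fun w => ?_).trans_lt m1
      exact (Finset.single_le_sum (f := fun j => ‖w.2.2 j‖ₑ ^ p.toReal)
        (fun _ _ => zero_le) (Finset.mem_univ j)).trans le_add_self
    · rwa [eLpNorm_lt_top_iff_lintegral_rpow_enorm_lt_top hp0 hp']

/-- The Liouville equation for the marginals. -/
theorem Problem.IsAffOcc.integral_pderiv_fst (hΩ : IsLipschitzDomain P.Ω) (hp : 1 ≤ p)
    (h : P.IsAffOcc p μ μ') (hf : P.IsFeasible μ μ') {φ : Vec n → ℝ} (hφ : ContDiff ℝ ∞ φ)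
    (j : Fin n) :
    ∫ x, pderiv j φ x ∂μ.fst = ∫ x, φ x * outerNormal P.Ω x j ∂μ'.fst := by
  have := h.isFiniteMeasure' hΩ hp
  have h1 := h.liouville φ 0 hφ contDiff_const j
  rw [Measure.restrict_eq_self_of_ae_mem hf.ae_mem_bulk,
    Measure.restrict_eq_self_of_ae_mem h.ae_mem_bdry] at h1
  have hz : ∀ x, pderiv j (0 : Vec n → Vec m) x = 0 := fun x => by
    rw [pderiv, fderiv_zero]; rfl
  simp only [hz, Pi.zero_apply, inner_zero_right, inner_zero_left, add_zero] at h1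
  have hN : AEMeasurable (outerNormal P.Ω) μ'.fst :=
    aemeasurable_outerNormal hΩ.isOpen.measurableSet (ae_fst_of_ae (p := fun x => ∃ ν, IsOuterNormal P.Ω x ν) h.normal_ae)
  have hNj : AEStronglyMeasurable (fun x => outerNormal P.Ω x j) μ'.fst :=
    (EuclideanSpace.proj (𝕜 := ℝ) j).continuous.comp_aestronglyMeasurable hN.aestronglyMeasurable
  have hφN : AEStronglyMeasurable (fun x => φ x * outerNormal P.Ω x j) μ'.fst :=
    hφ.continuous.aestronglyMeasurable.mul hNj
  rw [Measure.fst, Measure.fst, integral_map measurable_fst.aemeasurable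
    (continuous_pderiv (hφ.of_le (by norm_cast)) j).aestronglyMeasurable,
    integral_map measurable_fst.aemeasurable hφN, h1]

/-- Test functions supported in `Ω` kill the boundary term, so the marginal has no distributional
gradient. On a connected set it is a multiple of Lebesgue measure, and the mass condition fixes the
factor. -/
theorem Problem.IsAffOcc.fst_eq (hΩ : IsLipschitzDomain P.Ω) (hp : 1 ≤ p)
    (h : P.IsAffOcc p μ μ') (hf : P.IsFeasible μ μ') : μ.fst = volume.restrict P.Ω := by
  have := h.isFiniteMeasure hΩ
  have := h.isFiniteMeasure' hΩ hp
  have hmem : ∀ᵐ x ∂μ.fst, x ∈ P.Ω := ae_fst_of_ae (by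
    filter_upwards [hf.ae_mem_bulk] with w hw using hw.1)
  have hmem' : ∀ᵐ x ∂μ'.fst, x ∈ frontier P.Ω := ae_fst_of_ae (by
    filter_upwards [h.ae_mem_bdry] with w hw using hw.1)
  obtain ⟨c, hc⟩ := exists_restrict_eq_smul (ν := μ.fst) hΩ.isOpen hΩ.isConnected
    fun φ hφ _ hφΩ j => by
      rw [h.integral_pderiv_fst hΩ hp hf hφ j]
      refine integral_eq_zero_of_ae ?_
      filter_upwards [hmem'] with x hx
      have hx' : x ∉ tsupport φ := fun h' => by
        have h1 := hφΩ h'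
        rw [hΩ.isOpen.frontier_eq] at hx
        exact hx.2 h1
      simp [image_eq_zero_of_notMem_tsupport hx']
  rw [Measure.restrict_eq_self_of_ae_mem hmem] at hc
  have hmass : μ.fst univ = volume P.Ω := by
    have hu : closure P.Ω ×ˢ P.Y ×ˢ P.Z =ᵐ[μ] univ :=
      eventuallyEq_univ.2 (mem_ae_iff.2 h.carrier)
    rw [Measure.fst_univ, ← measure_congr hu, h.mass]
  rw [hc, Measure.smul_apply, Measure.restrict_apply_univ, smul_eq_mul] at hmass
  have hc1 : c = 1 := by
    refine (ENNReal.mul_left_inj (hΩ.isOpen.measure_pos volume hΩ.isConnected.nonempty).ne'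
      hΩ.isBounded.measure_lt_top.ne).1 ?_
    rw [hmass, one_mul]
  rw [hc, hc1, one_smul]

theorem exists_outerNormal_apply_ne_zero {Ω : Set (Vec n)} {x : Vec n}
    (h : ∃ ν, IsOuterNormal Ω x ν) : ∃ j, outerNormal Ω x j ≠ 0 := by
  obtain ⟨ν, hν⟩ := h
  by_contra! hcon
  have h0 : outerNormal Ω x = 0 := by ext j; simpa using hcon j
  have h1 := hν.1
  rw [← hν.outerNormal_eq, h0, norm_zero] at h1
  exact zero_ne_one h1

/-- With the bulk marginal known, Liouville's equation and the divergence theorem have the same left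
side. Hence the normal times the marginal equals the normal times surface measure, and the normal
vanishes almost nowhere for either measure. -/
theorem Problem.IsAffOcc.fst_eq' (hΩ : IsLipschitzDomain P.Ω) (hp : 1 ≤ p)
    (h : P.IsAffOcc p μ μ') (hf : P.IsFeasible μ μ') : μ'.fst = surf P.Ω := by
  have := h.isFiniteMeasure' hΩ hp
  have := hΩ.isFiniteMeasure_surf
  have hn := ae_fst_of_ae (p := fun x => ∃ ν, IsOuterNormal P.Ω x ν) h.normal_ae
  have hN : AEMeasurable (outerNormal P.Ω) μ'.fst :=
    aemeasurable_outerNormal hΩ.isOpen.measurableSet hn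
  have hint : ∀ ν : Measure (Vec n), IsFiniteMeasure ν →
      AEStronglyMeasurable (outerNormal P.Ω) ν → ∀ j,
      Integrable (fun x => outerNormal P.Ω x j) ν := fun ν _ hν j =>
    (integrable_const (1 : ℝ)).mono'
      ((EuclideanSpace.proj (𝕜 := ℝ) j).continuous.comp_aestronglyMeasurable hν)
      (ae_of_all _ fun x => (PiLp.norm_apply_le _ j).trans (norm_outerNormal_le x))
  have key := restrict_eq_of_integral_contDiff_eq (a := μ'.fst) (b := surf P.Ω)
    (f := fun j x => outerNormal P.Ω x j) (hint _ inferInstance hN.aestronglyMeasurable)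
    (hint _ inferInstance hΩ.aestronglyMeasurable_normal)
    (by filter_upwards [hn] with x hx using exists_outerNormal_apply_ne_zero hx)
    (by filter_upwards [hΩ.ae_normal] with x hx using exists_outerNormal_apply_ne_zero hx)
    isOpen_univ fun φ hφ _ _ j => by
      rw [← h.integral_pderiv_fst hΩ hp hf hφ j, h.fst_eq hΩ hp hf,
        hΩ.integral_pderiv (hφ.of_le (by norm_cast)) j]
  simpa using key

end Marginals

/-! ### Admissibility of the conditional means -/

section MeanFunction

variable {n m : ℕ} {I : Type*} {P : Problem n m I} {p : ℝ≥0∞}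
  {μ : Measure (Vec n × Vec m × Jac n m)} {μ' : Measure (Vec n × Vec m)}

theorem Problem.convex_bulkSet_slice (hc : P.IsConvex) (i : I) {x : Vec n} (hx : x ∈ P.Ω) :
    Convex ℝ {q : Vec m × Jac n m | (x, q) ∈ P.bulkSet i} := by
  obtain ⟨a, ha⟩ := hc.A_affine i x hx
  have h1 : {q : Vec m × Jac n m | (x, q) ∈ P.bulkSet i}
      = {q ∈ P.Y ×ˢ P.Z | P.B i (x, q) ≤ 0} ∩ a ⁻¹' {0} := by
    ext q
    constructor
    · rintro ⟨⟨-, h1⟩, h2, h3⟩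
      exact ⟨⟨h1, h3⟩, by rw [mem_preimage, ← ha q h1, h2]; rfl⟩
    · rintro ⟨⟨h1, h3⟩, h2⟩
      refine ⟨⟨hx, h1⟩, ?_, h3⟩
      rw [ha q h1]; exact h2
  rw [h1]
  exact ((hc.B_convex i x hx).convex_le 0).inter ((convex_singleton 0).affine_preimage a)

theorem Problem.convex_bdrySet_slice (hc : P.IsConvex) (i : I) {x : Vec n}
    (hx : x ∈ frontier P.Ω) : Convex ℝ {q : Vec m | (x, q) ∈ P.bdrySet i} := by
  obtain ⟨a, ha⟩ := hc.A'_affine i x hx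
  have h1 : {q : Vec m | (x, q) ∈ P.bdrySet i}
      = {q ∈ P.Y | P.B' i (x, q) ≤ 0} ∩ a ⁻¹' {0} := by
    ext q
    constructor
    · rintro ⟨⟨-, h1⟩, h2, h3⟩
      exact ⟨⟨h1, h3⟩, by rw [mem_preimage, ← ha q h1, h2]; rfl⟩
    · rintro ⟨⟨h1, h3⟩, h2⟩
      refine ⟨⟨hx, h1⟩, ?_, h3⟩
      rw [ha q h1]; exact h2
  rw [h1]
  exact ((hc.B'_convex i x hx).convex_le 0).inter ((convex_singleton 0).affine_preimage a)

theorem integrable_pi {α ι : Type*} [MeasurableSpace α] [Fintype ι] {ν : Measure α}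
    {f : α → ι → Vec m}
    (hf : ∀ i, Integrable (fun a => f a i) ν) : Integrable f ν := by
  refine (integrable_finsetSum Finset.univ fun i _ => (hf i).norm).mono'
    (aemeasurable_pi_iff.2 fun i => (hf i).1.aemeasurable).aestronglyMeasurable (ae_of_all _ fun a => ?_)
  refine (pi_norm_le_iff_of_nonneg (Finset.sum_nonneg fun i _ => norm_nonneg _)).2 fun i => ?_
  exact Finset.single_le_sum (f := fun i => ‖f a i‖) (fun _ _ => norm_nonneg _) (Finset.mem_univ i)

theorem Problem.IsAffOcc.integrable_snd (hΩ : IsLipschitzDomain P.Ω) (hp : 1 ≤ p)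
    (h : P.IsAffOcc p μ μ') (hf : P.IsFeasible μ μ') :
    Integrable (fun w : Vec n × Vec m × Jac n m => w.2) μ ∧
      Integrable (fun w : Vec n × Vec m => w.2) μ' := by
  have := h.isFiniteMeasure hΩ
  have := h.isFiniteMeasure' hΩ hp
  obtain ⟨m1, m2, m3⟩ := h.memLp hp hf
  exact ⟨(memLp_one_iff_integrable.1 (m1.mono_exponent hp)).prodMk
    (integrable_pi fun j => memLp_one_iff_integrable.1 ((m2 j).mono_exponent hp)),
    memLp_one_iff_integrable.1 (m3.mono_exponent hp)⟩

theorem Problem.extIntegral_condMean_le_bulk (hΩ : IsLipschitzDomain P.Ω) (hc : P.IsConvex)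
    [IsFiniteMeasure μ] (hfst : μ.fst = volume.restrict P.Ω)
    (hid : Integrable (fun w : Vec n × Vec m × Jac n m => w.2) μ) (hb : ∀ᵐ w ∂μ, w ∈ P.bulk)
    {f : Vec n × Vec m × Jac n m → ℝ} (hf : Measurable (P.bulk.domRestrict f))
    (hconv : ∀ x ∈ P.Ω, ConvexOn ℝ (P.Y ×ˢ P.Z) fun q => f (x, q)) :
    extIntegral (volume.restrict P.Ω) (fun x => f (x, condMean μ x))
      ≤ extIntegral (μ.restrict P.bulk) f := by
  have hm := P.measurableSet_bulk hΩ hc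
  have hf' := measurable_indicator_of_domRestrict hm hf
  have hC : ∀ᵐ w ∂μ, w.2 ∈ P.Y ×ˢ P.Z := by filter_upwards [hb] with w hw using hw.2
  have hxΩ : ∀ᵐ x ∂μ.fst, x ∈ P.Ω := by
    rw [hfst]; exact ae_restrict_mem hΩ.isOpen.measurableSet
  have hq := ae_condMean_mem hid hC (ae_of_all _ fun x => hc.Y_convex.prod hc.Z_convex)
  have hJ := extIntegral_condMean_le hid hC hf' (by
    filter_upwards [hxΩ] with x hx
    refine (hconv x hx).congr fun q hq => ?_
    exact (indicator_of_mem (show (x, q) ∈ P.bulk from ⟨hx, hq⟩) f).symm)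
  rw [Measure.restrict_eq_self_of_ae_mem hb, ← hfst]
  refine le_of_eq_of_le (extIntegral_congr ?_) (hJ.trans_eq (extIntegral_congr ?_))
  · filter_upwards [hxΩ, hq] with x hx hqx
    exact (indicator_of_mem (show (x, condMean μ x) ∈ P.bulk from ⟨hx, hqx⟩) f).symm
  · filter_upwards [hb] with w hw
    exact indicator_of_mem hw f

theorem Problem.extIntegral_condMean_le_bdry (hc : P.IsConvex)
    [IsFiniteMeasure μ'] (hfst : μ'.fst = surf P.Ω)
    (hid : Integrable (fun w : Vec n × Vec m => w.2) μ') (hb : ∀ᵐ w ∂μ', w ∈ P.bdry)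
    {f : Vec n × Vec m → ℝ} (hf : Measurable (P.bdry.domRestrict f))
    (hconv : ∀ x ∈ frontier P.Ω, ConvexOn ℝ P.Y fun q => f (x, q)) :
    extIntegral (surf P.Ω) (fun x => f (x, condMean μ' x))
      ≤ extIntegral (μ'.restrict P.bdry) f := by
  have hf' := measurable_indicator_of_domRestrict (P.isClosed_bdry hc).measurableSet hf
  have hC : ∀ᵐ w ∂μ', w.2 ∈ P.Y := by filter_upwards [hb] with w hw using hw.2
  have hxΩ : ∀ᵐ x ∂μ'.fst, x ∈ frontier P.Ω := by
    rw [hfst]; exact ae_surf_mem_frontier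
  have hq := ae_condMean_mem hid hC (ae_of_all _ fun x => hc.Y_convex)
  have hJ := extIntegral_condMean_le hid hC hf' (by
    filter_upwards [hxΩ] with x hx
    refine (hconv x hx).congr fun q hq => ?_
    exact (indicator_of_mem (show (x, q) ∈ P.bdry from ⟨hx, hq⟩) f).symm)
  rw [Measure.restrict_eq_self_of_ae_mem hb, ← hfst]
  refine le_of_eq_of_le (extIntegral_congr ?_) (hJ.trans_eq (extIntegral_congr ?_))
  · filter_upwards [hxΩ, hq] with x hx hqx
    exact (indicator_of_mem (show (x, condMean μ' x) ∈ P.bdry from ⟨hx, hqx⟩) f).symm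
  · filter_upwards [hb] with w hw
    exact indicator_of_mem hw f

theorem integrable_inner_of_ae_mem_closure {Ω : Set (Vec n)} (hΩ : IsLipschitzDomain Ω)
    {α : Type*} [MeasurableSpace α] {ν : Measure α} {g : α → Vec m} (hg : Integrable g ν)
    {a : α → Vec n} (ha : Measurable a) (haΩ : ∀ᵐ w ∂ν, a w ∈ closure Ω) {ψ : Vec n → Vec m}
    (hψ : Continuous ψ) : Integrable (fun w => (inner ℝ (g w) (ψ (a w)) : ℝ)) ν := by
  obtain ⟨C, hC0, hC⟩ := exists_forall_closure_norm_le hΩ hψ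
  refine (hg.norm.mul_const C).mono'
    (hg.1.inner (hψ.measurable.comp ha).aestronglyMeasurable) ?_
  filter_upwards [haΩ] with w hw
  exact (norm_inner_le_norm _ _).trans (mul_le_mul_of_nonneg_left (hC _ hw) (norm_nonneg _))

/-- Integration by parts for the conditional means. -/
theorem Problem.IsAffOcc.integral_condMean [IsFiniteMeasure μ] [IsFiniteMeasure μ']
    (hΩ : IsLipschitzDomain P.Ω) (hp : 1 ≤ p)
    (h : P.IsAffOcc p μ μ') (hf : P.IsFeasible μ μ') {φ : Vec n → Vec m} (hφ : ContDiff ℝ ∞ φ)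
    (j : Fin n) :
    ∫ x in P.Ω, (inner ℝ (condMean μ x).1 (pderiv j φ x) + inner ℝ ((condMean μ x).2 j) (φ x))
      = ∫ x, inner ℝ (condMean μ' x) (φ x) * outerNormal P.Ω x j ∂surf P.Ω := by
  have hfst := h.fst_eq hΩ hp hf
  have hfst' := h.fst_eq' hΩ hp hf
  obtain ⟨i1, i2⟩ := h.integrable_snd hΩ hp hf
  have hφ1 : ContDiff ℝ 1 φ := hφ.of_le (by norm_cast)
  have hb : ∀ᵐ w ∂μ, w.1 ∈ closure P.Ω := by
    filter_upwards [hf.ae_mem_bulk] with w hw using subset_closure hw.1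
  have hb' : ∀ᵐ w ∂μ', w.1 ∈ closure P.Ω := by
    filter_upwards [h.ae_mem_bdry] with w hw using frontier_subset_closure hw.1
  have h1 := h.liouville 0 φ contDiff_const hφ j
  rw [Measure.restrict_eq_self_of_ae_mem hf.ae_mem_bulk,
    Measure.restrict_eq_self_of_ae_mem h.ae_mem_bdry] at h1
  have hz : ∀ x, pderiv j (0 : Vec n → ℝ) x = 0 := fun x => by
    rw [pderiv, fderiv_zero]; rfl
  simp only [hz, Pi.zero_apply, zero_add] at h1
  -- With `φ₁ = 0` both integrands of Liouville's equation are, for fixed `x`, linear in the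
  -- remaining variables, so these may be replaced by their conditional means.
  let Ly : Vec m × Jac n m →L[ℝ] Vec m := ContinuousLinearMap.fst ℝ _ _
  let Lz : Vec m × Jac n m →L[ℝ] Vec m :=
    (ContinuousLinearMap.proj j).comp (ContinuousLinearMap.snd ℝ _ _)
  let L : Vec n → Vec m × Jac n m →L[ℝ] ℝ := fun x =>
    (innerSL ℝ (pderiv j φ x)).comp Ly + (innerSL ℝ (φ x)).comp Lz
  let L' : Vec n → Vec m →L[ℝ] ℝ := fun x => outerNormal P.Ω x j • innerSL ℝ (φ x)
  have eL : ∀ x q, L x q = inner ℝ q.1 (pderiv j φ x) + inner ℝ (φ x) (q.2 j) := fun x q => by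
    rw [real_inner_comm (pderiv j φ x)]; rfl
  have eL' : ∀ x q, L' x q = inner ℝ q (φ x) * outerNormal P.Ω x j := fun x q => by
    rw [mul_comm, real_inner_comm (φ x)]; rfl
  have hL : Integrable (fun w : Vec n × Vec m × Jac n m => L w.1 w.2) μ := by
    simp only [eL]
    refine (integrable_inner_of_ae_mem_closure hΩ (Ly.integrable_comp i1) measurable_fst hb
      (continuous_pderiv hφ1 j)).add ?_
    have := integrable_inner_of_ae_mem_closure hΩ (Lz.integrable_comp i1) measurable_fst hb
      hφ.continuous
    refine this.congr (ae_of_all _ fun w => ?_)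
    exact real_inner_comm _ _
  have hL' : Integrable (fun w : Vec n × Vec m => L' w.1 w.2) μ' := by
    simp only [eL']
    have hN : AEStronglyMeasurable (fun w : Vec n × Vec m => outerNormal P.Ω w.1 j) μ' := by
      have h2 : AEStronglyMeasurable (outerNormal P.Ω) μ'.fst :=
        hfst'.symm ▸ hΩ.aestronglyMeasurable_normal
      exact (EuclideanSpace.proj (𝕜 := ℝ) j).continuous.comp_aestronglyMeasurable
        (h2.comp_measurable measurable_fst)
    exact (integrable_inner_of_ae_mem_closure hΩ i2 measurable_fst hb' hφ.continuous).mul_bdd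
      (c := 1) hN (ae_of_all _ fun w => (PiLp.norm_apply_le _ j).trans (norm_outerNormal_le _))
  have k1 := integral_clm_condMean i1 hL
  have k2 := integral_clm_condMean i2 hL'
  simp only [eL, hfst] at k1
  simp only [eL', hfst'] at k2
  rw [k2, ← h1, ← k1]
  congr 1
  ext1 x
  rw [real_inner_comm (φ x)]

/-- For `φ = ψ • v` with `ψ` supported in `Ω` the boundary term vanishes. The remaining identity is
the definition of the weak derivative paired with the arbitrary vector `v`. -/
theorem Problem.IsAffOcc.isSobolev [IsFiniteMeasure μ] [IsFiniteMeasure μ']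
    (hΩ : IsLipschitzDomain P.Ω) (hp : 1 ≤ p)
    (h : P.IsAffOcc p μ μ') (hf : P.IsFeasible μ μ') :
    IsSobolev P.Ω p (fun x => (condMean μ x).1) (fun x => (condMean μ x).2) := by
  have := hΩ.isFiniteMeasure_vol
  have hfst := h.fst_eq hΩ hp hf
  obtain ⟨i1, i2⟩ := h.integrable_snd hΩ hp hf
  obtain ⟨m1, m2, m3⟩ := h.memLp hp hf
  have hy := memLp_clm_condMean hp i1 (ContinuousLinearMap.fst ℝ (Vec m) (Jac n m)) m1
  have hz := fun j => memLp_clm_condMean hp i1 ((ContinuousLinearMap.proj j).comp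
    (ContinuousLinearMap.snd ℝ (Vec m) (Jac n m))) (m2 j)
  rw [hfst] at hy
  have hz : ∀ j, MemLp (fun x => (condMean μ x).2 j) p (volume.restrict P.Ω) := fun j =>
    hfst ▸ hz j
  refine ⟨hy, hz, fun ψ hψ hψc hψΩ j => ?_⟩
  have hψ1 : ContDiff ℝ 1 ψ := hψ.of_le (by norm_cast)
  have hyi := memLp_one_iff_integrable.1 (hy.mono_exponent hp)
  have hzi := memLp_one_iff_integrable.1 ((hz j).mono_exponent hp)
  obtain ⟨C, hC⟩ := hψc.exists_bound_of_continuous hψ.continuous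
  obtain ⟨D, hD⟩ := (hψc.fderiv ℝ).exists_bound_of_continuous (hψ1.continuous_fderiv one_ne_zero)
  have j1 : Integrable (fun x => pderiv j ψ x • (condMean μ x).1) (volume.restrict P.Ω) := by
    refine hyi.bdd_smul D (continuous_pderiv hψ1 j).aestronglyMeasurable
      (ae_of_all _ fun x => ?_)
    refine ((fderiv ℝ ψ x).le_of_opNorm_le (hD x) _).trans ?_
    rw [PiLp.norm_single]; simp
  have j2 : Integrable (fun x => ψ x • (condMean μ x).2 j) (volume.restrict P.Ω) :=
    hzi.bdd_smul C hψ.continuous.aestronglyMeasurable (ae_of_all _ hC)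
  rw [← add_eq_zero_iff_eq_neg, ← integral_add j1 j2]
  refine ext_inner_right ℝ fun v => ?_
  rw [inner_zero_left, real_inner_comm, ← integral_inner (f := fun x => pderiv j ψ x • (condMean μ x).1 + ψ x • (condMean μ x).2 j)
    (j1.add j2)]
  have hφ : ContDiff ℝ ∞ fun x => ψ x • v := hψ.smul contDiff_const
  have hd : ∀ x, pderiv j (fun x => ψ x • v) x = pderiv j ψ x • v := fun x => by
    rw [pderiv, fderiv_smul_const (hψ1.differentiable one_ne_zero x)]; rfl
  have k := h.integral_condMean hΩ hp hf hφ j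
  rw [show ∫ x, inner ℝ (condMean μ' x) (ψ x • v) * outerNormal P.Ω x j ∂surf P.Ω = 0 from ?_] at k
  · rw [← k]
    congr 1
    ext1 x
    simp only [hd]
    rw [inner_add_right, real_inner_smul_right, real_inner_smul_right, real_inner_smul_right,
      real_inner_smul_right, real_inner_comm v, real_inner_comm v]
  · refine integral_eq_zero_of_ae ?_
    filter_upwards [ae_surf_mem_frontier] with x hx
    have hx' : x ∉ tsupport ψ := fun h' => by
      rw [hΩ.isOpen.frontier_eq] at hx
      exact hx.2 (hψΩ h')
    simp [image_eq_zero_of_notMem_tsupport hx']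

/-- The conditional means of feasible relaxed occupation measures are admissible. -/
theorem Problem.IsAffOcc.isAdmissible [IsFiniteMeasure μ] [IsFiniteMeasure μ']
    (hΩ : IsLipschitzDomain P.Ω) (hr : P.IsRegular)
    (hc : P.IsConvex) (hp : 1 ≤ p) (h : P.IsAffOcc p μ μ') (hf : P.IsFeasible μ μ') :
    P.IsAdmissible p (fun x => (condMean μ x).1) (fun x => (condMean μ x).2) (condMean μ') := by
  have hfst := h.fst_eq hΩ hp hf
  have hfst' := h.fst_eq' hΩ hp hf
  obtain ⟨i1, i2⟩ := h.integrable_snd hΩ hp hf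
  obtain ⟨m1, m2, m3⟩ := h.memLp hp hf
  have hb := hf.ae_mem_bulk
  have hb' := h.ae_mem_bdry
  have hS := h.isSobolev hΩ hp hf
  have hT := memLp_clm_condMean hp i2 (ContinuousLinearMap.id ℝ (Vec m)) m3
  rw [hfst'] at hT
  have := hΩ.isFiniteMeasure_surf
  have hq : ∀ᵐ x ∂volume.restrict P.Ω, condMean μ x ∈ P.Y ×ˢ P.Z := by
    rw [← hfst]
    refine ae_condMean_mem i1 (C := fun _ => P.Y ×ˢ P.Z) ?_
      (ae_of_all _ fun x => hc.Y_convex.prod hc.Z_convex)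
    filter_upwards [hb] with w hw using hw.2
  -- The mean of `μ'` is only known through integration by parts, and this identifies it as the
  -- trace.
  refine ⟨hS, IsTrace.of_integral_eq hΩ (hS.mono hΩ hp) (hT.mono_exponent hp)
    fun φ hφ j => h.integral_condMean hΩ hp hf hφ j, ?_, ?_, fun i => ?_, fun i => ?_,
    fun i => ?_, fun i => ?_⟩
  · filter_upwards [hq] with x hx using hx.1
  · filter_upwards [hq] with x hx using hx.2
  -- Almost every point lies in the support of `μ`, so the support constraint holds almost
  -- everywhere and passes to the mean through convexity of the slices.
  · have h1 : ∀ᵐ x ∂μ.fst, condMean μ x ∈ {q | (x, q) ∈ P.bulkSet i} := by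
      refine ae_condMean_mem i1 ?_ ?_
      · filter_upwards [hb, Measure.support_mem_ae (μ := μ)] with w hw hw'
          using hf.supp i ⟨hw', hw⟩
      · rw [hfst]
        filter_upwards [ae_restrict_mem hΩ.isOpen.measurableSet] with x hx
        exact P.convex_bulkSet_slice hc i hx
    rw [hfst] at h1
    filter_upwards [h1] with x hx using hx.2
  · have h1 : ∀ᵐ x ∂μ'.fst, condMean μ' x ∈ {q | (x, q) ∈ P.bdrySet i} := by
      refine ae_condMean_mem i2 ?_ ?_
      · filter_upwards [Measure.support_mem_ae (μ := μ')] with w hw' using hf.supp' i hw'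
      · rw [hfst']
        filter_upwards [ae_surf_mem_frontier] with x hx
        exact P.convex_bdrySet_slice hc i hx
    rw [hfst'] at h1
    filter_upwards [h1] with x hx using hx.2
  · exact (P.extIntegral_condMean_le_bulk hΩ hc hfst i1 hb (hr.C_meas i)
      fun x hx => hc.C_convex i x hx).trans (hf.bulk_int i)
  · exact (P.extIntegral_condMean_le_bdry hc hfst' i2 hb' (hr.C'_meas i)
      fun x hx => hc.C'_convex i x hx).trans (hf.bdry_int i)

theorem Problem.M_le_MrAff (hΩ : IsLipschitzDomain P.Ω) (hr : P.IsRegular) (hc : P.IsConvex)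
    (hp : 1 ≤ p) : P.M p ≤ P.MrAff p := by
  refine le_sInf ?_
  rintro _ ⟨μ, μ', h, hf, rfl⟩
  have := h.isFiniteMeasure hΩ
  have := h.isFiniteMeasure' hΩ hp
  have h1 : P.M p ≤ extIntegral (volume.restrict P.Ω) (fun x => P.L (x, condMean μ x)) :=
    sInf_le ⟨_, _, _, h.isAdmissible hΩ hr hc hp hf, rfl⟩
  exact h1.trans <| P.extIntegral_condMean_le_bulk hΩ hc (h.fst_eq hΩ hp hf) (h.integrable_snd hΩ hp hf).1
    hf.ae_mem_bulk hr.L_meas hc.L_convex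

end MeanFunction

end OccMeasure

end

theorem mainTheorem2 {n m : ℕ} (hn : 1 ≤ n) {I : Type*} (p : ℝ≥0∞) (hp : 1 ≤ p)
    (P : OccMeasure.Problem n m I) (hΩ : OccMeasure.IsLipschitzDomain P.Ω)
    (hreg : P.IsRegular) (hconv : P.IsConvex) :
    P.Mr p = P.MrAff p ∧ P.MrAff p = P.M p := by
  have h1 : P.MrAff p ≤ P.Mr p := OccMeasure.Problem.MrAff_le_Mr
  have h2 : P.Mr p ≤ P.M p := OccMeasure.Problem.Mr_le_M hΩ hreg hconv hp
  have h3 : P.M p ≤ P.MrAff p := OccMeasure.Problem.M_le_MrAff hΩ hreg hconv hp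
  exact ⟨le_antisymm (h2.trans h3) h1, le_antisymm (h1.trans h2) h3⟩
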